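/- **Setting.** Let $\mathbb H^2=\{z\in\mathbb C:\operatorname{Im}z>0\}$, let $G=\mathrm{PSL}(2,\mathbb R)$ act on it by Möbius transformations, and let $H\subset G$ be the stabilizer of $i$. Let $\sigma:H\to S^1$ be the isomorphism which maps the class of $\begin{pmatrix}\cos(t/2)&\sin(t/2)\\-\sin(t/2)&\cos(t/2)\end{pmatrix}$ to $e^{it}$, let $\theta_1:S^1\to\mathrm{PU}(2)=\mathrm{SU}(2)/\{\pm I_2\}$ be the morphism $\theta_1(e^{it})=[\mathrm{diag}(e^{it/2},e^{-it/2})]$, and put $\chi=\theta_1\circ\sigma$. Let $\mathfrak h=\mathbb R b_3$ and $\mathfrak s=\langle b_1,b_2\rangle$, where $$b_1=\tfrac12\begin{pmatrix}0&1\\1&0\end{pmatrix},\quad b_2=\tfrac12\begin{pmatrix}1&0\\0&-1\end{pmatrix},\quad b_3=\tfrac12\begin{pmatrix}0&1\\-1&0\end{pmatrix},$$ and let $\mu_0:\mathfrak s\to\mathfrak{su}(2)$ be the linear map $\mu_0(u_1b_1+u_2b_2)=\tfrac12\begin{pmatrix}0&-u_1-iu_2\\u_1-iu_2&0\end{pmatrix}$.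 Let $P_\chi=G\times_\chi\mathrm{PU}(2)$ be the associated principal $\mathrm{PU}(2)$-bundle over $\mathbb H^2$, with projection $[g,k]\mapsto g\cdot i$. For $r\in\mathbb R$ let $A_{\chi,r\mu_0}$ be the connection on $P_\chi$ whose connection form is pulled back by $g\mapsto[g,e]$ to $\lambda_r\circ\omega_G$, where $\omega_G$ is the left Maurer–Cartan form of $G$ and $\lambda_r:\mathfrak{sl}(2,\mathbb R)\to\mathfrak{su}(2)$ is equal to $\chi_*$ on $\mathfrak h$ and to $r\mu_0$ on $\mathfrak s$. The left action of $G$ on $P_\chi$ preserves this connection. The group $\mathrm{PU}(2)$ is identified with $\mathrm{SO}(3)$ by the adjoint representation on $\mathfrak{su}(2)$, in the basis $$a_1=\tfrac12\begin{pmatrix}0&i\\i&0\end{pmatrix},\quad a_2=\tfrac12\begin{pmatrix}0&-1\\1&0\end{pmatrix},\quad a_3=\tfrac12\begin{pmatrix}i&0\\0&-i\end{pmatrix}.$$ **Proposition.** Let $\Gamma\subset\mathrm{PSL}(2,\mathbb R)$ be a subgroup acting freely and properly discontinuously on $\mathbb H^2$ with compact quotient $M=\mathbb H^2/\Gamma$.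 Give $\mathbb M:=\mathbb R\times M$ the product orientation, and put $M_t:=\{t\}\times M$. There exists a hyperbolic metric on $\mathbb M$ (a smooth Riemannian metric which is locally isometric to the upper half-space $\mathbb H^3$) such that, denoting by $\mathbb B$ its Levi-Civita connection on the bundle $\mathrm{SO}(\mathbb M)$ of positively oriented orthonormal frames: 1. $M_0$ is totally geodesic, and the metric induced on it is hyperbolic. 2. For any $x\in M$ the path $t\mapsto(t,x)$ is a geodesic of $\mathbb M$. 3. For any $t\in\mathbb R$ the surface $M_t$ is umbilic in $\mathbb M$, and the restriction $(\mathrm{SO}(\mathbb M)|_{M_t},\mathbb B|_{M_t})$ is isomorphic, over the identification $x\mapsto(t,x)$ of $M$ with $M_t$, to the $\Gamma$-quotient of $(P_\chi,A_{\chi,\sinh(t)\mu_0})$. -/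

import Mathlib

open scoped Manifold ContDiff Topology MatrixGroups UpperHalfPlane Bundle

noncomputable section

/-! ## Riemannian geometry -/

namespace HypCyl

section General

variable {E : Type*} [NormedAddCommGroup E] [NormedSpace ℝ E]
  {H : Type*} [TopologicalSpace H] {I : ModelWithCorners ℝ E H}
  {N : Type*} [TopologicalSpace N] [ChartedSpace H N] [IsManifold I ∞ N]

/-- `cov` is a Levi-Civita connection of the Riemannian metric `g`: it is torsion free and
`v ⟨X, Y⟩ = ⟨∇_v X, Y⟩ + ⟨X, ∇_v Y⟩`.  (Such a connection is unique on differentiable vector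
fields.) -/
def IsLeviCivita [FiniteDimensional ℝ E] [CompleteSpace E]
    (g : Bundle.ContMDiffRiemannianMetric I ∞ E (fun p : N => TangentSpace I p))
    (cov : CovariantDerivative I E (TangentSpace I : N → Type _)) : Prop :=
  cov.torsion = 0 ∧
  ∀ (p : N) (X Y : ∀ q : N, TangentSpace I q),
    MDifferentiableAt I I.tangent (fun q => (⟨q, X q⟩ : TangentBundle I N)) p →
    MDifferentiableAt I I.tangent (fun q => (⟨q, Y q⟩ : TangentBundle I N)) p →
    ∀ v : TangentSpace I p,
      mvfderiv I (fun q => g.inner q (X q) (Y q)) p v =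
        g.inner p (cov X p v) (Y p) + g.inner p (X p) (cov Y p v)

/-- The velocity of a curve. -/
def velocity (I : ModelWithCorners ℝ E H) (γ : ℝ → N) (s : ℝ) : TangentSpace I (γ s) :=
  mfderiv 𝓘(ℝ, ℝ) I γ s (1 : ℝ)

/-- `W` is the covariant derivative at the time `s₀` of the vector field `V` along the curve `γ`.
It is computed by the two rules that characterize the covariant derivative along a curve,
`D(fX)/ds = f' X + f DX/ds`, and `DX/ds = ∇_{γ'} X` when `X` is the restriction to `γ` of a vector
field of the manifold; every differentiable field along `γ` is near `s₀` a finite sum of products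
`f • X` of this kind, and the result does not depend on the choice of the sum. -/
def HasCovDerivAlong (cov : CovariantDerivative I E (TangentSpace I : N → Type _))
    (γ : ℝ → N) (V : ∀ s, TangentSpace I (γ s)) (s₀ : ℝ) (W : TangentSpace I (γ s₀)) : Prop :=
  MDifferentiableAt 𝓘(ℝ, ℝ) I γ s₀ ∧
  ∃ (m : ℕ) (f : Fin m → ℝ → ℝ) (X : Fin m → ∀ q : N, TangentSpace I q),
    (∀ k, DifferentiableAt ℝ (f k) s₀) ∧
    (∀ k, MDifferentiableAt I I.tangent
      (fun q => (⟨q, X k q⟩ : TangentBundle I N)) (γ s₀)) ∧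
    (∀ᶠ s in 𝓝 s₀, V s = ∑ k, f k s • X k (γ s)) ∧
    W = ∑ k, (deriv (f k) s₀ • X k (γ s₀) + f k s₀ • cov (X k) (γ s₀) (velocity I γ s₀))

/-- A geodesic: a smooth curve whose velocity is parallel along it. -/
def IsGeodesic (cov : CovariantDerivative I E (TangentSpace I : N → Type _)) (γ : ℝ → N) : Prop :=
  ContMDiff 𝓘(ℝ, ℝ) I ∞ γ ∧ ∀ s, HasCovDerivAlong cov γ (velocity I γ) s 0

variable {E' : Type*} [NormedAddCommGroup E'] [NormedSpace ℝ E']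
  {H' : Type*} [TopologicalSpace H'] {J : ModelWithCorners ℝ E' H'}
  {S : Type*} [TopologicalSpace S] [ChartedSpace H' S]

variable (I J) in
/-- The vector field `Y` of the ambient manifold is differentiable at `ι p` and is, along the
submanifold `ι : S → N`, tangent to the submanifold near `p`. -/
def IsTangentFieldAt (ι : S → N) (p : S)
    (Y : ∀ q : N, TangentSpace I q) : Prop :=
  MDifferentiableAt I I.tangent (fun q => (⟨q, Y q⟩ : TangentBundle I N)) (ι p) ∧
  ∀ᶠ q in 𝓝 p, ∃ w : TangentSpace J q, mfderiv J I ι q w = Y (ι q)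

/-- The submanifold `ι : S → N` is totally geodesic: its second fundamental form
`II(u, Y) = (∇_u Y)^⊥`, where `u` is tangent and `Y` is a tangent field, vanishes. -/
def IsTotallyGeodesic (J : ModelWithCorners ℝ E' H')
    (cov : CovariantDerivative I E (TangentSpace I : N → Type _)) (ι : S → N) : Prop :=
  ∀ (p : S) (Y : ∀ q : N, TangentSpace I q), IsTangentFieldAt I J ι p Y →
    ∀ u : TangentSpace J p, ∃ w : TangentSpace J p,
      cov Y (ι p) (mfderiv J I ι p u) = mfderiv J I ι p w

/-- The submanifold `ι : S → N` is umbilic: at each point `p` there is a normal vector `η` such that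
the second fundamental form at `p` is `II(u, Y) = ⟨u, Y⟩ η`. -/
def IsUmbilic (J : ModelWithCorners ℝ E' H')
    (g : Bundle.ContMDiffRiemannianMetric I ∞ E (fun p : N => TangentSpace I p))
    (cov : CovariantDerivative I E (TangentSpace I : N → Type _)) (ι : S → N) : Prop :=
  ∀ p : S, ∃ η : TangentSpace I (ι p),
    (∀ u : TangentSpace J p, g.inner (ι p) η (mfderiv J I ι p u) = 0) ∧
    ∀ Y : (∀ q : N, TangentSpace I q), IsTangentFieldAt I J ι p Y →
      ∀ u : TangentSpace J p, ∃ w : TangentSpace J p,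
        cov Y (ι p) (mfderiv J I ι p u) =
          g.inner (ι p) (mfderiv J I ι p u) (Y (ι p)) • η + mfderiv J I ι p w

/-- The family of scalar products `B` on the tangent spaces of `N` is a hyperbolic metric of
dimension `n + 1`: near each point there is a local diffeomorphism to the upper half-space
`{x ∈ ℝ^{n+1} | x_{n+1} > 0}` which carries `B` to `(∑ dx_i²) / x_{n+1}²`. -/
def IsHyperbolicMetric (n : ℕ) (B : ∀ q : N, TangentSpace I q → TangentSpace I q → ℝ) : Prop :=
  ∀ p : N, ∃ φ : N → EuclideanSpace ℝ (Fin (n + 1)),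
    IsLocalDiffeomorphAt I 𝓘(ℝ, EuclideanSpace ℝ (Fin (n + 1))) ∞ φ p ∧
    ∀ᶠ q in 𝓝 p, 0 < φ q (Fin.last n) ∧
      ∀ u v : TangentSpace I q,
        B q u v = inner ℝ (mvfderiv I φ q u) (mvfderiv I φ q v) / (φ q (Fin.last n)) ^ 2

/-- The metric induced on a submanifold `ι : S → N`. -/
def inducedMetric (J : ModelWithCorners ℝ E' H')
    (g : Bundle.ContMDiffRiemannianMetric I ∞ E (fun p : N => TangentSpace I p)) (ι : S → N) :
    ∀ p : S, TangentSpace J p → TangentSpace J p → ℝ :=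
  fun p u v => g.inner (ι p) (mfderiv J I ι p u) (mfderiv J I ι p v)

end General

end HypCyl

/-! ## The groups `PSL(2, ℝ)` and `PU(2)` -/

namespace HypCyl

/-- The action of `PSL(2, ℝ)` on the upper half-plane by Möbius transformations. -/
instance pslAction : MulAction PSL(2, ℝ) ℍ :=
  MulAction.compHom ℍ (Matrix.ProjectiveSpecialLinearGroup.toPGL (n := Fin 2) (R := ℝ))

/-- The class in `PSL(2, ℝ)` of a matrix. -/
def toPSL (A : SL(2, ℝ)) : PSL(2, ℝ) := QuotientGroup.mk A

theorem toPSL_smul (A : SL(2, ℝ)) (z : ℍ) : toPSL A • z = A • z := by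
  change Matrix.ProjectiveSpecialLinearGroup.toPGL (toPSL A) • z = _
  rw [toPSL, Matrix.ProjectiveSpecialLinearGroup.toPGL_mk, UpperHalfPlane.pglMk_smul]
  rfl

/-- The stabilizer of the point `i`. -/
abbrev stabI : Subgroup PSL(2, ℝ) := MulAction.stabilizer PSL(2, ℝ) UpperHalfPlane.I

/-- `SU(2)`. -/
abbrev SU2 : Type := Matrix.specialUnitaryGroup (Fin 2) ℂ

/-- The subgroup `{±1}` of `SU(2)`. -/
def pmOne : Subgroup SU2 where
  carrier := {B | B.1 = 1 ∨ B.1 = -1}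
  one_mem' := Or.inl rfl
  mul_mem' := by
    rintro A B hA hB
    change (A.1 * B.1 = 1 ∨ A.1 * B.1 = -1)
    rcases hA with hA | hA <;> rcases hB with hB | hB <;> rw [hA, hB] <;> simp
  inv_mem' := by
    rintro A hA
    change (star A.1 = 1 ∨ star A.1 = -1)
    rcases hA with hA | hA <;> rw [hA] <;> simp

instance : pmOne.Normal where
  conj_mem := by
    intro n hn g
    have hg : g.1 * star g.1 = 1 := g.2.1.2
    change (g.1 * n.1 * star g.1 = 1 ∨ g.1 * n.1 * star g.1 = -1)
    rcases hn with hn | hn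
    · left; rw [hn]; simp [hg]
    · right; rw [hn]; simp [hg]

/-- `PU(2) = SU(2)/{±1}`. -/
abbrev PU2 : Type := SU2 ⧸ pmOne

/-- The class in `PU(2)` of a matrix. -/
def toPU (B : SU2) : PU2 := QuotientGroup.mk B

/-- The standard monomorphism `τ : S¹ → SU(2)`, `τ(ζ) = diag(ζ, ζ⁻¹)`. -/
def tau : Circle →* SU2 where
  toFun ζ := ⟨!![(ζ : ℂ), 0; 0, star (ζ : ℂ)], by
    have h : (starRingEnd ℂ) (ζ : ℂ) * (ζ : ℂ) = 1 := by
      rw [← Complex.normSq_eq_conj_mul_self]; simp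
    have h' : (ζ : ℂ) * (starRingEnd ℂ) (ζ : ℂ) = 1 := by rw [mul_comm]; exact h
    refine Matrix.mem_specialUnitaryGroup_iff.2 ⟨Matrix.mem_unitaryGroup_iff.2 ?_, ?_⟩
    · ext i j
      fin_cases i <;> fin_cases j <;>
        simp [Matrix.mul_apply, Matrix.star_apply, h, h']
    · simp [Matrix.det_fin_two, h']⟩
  map_one' := by
    apply Subtype.ext
    ext i j
    fin_cases i <;> fin_cases j <;> simp
  map_mul' a b := by
    apply Subtype.ext
    change _ = _ * _
    ext i j
    fin_cases i <;> fin_cases j <;> simp [Matrix.mul_apply, mul_comm]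

theorem toPU_tau_eq_of_sq {w w' : Circle} (h : w ^ 2 = w' ^ 2) : toPU (tau w) = toPU (tau w') := by
  have hs : (w⁻¹ * w') ^ 2 = 1 := by rw [mul_pow, inv_pow, h, inv_mul_cancel]
  have hs' : ((w⁻¹ * w' : Circle) : ℂ) ^ 2 = 1 := by
    rw [← Circle.coe_pow, hs]; rfl
  refine QuotientGroup.eq.2 ?_
  rw [← map_inv, ← map_mul]
  rcases (sq_eq_sq_iff_eq_or_eq_neg.1 (hs'.trans (one_pow 2).symm)) with hc | hc
  · left
    ext i j
    fin_cases i <;> fin_cases j <;> simp_all [tau]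
  · right
    ext i j
    fin_cases i <;> fin_cases j <;> simp_all [tau]

/-- The standard monomorphism `θ : S¹ → PU(2)`, `θ(e^{it}) = [τ(e^{it/2})]`. -/
def theta : Circle →* PU2 where
  toFun ζ := toPU (tau (Circle.exp (Complex.arg (ζ : ℂ) / 2)))
  map_one' := by simp [toPU]
  map_mul' a b := by
    have key : ∀ c : Circle, Circle.exp (Complex.arg (c : ℂ) / 2) ^ 2 = c := by
      intro c
      rw [← Circle.exp_nsmul]
      simp [mul_div_cancel₀, Circle.exp_arg]
    change _ = toPU (tau _ * tau _)
    rw [← map_mul]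
    apply toPU_tau_eq_of_sq
    rw [mul_pow, key, key, key]

theorem theta_sq (w : Circle) : theta (w ^ 2) = toPU (tau w) := by
  apply toPU_tau_eq_of_sq
  rw [← Circle.exp_nsmul]
  simp only [nsmul_eq_mul, Nat.cast_ofNat, ne_eq, OfNat.ofNat_ne_zero, not_false_eq_true,
    mul_div_cancel₀, Circle.exp_arg]

theorem theta_exp (t : ℝ) : theta (Circle.exp t) = toPU (tau (Circle.exp (t / 2))) := by
  rw [← theta_sq, ← Circle.exp_nsmul]
  congr 2
  simp [mul_div_cancel₀]

/-- The number `(a + i b)²` attached to the class in `PSL(2, ℝ)` of a matrix with first row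
`(a, b)`. -/
def rowSq : PSL(2, ℝ) → ℂ :=
  Quotient.lift (fun A : SL(2, ℝ) => ((A 0 0 : ℂ) + A 0 1 * Complex.I) ^ 2) (by
    intro A B h
    have h' : A⁻¹ * B ∈ Subgroup.center SL(2, ℝ) := QuotientGroup.leftRel_apply.1 h
    obtain ⟨r, hr, hc⟩ := Matrix.SpecialLinearGroup.mem_center_iff.1 h'
    have hB : B.1 = A.1 * Matrix.scalar (Fin 2) r := by
      rw [hc, ← Matrix.SpecialLinearGroup.coe_mul, mul_inv_cancel_left]
    have h0 : B 0 0 = A 0 0 * r := by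
      rw [hB]; simp
    have h1 : B 0 1 = A 0 1 * r := by
      rw [hB]; simp
    have hr' : (r : ℂ) ^ 2 = 1 := by
      have : r ^ 2 = 1 := by simpa using hr
      exact_mod_cast this
    simp only [h0, h1, Complex.ofReal_mul]
    linear_combination -((A 0 0 : ℂ) + A 0 1 * Complex.I) ^ 2 * hr')

theorem rowSq_toPSL (A : SL(2, ℝ)) :
    rowSq (toPSL A) = ((A 0 0 : ℂ) + A 0 1 * Complex.I) ^ 2 := rfl

theorem toPSL_surjective : Function.Surjective toPSL := Quotient.mk_surjective

/-- The matrices whose class fixes `i` are those of `SO(2)`. -/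
theorem toPSL_mem_stabI {A : SL(2, ℝ)} (h : toPSL A ∈ stabI) :
    A 1 1 = A 0 0 ∧ A 1 0 = - A 0 1 ∧ A 0 0 ^ 2 + A 0 1 ^ 2 = 1 := by
  have h1 : A • UpperHalfPlane.I = UpperHalfPlane.I := by
    rw [← toPSL_smul]; exact h
  have hd : A 0 0 * A 1 1 - A 0 1 * A 1 0 = 1 := by
    rw [← Matrix.det_fin_two]; exact A.2
  have h2 := congrArg (fun z : ℍ => (z : ℂ)) h1
  simp only [UpperHalfPlane.coe_specialLinearGroup_apply, UpperHalfPlane.coe_I] at h2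
  have hne : ((A 1 0 : ℂ) * Complex.I + (A 1 1 : ℂ)) ≠ 0 := by
    intro h0
    have hre := congrArg Complex.re h0
    have him := congrArg Complex.im h0
    simp at hre him
    rw [hre, him] at hd
    simp at hd
  have h3 := (div_eq_iff hne).1 h2
  have hre := congrArg Complex.re h3
  have him := congrArg Complex.im h3
  simp at hre him
  refine ⟨by linarith, by linarith, ?_⟩
  have e1 : A 1 1 = A 0 0 := by linarith
  have e2 : A 1 0 = - A 0 1 := by linarith
  rw [e1, e2] at hd
  linarith

/-- The isomorphism `σ` from the stabilizer of `i` to `S¹` which maps the class of the matrix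
`((cos (t/2), sin (t/2)), (-sin (t/2), cos (t/2)))` to `e^{it}`. -/
def sigma : stabI →* Circle where
  toFun h := ⟨rowSq h.1, by
    obtain ⟨g, hg⟩ := h
    obtain ⟨A, rfl⟩ := toPSL_surjective g
    have hn := (toPSL_mem_stabI hg).2.2
    have : Complex.normSq ((A 0 0 : ℂ) + A 0 1 * Complex.I) = 1 := by
      rw [Complex.normSq_add_mul_I]; exact hn
    change rowSq (toPSL A) ∈ Metric.sphere (0 : ℂ) 1
    rw [mem_sphere_zero_iff_norm, rowSq_toPSL, norm_pow, Complex.sq_norm, this]⟩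
  map_one' := by
    apply Circle.ext
    change rowSq (toPSL 1) = 1
    rw [rowSq_toPSL]
    simp
  map_mul' := by
    rintro ⟨g, hg⟩ ⟨g', hg'⟩
    obtain ⟨A, rfl⟩ := toPSL_surjective g
    obtain ⟨B, rfl⟩ := toPSL_surjective g'
    apply Circle.ext
    change rowSq (toPSL (A * B)) = rowSq (toPSL A) * rowSq (toPSL B)
    obtain ⟨-, -, -⟩ := toPSL_mem_stabI hg
    obtain ⟨hb1, hb2, -⟩ := toPSL_mem_stabI hg'
    have e0 : (A * B) 0 0 = A 0 0 * B 0 0 + A 0 1 * B 1 0 := by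
      simp [Matrix.mul_apply, Fin.sum_univ_two]
    have e1 : (A * B) 0 1 = A 0 0 * B 0 1 + A 0 1 * B 1 1 := by
      simp [Matrix.mul_apply, Fin.sum_univ_two]
    rw [rowSq_toPSL, rowSq_toPSL, rowSq_toPSL, e0, e1, hb1, hb2, ← mul_pow]
    congr 1
    push_cast
    linear_combination (-(A 0 1 : ℂ) * B 0 1) * Complex.I_sq

theorem sigma_coe (A : SL(2, ℝ)) (h : toPSL A ∈ stabI) :
    ((sigma ⟨toPSL A, h⟩ : Circle) : ℂ) = ((A 0 0 : ℂ) + A 0 1 * Complex.I) ^ 2 := rfl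

/-- The one-parameter group of matrices
`((cos (t/2), sin (t/2)), (-sin (t/2), cos (t/2)))`. -/
def rot (t : ℝ) : SL(2, ℝ) :=
  ⟨!![Real.cos (t / 2), Real.sin (t / 2); -Real.sin (t / 2), Real.cos (t / 2)], by
    rw [Matrix.det_fin_two_of]; nlinarith [Real.sin_sq_add_cos_sq (t / 2)]⟩

theorem sigma_rot (t : ℝ) (h : toPSL (rot t) ∈ stabI) :
    sigma ⟨toPSL (rot t), h⟩ = Circle.exp t := by
  apply Circle.ext
  rw [sigma_coe, Circle.coe_exp]
  have : ((rot t 0 0 : ℝ) : ℂ) + (rot t 0 1 : ℝ) * Complex.I =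
      Complex.exp ((t / 2 : ℝ) * Complex.I) := by
    rw [Complex.exp_mul_I]
    change ((Real.cos (t / 2) : ℝ) : ℂ) + ((Real.sin (t / 2) : ℝ) : ℂ) * Complex.I = _
    push_cast; rfl
  rw [this, ← Complex.exp_nat_mul]
  congr 1
  push_cast; ring

/-- The morphism `χ = θ₁ ∘ σ` from the stabilizer of `i` to `PU(2)`. -/
def chi : stabI →* PU2 := theta.comp sigma

theorem chi_rot (t : ℝ) (h : toPSL (rot t) ∈ stabI) :
    chi ⟨toPSL (rot t), h⟩ = toPU (tau (Circle.exp (t / 2))) := by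
  rw [← theta_exp, ← sigma_rot t h]; rfl

/-! ### The Lie algebras -/

/-- The basis `(a₁, a₂, a₃)` of `su(2)`. -/
def a : Fin 3 → Matrix (Fin 2) (Fin 2) ℂ :=
  ![(1 / 2 : ℂ) • !![0, Complex.I; Complex.I, 0],
    (1 / 2 : ℂ) • !![0, -1; 1, 0],
    (1 / 2 : ℂ) • !![Complex.I, 0; 0, -Complex.I]]

/-- The coordinate of an element of `su(2)` with respect to the element `a_i` of the basis, computed
through the invariant scalar product `-2 tr(XY)`, for which `(a₁, a₂, a₃)` is orthonormal. -/
def coord (X : Matrix (Fin 2) (Fin 2) ℂ) (i : Fin 3) : ℝ := (-2 * (a i * X).trace).re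

theorem coord_sum (x : Fin 3 → ℝ) (i : Fin 3) : coord (∑ j, (x j : ℂ) • a j) i = x i := by
  fin_cases i <;>
    simp [coord, a, Fin.sum_univ_three, Matrix.trace_fin_two] <;> ring

/-- The matrix, in the basis `(a₁, a₂, a₃)`, of the adjoint action `X ↦ B X B⁻¹` of an element of
`PU(2)` on `su(2)`.  This is the standard isomorphism `PU(2) → SO(su(2)) = SO(3)`. -/
def Ad : PU2 → Matrix (Fin 3) (Fin 3) ℝ :=
  Quotient.lift (fun B : SU2 => Matrix.of fun i j => coord (B.1 * a j * star B.1) i) (by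
    intro B B' h
    have h' : B⁻¹ * B' ∈ pmOne := QuotientGroup.leftRel_apply.1 h
    have hB : B.1 * star B.1 = 1 := B.2.1.2
    have key : ∀ X : Matrix (Fin 2) (Fin 2) ℂ, B.1 * X * star B.1 = B'.1 * X * star B'.1 := by
      intro X
      have e : B'.1 = B.1 * (star B.1 * B'.1) := by rw [← mul_assoc, hB, one_mul]
      have h2 : star B.1 * B'.1 = 1 ∨ star B.1 * B'.1 = -1 := h'
      rcases h2 with h2 | h2
      · rw [h2, mul_one] at e; rw [e]
      · rw [h2] at e; rw [e]; simp
    ext i j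
    simp only [Matrix.of_apply, key])

theorem Ad_toPU (B : SU2) (i j : Fin 3) : Ad (toPU B) i j = coord (B.1 * a j * star B.1) i := rfl

/-- The matrix, in the basis `(a₁, a₂, a₃)`, of `ad X` for an element `X` of `su(2)`.  This is the
derivative `su(2) → so(3)` of the isomorphism `Ad`. -/
def ad (X : Matrix (Fin 2) (Fin 2) ℂ) : Matrix (Fin 3) (Fin 3) ℝ :=
  Matrix.of fun i j => coord (X * a j - a j * X) i

/-- The basis `(b₁, b₂, b₃)` of `sl(2, ℝ)`; `b₁, b₂` span the complement `𝔰` of the Lie algebra `𝔥`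
of the stabilizer of `i`, which is spanned by `b₃`. -/
def b : Fin 3 → Matrix (Fin 2) (Fin 2) ℝ :=
  ![(1 / 2 : ℝ) • !![0, 1; 1, 0],
    (1 / 2 : ℝ) • !![1, 0; 0, -1],
    (1 / 2 : ℝ) • !![0, 1; -1, 0]]

/-- The coordinates of an element of `sl(2, ℝ)` in the basis `(b₁, b₂, b₃)`. -/
def slCoord (X : Matrix (Fin 2) (Fin 2) ℝ) : Fin 3 → ℝ := ![X 0 1 + X 1 0, 2 * X 0 0, X 0 1 - X 1 0]

theorem sum_slCoord {X : Matrix (Fin 2) (Fin 2) ℝ} (hX : X.trace = 0) :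
    ∑ j, slCoord X j • b j = X := by
  rw [Matrix.trace_fin_two] at hX
  ext i j
  fin_cases i <;> fin_cases j <;> simp [slCoord, b, Fin.sum_univ_three] <;> linarith

/-- The `S¹`-equivariant linear map `μ₀ : 𝔰 → su(2)`, as a function of the coordinates `u₁, u₂`. -/
def mu0 (u₁ u₂ : ℝ) : Matrix (Fin 2) (Fin 2) ℂ :=
  (1 / 2 : ℂ) • !![0, -u₁ - Complex.I * u₂; u₁ - Complex.I * u₂, 0]

/-- The linear map `λ : sl(2, ℝ) → su(2)` which is equal to the derivative `χ_*` of `χ` on `𝔥` and to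
`r μ₀` on `𝔰`. One has `χ_*(b₃) = a₃`, since `b₃` is the velocity at `0` of `rot` and `a₃` is the
velocity at `0` of `t ↦ τ(e^{it/2})`. -/
def lam (r : ℝ) (X : Matrix (Fin 2) (Fin 2) ℝ) : Matrix (Fin 2) (Fin 2) ℂ :=
  (slCoord X 2 : ℂ) • a 2 + (r : ℂ) • mu0 (slCoord X 0) (slCoord X 1)

theorem hasDerivAt_rot (i j : Fin 2) : HasDerivAt (fun t => rot t i j) (b 2 i j) 0 := by
  have hc : HasDerivAt (fun t : ℝ => Real.cos (t / 2)) 0 0 := by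
    simpa using ((hasDerivAt_id (0 : ℝ)).div_const 2).cos
  have hs : HasDerivAt (fun t : ℝ => Real.sin (t / 2)) (1 / 2) 0 := by
    simpa using ((hasDerivAt_id (0 : ℝ)).div_const 2).sin
  fin_cases i <;> fin_cases j
  · simpa [rot, b] using hc
  · simpa [rot, b] using hs
  · simpa [rot, b] using! hs.neg
  · simpa [rot, b] using hc

theorem hasDerivAt_tau (i j : Fin 2) :
    HasDerivAt (fun t : ℝ => (tau (Circle.exp (t / 2))).1 i j) (a 2 i j) 0 := by
  have he : HasDerivAt (fun t : ℝ => Complex.exp ((t / 2 : ℝ) * Complex.I)) (Complex.I / 2) 0 := by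
    have h1 : HasDerivAt (fun t : ℝ => (((t / 2 : ℝ) : ℂ)) * Complex.I) (Complex.I / 2) 0 := by
      have := (((hasDerivAt_id (0 : ℝ)).div_const 2).ofReal_comp).mul_const Complex.I
      convert! this using 1
      push_cast; ring
    simpa using h1.cexp
  have hs := he.star
  fin_cases i <;> fin_cases j
  · simpa [tau, a, Circle.coe_exp, div_eq_inv_mul] using he
  · simpa [tau, a] using hasDerivAt_const (0 : ℝ) (0 : ℂ)
  · simpa [tau, a] using hasDerivAt_const (0 : ℝ) (0 : ℂ)
  · simpa [tau, a, Circle.coe_exp, div_eq_inv_mul] using hs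

/-! ## The homogeneous bundle and its connection -/

/-- The relation `(g h, k) ∼ (g, χ(h) k)`, for `h` in the stabilizer of `i`. -/
def assocSetoid : Setoid (PSL(2, ℝ) × PU2) where
  r p q := ∃ h : stabI, q.1 = p.1 * h ∧ p.2 = chi h * q.2
  iseqv :=
    { refl := fun p => ⟨1, by simp⟩
      symm := by
        rintro p q ⟨h, h1, h2⟩
        exact ⟨h⁻¹, by simp [h1], by simp [h2]⟩
      trans := by
        rintro p q r ⟨h, h1, h2⟩ ⟨h', h1', h2'⟩
        exact ⟨h * h', by simp [h1, h1', mul_assoc], by simp [h2, h2', mul_assoc]⟩ }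

/-- The total space of the bundle `P_χ = PSL(2, ℝ) ×_χ PU(2)` over `ℍ`, with projection
`[g, k] ↦ g i` and right action `[g, k] k' = [g, k k']`. -/
def P : Type := Quotient assocSetoid

/-- The left action `γ [g, k] = [γ g, k]` of `PSL(2, ℝ)` on `P_χ`. -/
instance : MulAction PSL(2, ℝ) P where
  smul γ := Quotient.map (fun p => (γ * p.1, p.2)) (by
    rintro p q ⟨h, h1, h2⟩
    exact ⟨h, by simp [h1, mul_assoc], h2⟩)
  one_smul := by
    rintro ⟨p⟩
    exact congrArg (Quotient.mk assocSetoid) (by simp)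
  mul_smul := by
    rintro γ γ' ⟨p⟩
    exact congrArg (Quotient.mk assocSetoid) (by simp [mul_assoc])

/-- The total space of the `Γ`-quotient of `P_χ`. -/
def GammaQuotient (Γ : Subgroup PSL(2, ℝ)) : Type := MulAction.orbitRel.Quotient Γ P

/-- The point of the `Γ`-quotient of `P_χ` represented by `[g, k]`. -/
def GammaQuotient.mk (Γ : Subgroup PSL(2, ℝ)) (g : PSL(2, ℝ)) (k : PU2) : GammaQuotient Γ :=
  Quotient.mk (MulAction.orbitRel Γ P) (Quotient.mk assocSetoid (g, k))

/-- A map from a normed space to `SL(2, ℝ)` is smooth if its matrix entries are. -/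
def SmoothSL {W : Type*} [NormedAddCommGroup W] [NormedSpace ℝ W] (A : W → SL(2, ℝ)) : Prop :=
  ∀ i j, ContDiff ℝ ∞ fun w => A w i j

/-- A map from a normed space to `SU(2)` is smooth if its matrix entries are. -/
def SmoothSU {W : Type*} [NormedAddCommGroup W] [NormedSpace ℝ W] (B : W → SU2) : Prop :=
  ∀ i j, ContDiff ℝ ∞ fun w => (B w).1 i j

/-- The connection form `A_{χ, r μ₀}`, evaluated on the velocity at the time `s` of the curve
`s ↦ [A(s), B(s)] = [A(s), 1] B(s)` of `P_χ`: it is `Ad(B⁻¹) λ(A⁻¹ A') + B⁻¹ B'`. In other words, the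
pull-back of `A_{χ, r μ₀}` by `g ↦ [g, 1]` is `λ` composed with the left Maurer-Cartan form.  This is
invariant by the left action of `PSL(2, ℝ)`, and is therefore also the connection form induced on the
`Γ`-quotient. -/
def connForm (r : ℝ) (A : ℝ → SL(2, ℝ)) (B : ℝ → SU2) (s : ℝ) : Matrix (Fin 2) (Fin 2) ℂ :=
  star (B s).1 * lam r (((A s)⁻¹).1 * Matrix.of fun i j => deriv (fun s => A s i j) s) * (B s).1 +
    star (B s).1 * Matrix.of fun i j => deriv (fun s => (B s).1 i j) s

/-! ## The cylinder `ℝ × M` over a quotient `M` of the hyperbolic plane -/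

section Cylinder

variable {M : Type*} [TopologicalSpace M] [ChartedSpace ℂ M]

/-- `pr : ℍ → M` presents the smooth surface `M` as the quotient `ℍ/Γ`: it is a surjective local
diffeomorphism whose fibres are the `Γ`-orbits. -/
structure IsQuotientBy (Γ : Subgroup PSL(2, ℝ)) (pr : ℍ → M) : Prop where
  isLocalDiffeomorph : IsLocalDiffeomorph 𝓘(ℝ, ℂ) 𝓘(ℝ, ℂ) ∞ pr
  surjective : Function.Surjective pr
  eq_iff : ∀ z w : ℍ, pr z = pr w ↔ ∃ γ ∈ Γ, γ • z = w

/-- The smooth structure of `ℝ × M`. -/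
abbrev cylModel : ModelWithCorners ℝ (ℝ × ℂ) (ModelProd ℝ ℂ) := 𝓘(ℝ, ℝ).prod 𝓘(ℝ, ℂ)

/-- The embedding of the slice `M_t = {t} × M` in `ℝ × M`. -/
def slice (t : ℝ) (x : M) : ℝ × M := (t, x)

/-- A point of the total space of the restriction to `M_t` of the bundle `SO(ℝ × M)` of positively
oriented orthonormal frames. A frame is positively oriented if it is the image by the differential of
`id × pr` of a basis of `ℝ × ℂ` which is positive with respect to the basis `(∂_t, 1, i)`. -/
@[ext]
structure SOFrame [IsManifold 𝓘(ℝ, ℂ) ∞ M] (pr : ℍ → M)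
    (g : Bundle.ContMDiffRiemannianMetric cylModel ∞ (ℝ × ℂ)
      (fun p : ℝ × M => TangentSpace cylModel p)) (t : ℝ) where
  /-- the base point -/
  pt : M
  /-- the vectors of the frame -/
  vec : Fin 3 → TangentSpace cylModel (slice t pt)
  orthonormal : ∀ i j, g.inner (slice t pt) (vec i) (vec j) = if i = j then 1 else 0
  positive : ∃ (z : ℍ) (C : Matrix (Fin 3) (Fin 3) ℝ), 0 < C.det ∧
    ∀ j, (⟨slice t pt, vec j⟩ : TangentBundle cylModel (ℝ × M)) =
      tangentMap cylModel cylModel (Prod.map id pr : ℝ × ℍ → ℝ × M)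
        ⟨(t, z), ((C 0 j, (C 1 j : ℂ) + C 2 j * Complex.I) : ℝ × ℂ)⟩

variable [IsManifold 𝓘(ℝ, ℂ) ∞ M] {pr : ℍ → M}
  {g : Bundle.ContMDiffRiemannianMetric cylModel ∞ (ℝ × ℂ)
    (fun p : ℝ × M => TangentSpace cylModel p)} {t : ℝ}

/-- The vectors of a frame, as points of the tangent bundle of `ℝ × M`. -/
def SOFrame.toTangent (F : SOFrame pr g t) (j : Fin 3) : TangentBundle cylModel (ℝ × M) :=
  ⟨slice t F.pt, F.vec j⟩

/-- `Φ` is an isomorphism from the `Γ`-quotient of `(P_χ, A_{χ, r μ₀})`, a `PU(2)`-bundle with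
connection on `M`, to the restriction to `M_t` of the `SO(3)`-bundle `SO(ℝ × M)`, with the connection
given by the Levi-Civita connection `cov`. It covers the identification `x ↦ (t, x)` of `M` with
`M_t`, and the structure groups are identified by `Ad : PU(2) → SO(3)`, where `SO(3)` acts on frames
by `(f R)_j = ∑ i, R_ij f_i`.

Smoothness is tested on smooth families `[A(w), B(w)]`, where the total space of the quotient has the
smooth structure for which `SL(2, ℝ) × SU(2)` submerses onto it. A smooth equivariant map of
principal bundles over a diffeomorphism is automatically a diffeomorphism. The connections correspond
to each other if, for every smooth curve `s ↦ [A(s), B(s)]`, the frame `f(s) = Φ [A(s), B(s)]`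
satisfies `D f_j/ds = ∑ i, ω_ij f_i`, where `ω` is the element of `so(3)` which corresponds to the
value of `A_{χ, r μ₀}` on the velocity of the curve. -/
structure IsIsomorphism (Γ : Subgroup PSL(2, ℝ))
    (cov : CovariantDerivative cylModel (ℝ × ℂ) (TangentSpace cylModel : ℝ × M → Type _)) (r : ℝ)
    (Φ : GammaQuotient Γ → SOFrame pr g t) : Prop where
  bijective : Function.Bijective Φ
  covers : ∀ (h : PSL(2, ℝ)) (k : PU2), (Φ (.mk Γ h k)).pt = pr (h • UpperHalfPlane.I)
  equivariant : ∀ (h : PSL(2, ℝ)) (k k' : PU2) (j : Fin 3),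
    (Φ (.mk Γ h (k * k'))).toTangent j =
      ⟨slice t (Φ (.mk Γ h k)).pt, ∑ i, Ad k' i j • (Φ (.mk Γ h k)).vec i⟩
  smooth : ∀ (m : ℕ) (A : EuclideanSpace ℝ (Fin m) → SL(2, ℝ)) (B : EuclideanSpace ℝ (Fin m) → SU2),
    SmoothSL A → SmoothSU B → ∀ j,
      ContMDiff 𝓘(ℝ, EuclideanSpace ℝ (Fin m)) cylModel.tangent ∞
        (fun w => (Φ (.mk Γ (toPSL (A w)) (toPU (B w)))).toTangent j)
  connection : ∀ (A : ℝ → SL(2, ℝ)) (B : ℝ → SU2), SmoothSL A → SmoothSU B → ∀ (s : ℝ) (j : Fin 3),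
    HasCovDerivAlong cov
      (fun s => slice t (Φ (.mk Γ (toPSL (A s)) (toPU (B s)))).pt)
      (fun s => (Φ (.mk Γ (toPSL (A s)) (toPU (B s)))).vec j) s
      (∑ i, ad (connForm r A B s) i j • (Φ (.mk Γ (toPSL (A s)) (toPU (B s)))).vec i)

end Cylinder

end HypCyl

end

/-! The metric is `dt² + cosh²(t) g_M`, where `g_M` comes from `|dz|²/y²` on `ℍ`. It is hyperbolic
because `(t, x + iy) ↦ (x, y tanh t, y / cosh t)` carries `dt² + cosh²(t) |dz|²/y²` to the metric of
the upper half-space (`inner_fderiv_toHalfSpace`). Everything is computed in developing charts, the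
local inverses of `pr`: two of them differ by an element of `Γ` (`IsQuotientBy.transition`), which
acts by an isometry (`warp_mob`), so the choice of chart is immaterial. The Levi-Civita connection
is written with explicit Christoffel symbols (`warpChr`). They show that `∂_t` is parallel along the
lines `t ↦ (t, x)` and that the second fundamental form of `M_t` is `-tanh(t) ⟨u, Y⟩ ∂_t`
(`IsQuotientBy.cylCov_slice_fst`), whence the geodesics, the umbilicity and the totally geodesic
slice `t = 0`.

For the bundles, `[g, k]` is sent to the frame at `pr (g i)` obtained by rotating `(g'(i)/cosh t, i
g'(i)/cosh t, ∂_t)` by `Ad k`. It is orthonormal because `|g'(i)| = Im (g i)`. It depends only on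
the class in `P_χ` because `h'(i) = σ(h)` when `h` fixes `i`, while `Ad (χ(h))` is the rotation by
`σ(h)` in the plane of `a₁, a₂`; it descends to the `Γ`-quotient by the chain rule for `pr ∘ γ =
pr`. Bijectivity comes down to `Ad` being an isomorphism from `PU(2)` onto `SO(3)` (`Ad_injective`,
`exists_Ad_eq`).

The equality of the connections is `hasDerivAt_frameVec`. Along a curve `[A, B]`, let `u₁, u₂, u₃`
be the coordinates of `X = A⁻¹A'`. The base point has velocity `g'(i) (u₁ + i u₂)`; the vector
`g'(i)` turns at the rate `u₃` relative to parallel transport in `ℍ`; and `Q = Ad B` satisfies `Q' =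
Q ad(ω) - ad(λ(X)) Q`. The entries `u₃` of `ad(λ(X))` cancel that rotation, and its entries `r u₁, r
u₂` cancel the Christoffel terms which mix `∂_t` with the slice, provided that `r = sinh t`. What is
left is `Df_j/ds = ∑ ω_ij f_i`. -/

noncomputable section

namespace HypCyl

/-! ### Connections given by Christoffel symbols in charts. -/

section ChartConnection

variable {E : Type*} [NormedAddCommGroup E] [NormedSpace ℝ E]
  {H : Type*} [TopologicalSpace H] {I : ModelWithCorners ℝ E H}
  {N : Type*} [TopologicalSpace N] [ChartedSpace H N]
  {F : Type*} [NormedAddCommGroup F] [NormedSpace ℝ F]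

theorem isLocalDiffeomorphAt_eventually {E' H' N' : Type*} [NormedAddCommGroup E']
    [NormedSpace ℝ E'] [TopologicalSpace H'] {J : ModelWithCorners ℝ E' H'} [TopologicalSpace N']
    [ChartedSpace H' N'] {f : N → N'} {p : N} (h : IsLocalDiffeomorphAt I J ∞ f p) :
    ∀ᶠ q in 𝓝 p, IsLocalDiffeomorphAt I J ∞ f q := by
  obtain ⟨Φ, hp, he⟩ := h
  filter_upwards [Φ.open_source.mem_nhds hp] with q hq using ⟨Φ, hq, he⟩

theorem mvfderiv_congr {f f' : N → F} {p : N} (h : f =ᶠ[𝓝 p] f') :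
    mvfderiv I f p = mvfderiv I f' p := by
  ext v
  exact congrArg (fun L : E →L[ℝ] F => L v) h.mfderiv_eq

theorem isInvertible_mfderiv {ψ : N → F} {p : N} (h : IsLocalDiffeomorphAt I 𝓘(ℝ, F) ∞ ψ p) :
    (mfderiv I 𝓘(ℝ, F) ψ p).IsInvertible :=
  ⟨h.mfderivToContinuousLinearEquiv (by simp), rfl⟩

/-- The differential of a local diffeomorphism to a normed space, as a linear equivalence. -/
def diffEquiv {ψ : N → F} {p : N} (h : IsLocalDiffeomorphAt I 𝓘(ℝ, F) ∞ ψ p) :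
    TangentSpace I p ≃L[ℝ] F :=
  (h.mfderivToContinuousLinearEquiv (by simp)).trans (NormedSpace.fromTangentSpace (ψ p))

theorem diffEquiv_apply {ψ : N → F} {p : N} (h : IsLocalDiffeomorphAt I 𝓘(ℝ, F) ∞ ψ p)
    (v : TangentSpace I p) : diffEquiv h v = mvfderiv I ψ p v := rfl

theorem mvfderiv_inj {ψ : N → F} {p : N} (h : IsLocalDiffeomorphAt I 𝓘(ℝ, F) ∞ ψ p)
    {v w : TangentSpace I p} : mvfderiv I ψ p v = mvfderiv I ψ p w ↔ v = w := by
  rw [← diffEquiv_apply h, ← diffEquiv_apply h, EmbeddingLike.apply_eq_iff_eq]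

theorem hasMFDerivAt_prodMk {F' : Type*} [NormedAddCommGroup F'] [NormedSpace ℝ F']
    {f : N → F} {g : N → F'} {p : N} {f' : TangentSpace I p →L[ℝ] F}
    {g' : TangentSpace I p →L[ℝ] F'}
    (hf : HasMFDerivAt I 𝓘(ℝ, F) f p f') (hg : HasMFDerivAt I 𝓘(ℝ, F') g p g') :
    HasMFDerivAt I 𝓘(ℝ, F × F') (fun q => (f q, g q)) p (f'.prod g') :=
  ⟨hf.1.prodMk hg.1, hf.2.prodMk hg.2⟩

/-- The vector field with constant components in a chart. -/
def coordField (I : ModelWithCorners ℝ E H) (ψ : N → F) (e : F) : ∀ q : N, TangentSpace I q :=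
  VectorField.mpullback I 𝓘(ℝ, F) ψ (fun _ => e)

theorem mvfderiv_coordField {ψ : N → F} {p : N} (h : IsLocalDiffeomorphAt I 𝓘(ℝ, F) ∞ ψ p)
    (e : F) : mvfderiv I ψ p (coordField I ψ e p) = e := by
  obtain ⟨L, hL⟩ := isInvertible_mfderiv h
  change mfderiv I 𝓘(ℝ, F) ψ p ((mfderiv I 𝓘(ℝ, F) ψ p).inverse e) = e
  rw [← hL, ContinuousLinearMap.inverse_equiv]
  exact L.apply_symm_apply e

theorem coordField_mvfderiv {ψ : N → F} {p : N} (h : IsLocalDiffeomorphAt I 𝓘(ℝ, F) ∞ ψ p)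
    (v : TangentSpace I p) : coordField I ψ (mvfderiv I ψ p v) p = v := by
  rw [← mvfderiv_inj h, mvfderiv_coordField h]

variable [IsManifold I ∞ N]

/-- A differentiable vector field has differentiable components in a chart. -/
theorem mdifferentiableAt_mvfderiv_apply {ψ : N → F} {p : N} (hψ : ContMDiffAt I 𝓘(ℝ, F) ∞ ψ p)
    {Y : ∀ q : N, TangentSpace I q}
    (hY : MDifferentiableAt I I.tangent (fun q => (⟨q, Y q⟩ : TangentBundle I N)) p) :
    MDifferentiableAt I 𝓘(ℝ, F) (fun q => mvfderiv I ψ q (Y q)) p := by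
  have hm : MDifferentiableAt I 𝓘(ℝ, E →L[ℝ] F)
      (inTangentCoordinates I 𝓘(ℝ, F) id ψ (fun q => mfderiv I 𝓘(ℝ, F) ψ q) p) p :=
    (hψ.mfderiv_const (m := 1) (by decide)).mdifferentiableAt (by simp)
  have := MDifferentiableAt.clm_apply_of_inCoordinates (F₁ := E) (F₂ := F)
    (E₁ := TangentSpace I) (E₂ := TangentSpace 𝓘(ℝ, F)) (b₁ := id) (b₂ := ψ)
    (ϕ := fun q => mfderiv I 𝓘(ℝ, F) ψ q) (v := Y) (m₀ := p) hm hY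
    (hψ.mdifferentiableAt (by simp))
  exact ((contMDiff_snd_tangentBundle_modelSpace F 𝓘(ℝ, F) (n := 1)).mdifferentiable
    (by simp)).mdifferentiableAt.comp p this

theorem mdifferentiableAt_const_field (e x : F) :
    MDifferentiableAt 𝓘(ℝ, F) 𝓘(ℝ, F).tangent
      (fun y => (⟨y, e⟩ : TangentBundle 𝓘(ℝ, F) F)) x :=
  ((contMDiff_vectorSpace_iff_contDiff (n := 1) (V := fun _ => e)).2
    contDiff_const).mdifferentiable (by simp) x

theorem mdifferentiableAt_coordField [CompleteSpace E] {ψ : N → F} {p : N}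
    (h : IsLocalDiffeomorphAt I 𝓘(ℝ, F) ∞ ψ p) (e : F) :
    MDifferentiableAt I I.tangent
      (fun q => (⟨q, coordField I ψ e q⟩ : TangentBundle I N)) p :=
  MDifferentiableAt.mpullback_vectorField (mdifferentiableAt_const_field e _)
    h.contMDiffAt (isInvertible_mfderiv h) (by decide)

/-- The bracket is natural under pull-back by a local diffeomorphism, and constant fields commute.
-/
theorem mlieBracket_coordField [CompleteSpace E] [CompleteSpace F] {ψ : N → F} {p : N}
    (h : IsLocalDiffeomorphAt I 𝓘(ℝ, F) ∞ ψ p) (e e' : F) :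
    VectorField.mlieBracket I (coordField I ψ e) (coordField I ψ e') p = 0 := by
  have : IsManifold I (minSmoothness ℝ 2) N := by
    rw [minSmoothness_of_isRCLikeNormedField]
    exact IsManifold.of_le (n := ∞) (by decide)
  have := VectorField.mpullback_mlieBracket (I := I) (I' := 𝓘(ℝ, F)) (f := ψ) (x₀ := p) (n := ∞)
    (mdifferentiableAt_const_field e _) (mdifferentiableAt_const_field e' _) h.contMDiffAt
    (by simp; decide)
  unfold coordField
  have h0 : VectorField.mlieBracket 𝓘(ℝ, F) (fun _ => e) (fun _ => e') (ψ p) = (0 : F) := by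
    have h1 := VectorField.mlieBracketWithin_eq_lieBracketWithin (𝕜 := ℝ) (E := F)
      (V := fun _ => e) (W := fun _ => e') (s := Set.univ)
    have h2 := VectorField.mlieBracketWithin_univ (I := 𝓘(ℝ, F)) (V := fun _ : F => e)
      (W := fun _ => e')
    refine (congrFun (h2.symm.trans h1) (ψ p)).trans ?_
    change fderivWithin ℝ (fun _ : F => e') Set.univ (ψ p) e -
      fderivWithin ℝ (fun _ : F => e) Set.univ (ψ p) e' = 0
    simp
  rw [← this, VectorField.mpullback_apply]
  exact (congrArg (mfderiv I 𝓘(ℝ, F) ψ p).inverse h0).trans (map_zero _)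

/-- The connection which in the chart `ψ p`, at the point `p`, has the Christoffel symbols
`Chr p`. -/
def chartCov (ψ : N → N → F) (hψ : ∀ p, IsLocalDiffeomorphAt I 𝓘(ℝ, F) ∞ (ψ p) p)
    (Chr : N → F →L[ℝ] F →L[ℝ] F) :
    CovariantDerivative I E (TangentSpace I : N → Type _) where
  -- In the chart `ψ p` this is `dY + Chr(Y, ·)`. Each chart is used only to compute at its own
  -- point `p`, so no compatibility between `ψ p` and `ψ q`, or between their symbols, has to be
  -- assumed.
  toFun Y p := ((diffEquiv (hψ p)).symm : F →L[ℝ] TangentSpace I p) ∘L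
    (mvfderiv I (fun q => mvfderiv I (ψ p) q (Y q)) p +
      Chr p (mvfderiv I (ψ p) p (Y p)) ∘L mvfderiv I (ψ p) p)
  isCovariantDerivativeOnUniv :=
    { add := by
        intro Y Y' p hY hY' _
        have h1 := mdifferentiableAt_mvfderiv_apply (hψ p).contMDiffAt hY
        have h2 := mdifferentiableAt_mvfderiv_apply (hψ p).contMDiffAt hY'
        have : (fun q => mvfderiv I (ψ p) q ((Y + Y') q)) =
            (fun q => mvfderiv I (ψ p) q (Y q)) + fun q => mvfderiv I (ψ p) q (Y' q) := by
          ext q; simp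
        rw [this, mvfderiv_add h1 h2]
        ext v
        simp
        abel
      leibniz := by
        intro Y f p hY hf _
        have h1 := mdifferentiableAt_mvfderiv_apply (hψ p).contMDiffAt hY
        have : (fun q => mvfderiv I (ψ p) q ((f • Y) q)) =
            f • (fun q => mvfderiv I (ψ p) q (Y q)) := by
          ext q; simp
        rw [this, mvfderiv_smul hf h1]
        ext v
        rw [← mvfderiv_inj (hψ p)]
        simp [← diffEquiv_apply (hψ p)]
        module }

variable {ψ : N → N → F} {hψ : ∀ p, IsLocalDiffeomorphAt I 𝓘(ℝ, F) ∞ (ψ p) p}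
  {Chr : N → F →L[ℝ] F →L[ℝ] F}

theorem mvfderiv_chartCov (Y : ∀ q : N, TangentSpace I q) (p : N) (v : TangentSpace I p) :
    mvfderiv I (ψ p) p (chartCov ψ hψ Chr Y p v) =
      mvfderiv I (fun q => mvfderiv I (ψ p) q (Y q)) p v +
        Chr p (mvfderiv I (ψ p) p (Y p)) (mvfderiv I (ψ p) p v) := by
  rw [← diffEquiv_apply (hψ p)]
  exact (diffEquiv (hψ p)).apply_symm_apply _

theorem mvfderiv_chartCov_coordField (e : F) (p : N) (v : TangentSpace I p) :
    mvfderiv I (ψ p) p (chartCov ψ hψ Chr (coordField I (ψ p) e) p v) =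
      Chr p e (mvfderiv I (ψ p) p v) := by
  rw [mvfderiv_chartCov, mvfderiv_coordField (hψ p)]
  have : (fun q => mvfderiv I (ψ p) q (coordField I (ψ p) e q)) =ᶠ[𝓝 p] fun _ => e := by
    filter_upwards [isLocalDiffeomorphAt_eventually (hψ p)] with q hq
    exact mvfderiv_coordField hq e
  have h0 : mvfderiv I (fun q => mvfderiv I (ψ p) q (coordField I (ψ p) e q)) p = 0 := by
    rw [mvfderiv_congr this, mvfderiv_const]
  simp [h0]

/-- The torsion is a tensor, so it may be evaluated on the commuting coordinate fields, where it is
the antisymmetric part of `Chr`. -/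
theorem torsion_chartCov [FiniteDimensional ℝ E] [CompleteSpace E] [CompleteSpace F]
    (hsymm : ∀ p x y, Chr p x y = Chr p y x) : (chartCov ψ hψ Chr).torsion = 0 := by
  ext p u v
  have h := (chartCov ψ hψ Chr).torsion_apply
    (mdifferentiableAt_coordField (hψ p) (mvfderiv I (ψ p) p u))
    (mdifferentiableAt_coordField (hψ p) (mvfderiv I (ψ p) p v))
  rw [mlieBracket_coordField (hψ p), coordField_mvfderiv (hψ p), coordField_mvfderiv (hψ p),
    sub_zero] at h
  rw [h, ← mvfderiv_inj (hψ p), map_sub, mvfderiv_chartCov_coordField,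
    mvfderiv_chartCov_coordField, hsymm]
  simp

/-- The hypothesis `hG` packs two facts into one differential: `G` is bilinear in its last two
arguments, and its derivative in the base point is `∂_w G(x, y) = G(Chr(x, w), y) + G(x, Chr(y,
w))`. Compatibility with the metric is then the chain rule. -/
theorem isLeviCivita_chartCov [FiniteDimensional ℝ E] [CompleteSpace E] [CompleteSpace F]
    (hsymm : ∀ p x y, Chr p x y = Chr p y x)
    (g : Bundle.ContMDiffRiemannianMetric I ∞ E (fun p : N => TangentSpace I p))
    {G : F → F → F → ℝ}
    (hg : ∀ p, ∀ᶠ q in 𝓝 p, ∀ u v : TangentSpace I q,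
      g.inner q u v = G (ψ p q) (mvfderiv I (ψ p) q u) (mvfderiv I (ψ p) q v))
    (hG : ∀ p x y, ∃ L : F × F × F →L[ℝ] ℝ,
      HasFDerivAt (fun e : F × F × F => G e.1 e.2.1 e.2.2) L (ψ p p, x, y) ∧
      ∀ w x' y', L (w, x', y') =
        G (ψ p p) (x' + Chr p x w) y + G (ψ p p) x (y' + Chr p y w)) :
    IsLeviCivita g (chartCov ψ hψ Chr) := by
  refine ⟨torsion_chartCov hsymm, fun p X Y hX hY v => ?_⟩
  have hc : (fun q => g.inner q (X q) (Y q)) =ᶠ[𝓝 p] fun q =>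
      G (ψ p q) (mvfderiv I (ψ p) q (X q)) (mvfderiv I (ψ p) q (Y q)) := by
    filter_upwards [hg p] with q hq using hq _ _
  have h1 := (mdifferentiableAt_mvfderiv_apply (hψ p).contMDiffAt hX).hasMFDerivAt
  have h2 := (mdifferentiableAt_mvfderiv_apply (hψ p).contMDiffAt hY).hasMFDerivAt
  have h0 := ((hψ p).mdifferentiableAt (by simp)).hasMFDerivAt
  obtain ⟨L, hL, hL'⟩ := hG p (mvfderiv I (ψ p) p (X p)) (mvfderiv I (ψ p) p (Y p))
  have hF := HasMFDerivAt.comp p hL.hasMFDerivAt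
    (hasMFDerivAt_prodMk h0 (hasMFDerivAt_prodMk h1 h2))
  have hF' := congrArg (fun L : E →L[ℝ] ℝ => L v) hF.mfderiv
  rw [mvfderiv_congr hc, (hg p).self_of_nhds, (hg p).self_of_nhds, mvfderiv_chartCov,
    mvfderiv_chartCov]
  exact hF'.trans (hL' _ _ _)

variable [FiniteDimensional ℝ F]

/-- Reduces covariant derivatives along curves to the classical formula `f' + Chr(f, γ')` in a
single chart. The required decomposition of `V` is its expansion in the coordinate fields of a basis
of `F`. -/
theorem hasCovDerivAlong_chartCov [CompleteSpace E] {γ : ℝ → N} {V : ∀ s, TangentSpace I (γ s)}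
    {s₀ : ℝ} {W : TangentSpace I (γ s₀)} {f : ℝ → F} {f' : F}
    (hγ : MDifferentiableAt 𝓘(ℝ, ℝ) I γ s₀)
    (hV : ∀ᶠ s in 𝓝 s₀, mvfderiv I (ψ (γ s₀)) (γ s) (V s) = f s)
    (hf : HasDerivAt f f' s₀)
    (hW : mvfderiv I (ψ (γ s₀)) (γ s₀) W = f' + Chr (γ s₀) (f s₀)
      (mvfderiv I (ψ (γ s₀)) (γ s₀) (velocity I γ s₀))) :
    HasCovDerivAlong (chartCov ψ hψ Chr) γ V s₀ W := by
  let b := Module.finBasis ℝ F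
  have hd : ∀ k, HasDerivAt (fun s => b.repr (f s) k) (b.repr f' k) s₀ := fun k =>
    (LinearMap.toContinuousLinearMap (b.coord k)).hasFDerivAt.comp_hasDerivAt s₀ hf
  refine ⟨hγ, Module.finrank ℝ F, fun k s => b.repr (f s) k,
    fun k => coordField I (ψ (γ s₀)) (b k), fun k => (hd k).differentiableAt,
    fun k => mdifferentiableAt_coordField (hψ _) _, ?_, ?_⟩
  · filter_upwards [hV,
      hγ.continuousAt.eventually (isLocalDiffeomorphAt_eventually (hψ (γ s₀)))] with s hs hd
    rw [← mvfderiv_inj hd, hs, map_sum]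
    simp only [map_smul, mvfderiv_coordField hd]
    exact (b.sum_repr _).symm
  · rw [← mvfderiv_inj (hψ _), hW, map_sum]
    simp only [map_add, map_smul, mvfderiv_coordField (hψ _), mvfderiv_chartCov_coordField,
      Finset.sum_add_distrib, (hd _).deriv]
    rw [b.sum_repr]
    congr 1
    conv_lhs => rw [← b.sum_repr (f s₀), map_sum, sum_apply]
    simp

end ChartConnection

/-! ### Developing charts and their transition maps. -/

section Developing

/-- The inclusion of the upper half-plane, as a partial diffeomorphism. -/
def coePartialDiffeomorph : PartialDiffeomorph 𝓘(ℝ, ℂ) 𝓘(ℝ, ℂ) ℍ ℂ ∞ where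
  toFun := (↑)
  invFun := UpperHalfPlane.ofComplex
  source := Set.univ
  target := {z | 0 < z.im}
  map_source' z _ := z.im_pos
  map_target' _ _ := trivial
  left_inv' z _ := UpperHalfPlane.ofComplex_apply z
  right_inv' z hz := by simp [UpperHalfPlane.ofComplex_apply_of_im_pos hz]
  open_source := isOpen_univ
  open_target := isOpen_lt continuous_const Complex.continuous_im
  contMDiffOn_toFun := (contMDiffOn_univ.2 fun _ => contMDiffAt_extChartAt)
  contMDiffOn_invFun := by
    intro z hz
    refine ContMDiffAt.contMDiffWithinAt ?_
    rw [contMDiffAt_iff]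
    constructor
    · rw [ContinuousAt, nhds_induced, Filter.tendsto_comap_iff]
      refine Filter.Tendsto.congr' (UpperHalfPlane.eventuallyEq_coe_comp_ofComplex hz).symm ?_
      simpa [UpperHalfPlane.ofComplex_apply_of_im_pos hz] using! Filter.tendsto_id
    · simpa using!
        contDiffAt_id.congr_of_eventuallyEq (UpperHalfPlane.eventuallyEq_coe_comp_ofComplex hz)

theorem isLocalDiffeomorphAt_coe (z : ℍ) :
    IsLocalDiffeomorphAt 𝓘(ℝ, ℂ) 𝓘(ℝ, ℂ) ∞ ((↑) : ℍ → ℂ) z :=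
  ⟨coePartialDiffeomorph, Set.mem_univ _, fun _ _ => rfl⟩

theorem isLocalDiffeomorphAt_ofComplex {z : ℂ} (hz : 0 < z.im) :
    IsLocalDiffeomorphAt 𝓘(ℝ, ℂ) 𝓘(ℝ, ℂ) ∞ UpperHalfPlane.ofComplex z :=
  ⟨coePartialDiffeomorph.symm, hz, fun _ _ => rfl⟩

variable {M : Type*} [TopologicalSpace M] [ChartedSpace ℂ M] {Γ : Subgroup PSL(2, ℝ)} {pr : ℍ → M}

/-- `φ` is near `x` a local inverse of the projection `pr`. -/
structure IsDev (pr : ℍ → M) (φ : M → ℂ) (x : M) : Prop where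
  isLocalDiffeomorphAt : IsLocalDiffeomorphAt 𝓘(ℝ, ℂ) 𝓘(ℝ, ℂ) ∞ φ x
  eventually_section : ∀ᶠ y in 𝓝 x, ∃ z : ℍ, φ y = z ∧ pr z = y

theorem IsDev.eventually {φ : M → ℂ} {x : M} (h : IsDev pr φ x) : ∀ᶠ y in 𝓝 x, IsDev pr φ y := by
  filter_upwards [isLocalDiffeomorphAt_eventually h.1, eventually_eventually_nhds.2 h.2]
    with y hy hy' using ⟨hy, hy'⟩

theorem IsDev.im_pos {φ : M → ℂ} {x : M} (h : IsDev pr φ x) : 0 < (φ x).im := by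
  obtain ⟨z, hz, -⟩ := h.2.self_of_nhds
  rw [hz]; exact z.im_pos

theorem IsQuotientBy.exists_isDev (h : IsQuotientBy Γ pr) (z : ℍ) :
    ∃ φ : M → ℂ, IsDev pr φ (pr z) ∧ ∀ᶠ w in 𝓝 z, φ (pr w) = w := by
  have hz := h.isLocalDiffeomorph z
  refine ⟨fun y => (hz.localInverse y : ℍ), ⟨?_, ?_⟩, ?_⟩
  · exact IsLocalDiffeomorphAt.comp
      (hf := hz.localInverse_isLocalDiffeomorphAt) (hg := isLocalDiffeomorphAt_coe _)
  · filter_upwards [hz.localInverse_eventuallyEq_right] with y hy using ⟨_, rfl, hy⟩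
  · filter_upwards [hz.localInverse_eventuallyEq_left] with w hw
    exact congrArg _ hw

/-- The Möbius transformation of a matrix, on complex numbers. -/
def mob (A : SL(2, ℝ)) (z : ℂ) : ℂ := (A 0 0 * z + A 0 1) / (A 1 0 * z + A 1 1)

theorem coe_smul_eq_mob (A : SL(2, ℝ)) (z : ℍ) : ((A • z : ℍ) : ℂ) = mob A z := by
  rw [UpperHalfPlane.coe_specialLinearGroup_apply]; rfl

theorem det_SL (A : SL(2, ℝ)) : A 0 0 * A 1 1 - A 0 1 * A 1 0 = 1 := by
  rw [← Matrix.det_fin_two]; exact A.2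

theorem denom_ne_zero (A : SL(2, ℝ)) {z : ℂ} (hz : 0 < z.im) : (A 1 0 * z + A 1 1 : ℂ) ≠ 0 := by
  intro h
  have him := congrArg Complex.im h
  have hre := congrArg Complex.re h
  simp at him hre
  have hd := det_SL A
  rcases him with h1 | h1
  · simp [h1] at hre
    simp [h1, hre] at hd
  · exact hz.ne' h1

theorem hasDerivAt_mob (A : SL(2, ℝ)) {z : ℂ} (hz : 0 < z.im) :
    HasDerivAt (mob A) (1 / (A 1 0 * z + A 1 1) ^ 2) z := by
  have hd : (A 0 0 * A 1 1 - A 0 1 * A 1 0 : ℂ) = 1 := by exact_mod_cast det_SL A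
  have h1 : HasDerivAt (fun z : ℂ => (A 0 0 * z + A 0 1 : ℂ)) (A 0 0) z := by
    simpa using ((hasDerivAt_id z).const_mul (A 0 0 : ℂ)).add_const (A 0 1 : ℂ)
  have h2 : HasDerivAt (fun z : ℂ => (A 1 0 * z + A 1 1 : ℂ)) (A 1 0) z := by
    simpa using ((hasDerivAt_id z).const_mul (A 1 0 : ℂ)).add_const (A 1 1 : ℂ)
  convert! h1.div h2 (denom_ne_zero A hz) using 1
  rw [← hd]; ring

theorem continuous_SL_smul (A : SL(2, ℝ)) : Continuous fun z : ℍ => A • z := by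
  rw [UpperHalfPlane.isEmbedding_coe.continuous_iff, continuous_iff_continuousAt]
  intro z
  have : ((↑) : ℍ → ℂ) ∘ (fun z : ℍ => A • z) = mob A ∘ (↑) := by
    ext z; exact coe_smul_eq_mob A z
  rw [this]
  exact ContinuousAt.comp (hasDerivAt_mob A z.im_pos).continuousAt
    UpperHalfPlane.continuous_coe.continuousAt

theorem continuousAt_ofComplex {z : ℂ} (hz : 0 < z.im) :
    ContinuousAt UpperHalfPlane.ofComplex z :=
  (isLocalDiffeomorphAt_ofComplex hz).contMDiffAt.continuousAt

/-- Two developing charts differ by an element of the group. -/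
theorem IsQuotientBy.transition (h : IsQuotientBy Γ pr) {φ φ' : M → ℂ} {x : M}
    (hφ : IsDev pr φ x) (hφ' : IsDev pr φ' x) :
    ∃ A : SL(2, ℝ), toPSL A ∈ Γ ∧ ∀ᶠ y in 𝓝 x, φ' y = mob A (φ y) := by
  obtain ⟨z, hz, hzx⟩ := hφ.2.self_of_nhds
  obtain ⟨z', hz', hzx'⟩ := hφ'.2.self_of_nhds
  obtain ⟨γ, hγ, hγz⟩ := (h.eq_iff z z').1 (hzx.trans hzx'.symm)
  obtain ⟨A, rfl⟩ := toPSL_surjective γ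
  rw [toPSL_smul] at hγz
  -- For `y` near `x`, both `A • w` and `w'`, where `w, w'` are the lifts of `y` chosen by `φ, φ'`,
  -- are close to `z'` and lie over `y`. Since `pr` is injective near `z'`, they coincide.
  obtain ⟨Φ, hΦ, hΦe⟩ := h.isLocalDiffeomorph z'
  refine ⟨A, hγ, ?_⟩
  have c1 : Filter.Tendsto (fun y => A • UpperHalfPlane.ofComplex (φ y)) (𝓝 x) (𝓝 z') := by
    have := (continuous_SL_smul A).continuousAt.comp
      ((continuousAt_ofComplex hφ.im_pos).comp hφ.1.contMDiffAt.continuousAt)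
    have e : A • UpperHalfPlane.ofComplex (φ x) = z' := by
      rw [hz, UpperHalfPlane.ofComplex_apply, hγz]
    rw [← e]; exact this
  have c2 : Filter.Tendsto (fun y => UpperHalfPlane.ofComplex (φ' y)) (𝓝 x) (𝓝 z') := by
    have := (continuousAt_ofComplex hφ'.im_pos).comp hφ'.1.contMDiffAt.continuousAt
    have e : UpperHalfPlane.ofComplex (φ' x) = z' := by
      rw [hz', UpperHalfPlane.ofComplex_apply]
    rw [← e]; exact this
  filter_upwards [hφ.2, hφ'.2, c1.eventually (Φ.open_source.mem_nhds hΦ),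
    c2.eventually (Φ.open_source.mem_nhds hΦ)] with y ⟨w, hw, hwy⟩ ⟨w', hw', hwy'⟩ h1 h2
  rw [hw, UpperHalfPlane.ofComplex_apply] at h1
  rw [hw', UpperHalfPlane.ofComplex_apply] at h2
  have e : pr (A • w) = pr w' := by
    rw [hwy', ← hwy]
    exact ((h.eq_iff _ _).2 ⟨toPSL A, hγ, toPSL_smul A w⟩).symm
  rw [hΦe h1, hΦe h2] at e
  rw [hw', hw, ← coe_smul_eq_mob, Φ.injOn h1 h2 e]

/-- A developing chart at `pr z` need not lift to `z` itself: it may select another point of the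
`Γ`-orbit. The matrix `A` measures this ambiguity, and is removed later by the invariance under `Γ`.
-/
theorem IsQuotientBy.isDev_comp_pr (h : IsQuotientBy Γ pr) {φ : M → ℂ} {z : ℍ}
    (hφ : IsDev pr φ (pr z)) :
    ∃ A : SL(2, ℝ), toPSL A ∈ Γ ∧ ∀ᶠ w in 𝓝 z, φ (pr w) = (A • w : ℍ) := by
  obtain ⟨φ', hφ', hz⟩ := h.exists_isDev z
  obtain ⟨A, hA, he⟩ := h.transition hφ' hφ
  refine ⟨A, hA, ?_⟩
  filter_upwards [hz, (h.isLocalDiffeomorph z).contMDiffAt.continuousAt.eventually he] with w h1 h2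
  rw [h2, h1, coe_smul_eq_mob]

theorem mvfderiv_mob_comp {φ φ' : M → ℂ} {x : M} (hφ : IsDev pr φ x) {A : SL(2, ℝ)}
    (h : ∀ᶠ y in 𝓝 x, φ' y = mob A (φ y)) (v : TangentSpace 𝓘(ℝ, ℂ) x) :
    mvfderiv 𝓘(ℝ, ℂ) φ' x v =
      1 / (A 1 0 * φ x + A 1 1) ^ 2 * mvfderiv 𝓘(ℝ, ℂ) φ x v := by
  have h1 : HasFDerivAt (mob A) _ (φ x) :=
    ((hasDerivAt_mob A hφ.im_pos).hasFDerivAt).restrictScalars ℝ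
  have h2 := HasMFDerivAt.comp x h1.hasMFDerivAt (hφ.1.mdifferentiableAt (by simp)).hasMFDerivAt
  rw [mvfderiv_congr (f' := mob A ∘ φ) h]
  refine (congrArg (fun L : ℂ →L[ℝ] ℂ => L v) h2.mfderiv).trans ?_
  change (mvfderiv 𝓘(ℝ, ℂ) φ x v) • (1 / (A 1 0 * φ x + A 1 1) ^ 2 : ℂ) = _
  rw [smul_eq_mul, mul_comm]

/-- The product of the identity of `ℝ` with a developing chart. -/
def cylDev (φ : M → ℂ) (p : ℝ × M) : ℝ × ℂ := (p.1, φ p.2)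

theorem isLocalDiffeomorphAt_cylDev {φ : M → ℂ} {p : ℝ × M}
    (h : IsLocalDiffeomorphAt 𝓘(ℝ, ℂ) 𝓘(ℝ, ℂ) ∞ φ p.2) :
    IsLocalDiffeomorphAt cylModel 𝓘(ℝ, ℝ × ℂ) ∞ (cylDev φ) p := by
  obtain ⟨Φ, hp, he⟩ := h
  refine ⟨{ toPartialEquiv := (PartialEquiv.refl ℝ).prod Φ.toPartialEquiv
            open_source := isOpen_univ.prod Φ.open_source
            open_target := isOpen_univ.prod Φ.open_target
            contMDiffOn_toFun := ?_
            contMDiffOn_invFun := ?_ }, ⟨trivial, hp⟩, fun q hq => ?_⟩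
  · exact contMDiff_fst.contMDiffOn.prodMk_space
      (Φ.contMDiffOn_toFun.comp contMDiff_snd.contMDiffOn fun q hq => hq.2)
  · exact contDiff_fst.contMDiff.contMDiffOn.prodMk
      (Φ.contMDiffOn_invFun.comp contDiff_snd.contMDiff.contMDiffOn fun q hq => hq.2)
  · exact congrArg (Prod.mk q.1) (he hq.2)

theorem mvfderiv_cylDev {φ : M → ℂ} {p : ℝ × M}
    (h : IsLocalDiffeomorphAt 𝓘(ℝ, ℂ) 𝓘(ℝ, ℂ) ∞ φ p.2) (v : TangentSpace cylModel p) :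
    mvfderiv cylModel (cylDev φ) p v = (v.1, mvfderiv 𝓘(ℝ, ℂ) φ p.2 v.2) := by
  have h1 := hasMFDerivAt_prodMk (I := cylModel) (p := p) (hasMFDerivAt_fst p)
    (HasMFDerivAt.comp p (h.mdifferentiableAt (by simp)).hasMFDerivAt
      (hasMFDerivAt_snd (I := 𝓘(ℝ, ℝ)) (I' := 𝓘(ℝ, ℂ)) p))
  exact congrArg (fun L : ℝ × ℂ →L[ℝ] ℝ × ℂ => L v) h1.mfderiv

end Developing

/-! ### The warped product metric on `ℝ × ℂ` and its Christoffel symbols. -/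

section Warped

/-- The metric `dt² + cosh²(t) |dz|² / (Im z)²`. -/
def warp (e : ℝ × ℂ) : ℝ × ℂ →L[ℝ] ℝ × ℂ →L[ℝ] ℝ :=
  (ContinuousLinearMap.mul ℝ ℝ).bilinearComp (.fst ℝ ℝ ℂ) (.fst ℝ ℝ ℂ) +
    (Real.cosh e.1 ^ 2 / e.2.im ^ 2) •
      ((ContinuousLinearMap.mul ℝ ℝ).bilinearComp (Complex.reCLM ∘L .snd ℝ ℝ ℂ)
          (Complex.reCLM ∘L .snd ℝ ℝ ℂ) +
        (ContinuousLinearMap.mul ℝ ℝ).bilinearComp (Complex.imCLM ∘L .snd ℝ ℝ ℂ)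
          (Complex.imCLM ∘L .snd ℝ ℝ ℂ))

theorem warp_apply (e u v : ℝ × ℂ) : warp e u v =
    u.1 * v.1 + Real.cosh e.1 ^ 2 / e.2.im ^ 2 * (u.2.re * v.2.re + u.2.im * v.2.im) := by
  simp [warp]
  ring

theorem warp_symm (e u v : ℝ × ℂ) : warp e u v = warp e v u := by
  rw [warp_apply, warp_apply]; ring

theorem warp_pos {e u : ℝ × ℂ} (he : 0 < e.2.im) (hu : u ≠ 0) : 0 < warp e u u := by
  rw [warp_apply]
  have hc := Real.cosh_pos e.1
  by_cases h1 : u.1 = 0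
  · have h2 : u.2 ≠ 0 := fun h => hu (Prod.ext h1 h)
    have h3 : 0 < u.2.re * u.2.re + u.2.im * u.2.im := Complex.normSq_pos.2 h2
    rw [h1]
    positivity
  · have h3 : 0 ≤ u.2.re * u.2.re + u.2.im * u.2.im := Complex.normSq_nonneg _
    have h4 : 0 < u.1 * u.1 := mul_self_pos.2 h1
    positivity

theorem contDiffAt_warp {e : ℝ × ℂ} (he : 0 < e.2.im) : ContDiffAt ℝ ∞ warp e := by
  have h1 : ContDiff ℝ ∞ fun e : ℝ × ℂ => e.2.im := Complex.imCLM.contDiff.comp contDiff_snd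
  have h2 : ContDiffAt ℝ ∞ (fun e : ℝ × ℂ => Real.cosh e.1 ^ 2 / e.2.im ^ 2) e :=
    ((Real.contDiff_cosh.comp contDiff_fst).pow 2).contDiffAt.div (h1.pow 2).contDiffAt
      (by positivity)
  exact contDiffAt_const.add
    (((ContinuousLinearMap.toSpanSingleton ℝ _).contDiff.contDiffAt (n := ∞)).comp e h2)

theorem isVonNBounded_warp {e : ℝ × ℂ} (he : 0 < e.2.im) :
    Bornology.IsVonNBounded ℝ {v : ℝ × ℂ | warp e v v < 1} := by
  rw [NormedSpace.isVonNBounded_iff, Metric.isBounded_iff_subset_closedBall 0]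
  -- On the unit ball `|v.1| ≤ 1`, and `|v.2| ≤ Im e.2` because `cosh ≥ 1`.
  refine ⟨max 1 e.2.im, fun v hv => ?_⟩
  have hv' : warp e v v < 1 := hv
  rw [warp_apply] at hv'
  have hc := Real.one_le_cosh e.1
  have h3 : 0 ≤ v.2.re * v.2.re + v.2.im * v.2.im := Complex.normSq_nonneg _
  have h4 : v.2.re * v.2.re + v.2.im * v.2.im = ‖v.2‖ ^ 2 := by
    rw [← Complex.normSq_eq_norm_sq]; rfl
  rw [mem_closedBall_zero_iff, Prod.norm_def]
  refine max_le_max ?_ ?_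
  · rw [Real.norm_eq_abs, abs_le_one_iff_mul_self_le_one]
    have : 0 ≤ Real.cosh e.1 ^ 2 / e.2.im ^ 2 * (v.2.re * v.2.re + v.2.im * v.2.im) := by positivity
    linarith
  · have h5 : Real.cosh e.1 ^ 2 / e.2.im ^ 2 * ‖v.2‖ ^ 2 < 1 := by
      rw [← h4]; nlinarith [mul_self_nonneg v.1]
    rw [div_mul_eq_mul_div, div_lt_one (by positivity)] at h5
    refine abs_le_of_sq_le_sq' ?_ he.le |>.2
    have : 1 ≤ Real.cosh e.1 ^ 2 := one_le_pow₀ hc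
    nlinarith [sq_nonneg ‖v.2‖]

/-- The Christoffel symbols of `warp e`. -/
def warpChr (e : ℝ × ℂ) : ℝ × ℂ →L[ℝ] ℝ × ℂ →L[ℝ] ℝ × ℂ :=
  LinearMap.toContinuousBilinearMap (LinearMap.mk₂ ℝ (fun v w : ℝ × ℂ =>
    ((-(Real.cosh e.1 * Real.sinh e.1 / e.2.im ^ 2 * (v.2.re * w.2.re + v.2.im * w.2.im)),
      ⟨-(v.2.re * w.2.im + v.2.im * w.2.re) / e.2.im +
          Real.sinh e.1 / Real.cosh e.1 * (v.1 * w.2.re + w.1 * v.2.re),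
        (v.2.re * w.2.re - v.2.im * w.2.im) / e.2.im +
          Real.sinh e.1 / Real.cosh e.1 * (v.1 * w.2.im + w.1 * v.2.im)⟩) : ℝ × ℂ))
    (by intros; refine Prod.ext ?_ (Complex.ext ?_ ?_) <;> simp <;> ring)
    (by intros; refine Prod.ext ?_ (Complex.ext ?_ ?_) <;> simp <;> ring)
    (by intros; refine Prod.ext ?_ (Complex.ext ?_ ?_) <;> simp <;> ring)
    (by intros; refine Prod.ext ?_ (Complex.ext ?_ ?_) <;> simp <;> ring))

theorem warpChr_apply (e v w : ℝ × ℂ) : warpChr e v w =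
    (-(Real.cosh e.1 * Real.sinh e.1 / e.2.im ^ 2 * (v.2.re * w.2.re + v.2.im * w.2.im)),
      ⟨-(v.2.re * w.2.im + v.2.im * w.2.re) / e.2.im +
          Real.sinh e.1 / Real.cosh e.1 * (v.1 * w.2.re + w.1 * v.2.re),
        (v.2.re * w.2.re - v.2.im * w.2.im) / e.2.im +
          Real.sinh e.1 / Real.cosh e.1 * (v.1 * w.2.im + w.1 * v.2.im)⟩) := rfl

theorem warpChr_symm (e v w : ℝ × ℂ) : warpChr e v w = warpChr e w v := by
  rw [warpChr_apply, warpChr_apply]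
  refine Prod.ext ?_ (Complex.ext ?_ ?_) <;> dsimp only <;> ring

/-- The identity that characterizes the Christoffel symbols of `warp`, in the form required by
`isLeviCivita_chartCov`. -/
theorem hasFDerivAt_warp {e : ℝ × ℂ} (he : 0 < e.2.im) (x y : ℝ × ℂ) :
    ∃ L : (ℝ × ℂ) × (ℝ × ℂ) × (ℝ × ℂ) →L[ℝ] ℝ,
      HasFDerivAt (fun e : (ℝ × ℂ) × (ℝ × ℂ) × (ℝ × ℂ) => warp e.1 e.2.1 e.2.2) L (e, x, y) ∧
      ∀ w x' y', L (w, x', y') =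
        warp e (x' + warpChr e x w) y + warp e x (y' + warpChr e y w) := by
  let pe : (ℝ × ℂ) × (ℝ × ℂ) × (ℝ × ℂ) →L[ℝ] ℝ × ℂ := .fst ℝ _ _
  let px : (ℝ × ℂ) × (ℝ × ℂ) × (ℝ × ℂ) →L[ℝ] ℝ × ℂ :=
    (ContinuousLinearMap.fst ℝ _ _) ∘L (.snd ℝ _ _)
  let py : (ℝ × ℂ) × (ℝ × ℂ) × (ℝ × ℂ) →L[ℝ] ℝ × ℂ :=
    (ContinuousLinearMap.snd ℝ _ _) ∘L (.snd ℝ _ _)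
  let t : ℝ × ℂ →L[ℝ] ℝ := .fst ℝ _ _
  let re : ℝ × ℂ →L[ℝ] ℝ := Complex.reCLM ∘L .snd ℝ _ _
  let im : ℝ × ℂ →L[ℝ] ℝ := Complex.imCLM ∘L .snd ℝ _ _
  have d : ∀ f : (ℝ × ℂ) × (ℝ × ℂ) × (ℝ × ℂ) →L[ℝ] ℝ, HasFDerivAt f f (e, x, y) :=
    fun f => f.hasFDerivAt
  have hne : e.2.im ^ 2 ≠ 0 := by positivity
  have hinv := (hasDerivAt_inv hne).comp_hasFDerivAt (e, x, y) ((d (im ∘L pe)).pow 2)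
  have h := ((d (t ∘L px)).mul (d (t ∘L py))).add
    ((((d (t ∘L pe)).cosh.pow 2).mul hinv).mul
      (((d (re ∘L px)).mul (d (re ∘L py))).add ((d (im ∘L px)).mul (d (im ∘L py)))))
  refine ⟨_, h.congr_of_eventuallyEq (Filter.Eventually.of_forall fun q => ?_), fun w x' y' => ?_⟩
  · simp [warp_apply, t, re, im, pe, px, py, div_eq_mul_inv]
  · have hc := (Real.cosh_pos e.1).ne'
    simp [warp_apply, warpChr_apply, t, re, im, pe, px, py]
    field_simp
    ring

/-- The action of `SL(2, ℝ)` on the second factor preserves `warp`. -/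
theorem warp_mob (A : SL(2, ℝ)) (e u v : ℝ × ℂ) (he : 0 < e.2.im) :
    warp (e.1, mob A e.2) (u.1, 1 / (A 1 0 * e.2 + A 1 1) ^ 2 * u.2)
      (v.1, 1 / (A 1 0 * e.2 + A 1 1) ^ 2 * v.2) = warp e u v := by
  have hn : Complex.normSq (A 1 0 * e.2 + A 1 1) ≠ 0 := by
    simpa using denom_ne_zero A he
  have him : (mob A e.2).im = e.2.im / Complex.normSq (A 1 0 * e.2 + A 1 1) := by
    have hd := det_SL A
    rw [mob, Complex.div_im]
    simp
    field_simp
    linear_combination hd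
  -- Multiplication by `q` scales the scalar product of `ℂ` by `|q|²`. For `q = (cz + d)⁻²` this
  -- factor is `|cz + d|⁻⁴`, which cancels against `(Im Az)² = (Im z)² / |cz + d|⁴`.
  have hq : ∀ q : ℂ, ∀ a b : ℂ, (q * a).re * (q * b).re + (q * a).im * (q * b).im =
      Complex.normSq q * (a.re * b.re + a.im * b.im) := by
    intro q a b
    simp [Complex.normSq_apply]
    ring
  rw [warp_apply, warp_apply]
  simp only [hq, him]
  rw [map_div₀, map_pow, map_one]
  field_simp

end Warped

/-! ### The metric of the cylinder and its Levi-Civita connection. -/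

section CylinderMetric

variable {M : Type*} [TopologicalSpace M] [ChartedSpace ℂ M] {Γ : Subgroup PSL(2, ℝ)} {pr : ℍ → M}

theorem IsQuotientBy.exists_isDev_at (h : IsQuotientBy Γ pr) (x : M) :
    ∃ φ : M → ℂ, IsDev pr φ x := by
  obtain ⟨z, rfl⟩ := h.surjective x
  obtain ⟨φ, hφ, -⟩ := h.exists_isDev z
  exact ⟨φ, hφ⟩

/-- A chosen developing chart at a point. -/
def IsQuotientBy.dev (h : IsQuotientBy Γ pr) (x : M) : M → ℂ := (h.exists_isDev_at x).choose

theorem IsQuotientBy.isDev_dev (h : IsQuotientBy Γ pr) (x : M) : IsDev pr (h.dev x) x :=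
  (h.exists_isDev_at x).choose_spec

/-- The chosen developing chart of the cylinder at a point. -/
def IsQuotientBy.cyl (h : IsQuotientBy Γ pr) (p : ℝ × M) : ℝ × M → ℝ × ℂ := cylDev (h.dev p.2)

theorem IsQuotientBy.isLocalDiffeomorphAt_cyl (h : IsQuotientBy Γ pr) (p : ℝ × M) :
    IsLocalDiffeomorphAt cylModel 𝓘(ℝ, ℝ × ℂ) ∞ (h.cyl p) p :=
  isLocalDiffeomorphAt_cylDev (h.isDev_dev p.2).1

/-- The scalar product of the metric of the cylinder. -/
def IsQuotientBy.cylInner (h : IsQuotientBy Γ pr) (p : ℝ × M) :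
    TangentSpace cylModel p →L[ℝ] TangentSpace cylModel p →L[ℝ] ℝ :=
  ContinuousLinearMap.precomp ℝ (mvfderiv cylModel (h.cyl p) p) ∘L warp (h.cyl p p) ∘L
    mvfderiv cylModel (h.cyl p) p

/-- The chosen chart differs from `φ` by a Möbius transformation, which preserves `warp`. Hence the
metric, although defined with a different chart at each point, can be computed near a point with one
chart; smoothness follows from this. -/
theorem IsQuotientBy.cylInner_eq (h : IsQuotientBy Γ pr) {φ : M → ℂ} {p : ℝ × M}
    (hφ : IsDev pr φ p.2) (u v : TangentSpace cylModel p) :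
    h.cylInner p u v = warp (cylDev φ p) (mvfderiv cylModel (cylDev φ) p u)
      (mvfderiv cylModel (cylDev φ) p v) := by
  obtain ⟨A, -, hA⟩ := h.transition hφ (h.isDev_dev p.2)
  change warp (cylDev (h.dev p.2) p) (mvfderiv cylModel (cylDev (h.dev p.2)) p u)
      (mvfderiv cylModel (cylDev (h.dev p.2)) p v) = _
  have e : ∀ w : TangentSpace cylModel p, mvfderiv cylModel (cylDev (h.dev p.2)) p w =
      ((mvfderiv cylModel (cylDev φ) p w).1,
        1 / (A 1 0 * φ p.2 + A 1 1) ^ 2 * (mvfderiv cylModel (cylDev φ) p w).2) := fun w => by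
    rw [mvfderiv_cylDev hφ.1, mvfderiv_cylDev (h.isDev_dev p.2).1]
    exact Prod.ext rfl (mvfderiv_mob_comp hφ hA _)
  rw [e u, e v, cylDev, hA.self_of_nhds]
  exact warp_mob A (cylDev φ p) _ _ hφ.im_pos

theorem IsQuotientBy.cylInner_eventually (h : IsQuotientBy Γ pr) (p : ℝ × M) :
    ∀ᶠ q in 𝓝 p, ∀ u v : TangentSpace cylModel q, h.cylInner q u v =
      warp (h.cyl p q) (mvfderiv cylModel (h.cyl p) q u) (mvfderiv cylModel (h.cyl p) q v) := by
  have h1 : ∀ᶠ q : ℝ × M in 𝓝 p, IsDev pr (h.dev p.2) q.2 :=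
    continuousAt_snd.eventually (h.isDev_dev p.2).eventually
  filter_upwards [h1] with q hq u v using h.cylInner_eq hq u v

variable [IsManifold 𝓘(ℝ, ℂ) ∞ M]

theorem IsQuotientBy.contMDiff_cylInner (h : IsQuotientBy Γ pr) :
    ContMDiff cylModel (cylModel.prod 𝓘(ℝ, (ℝ × ℂ) →L[ℝ] (ℝ × ℂ) →L[ℝ] ℝ)) ∞
      (fun p : ℝ × M => Bundle.TotalSpace.mk' ((ℝ × ℂ) →L[ℝ] (ℝ × ℂ) →L[ℝ] ℝ)
        (E := fun p : ℝ × M => TangentSpace cylModel p →L[ℝ] TangentSpace cylModel p →L[ℝ] ℝ)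
        p (h.cylInner p)) := by
  intro p
  rw [contMDiffAt_hom_bundle]
  refine ⟨contMDiffAt_id, ?_⟩
  have hψ := (h.isLocalDiffeomorphAt_cyl p).contMDiffAt
  have hL : ContMDiffAt cylModel 𝓘(ℝ, ℝ × ℂ →L[ℝ] ℝ × ℂ) ∞
      (inTangentCoordinates cylModel 𝓘(ℝ, ℝ × ℂ) id (h.cyl p)
        (fun q => mfderiv cylModel 𝓘(ℝ, ℝ × ℂ) (h.cyl p) q) p) p := hψ.mfderiv_const (by simp)
  have hw : ContMDiffAt cylModel 𝓘(ℝ, ℝ × ℂ →L[ℝ] ℝ × ℂ →L[ℝ] ℝ) ∞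
      (fun q => warp (h.cyl p q)) p :=
    (contDiffAt_warp (h.isDev_dev p.2).im_pos).contMDiffAt.comp p hψ
  have hc : ContMDiffAt cylModel 𝓘(ℝ, (ℝ × ℂ →L[ℝ] ℝ) →L[ℝ] ℝ × ℂ →L[ℝ] ℝ) ∞
      (fun q => (ContinuousLinearMap.compL ℝ (ℝ × ℂ) (ℝ × ℂ) ℝ).flip
        (inTangentCoordinates cylModel 𝓘(ℝ, ℝ × ℂ) id (h.cyl p)
        (fun q => mfderiv cylModel 𝓘(ℝ, ℝ × ℂ) (h.cyl p) q) p q)) p :=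
    (ContinuousLinearMap.contDiff _).contMDiff.contMDiffAt.comp p hL
  refine (hc.clm_comp (hw.clm_comp hL)).congr_of_eventuallyEq ?_
  filter_upwards [h.cylInner_eventually p, (trivializationAt (ℝ × ℂ)
    (TangentSpace cylModel : ℝ × M → Type _) p).open_baseSet.mem_nhds
      (FiberBundle.mem_baseSet_trivializationAt' p)] with q hq hqb
  refine ContinuousLinearMap.ext fun u => ContinuousLinearMap.ext fun v => ?_
  rw [inCoordinates_apply_eq₂ hqb hqb (by trivial)]
  -- The tangent bundle of the model space `ℝ × ℂ` is trivialized by the identity, so only the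
  -- trivialization at the source is visible in the coordinates of the differential.
  have hLq : ∀ u : ℝ × ℂ, inTangentCoordinates cylModel 𝓘(ℝ, ℝ × ℂ) id (h.cyl p)
      (fun q => mfderiv cylModel 𝓘(ℝ, ℝ × ℂ) (h.cyl p) q) p q u = mvfderiv cylModel (h.cyl p) q
        ((trivializationAt (ℝ × ℂ) (TangentSpace cylModel : ℝ × M → Type _) p).symm q u) := by
    intro u
    have e : ∀ w : ℝ × ℂ, (trivializationAt (ℝ × ℂ) (TangentSpace 𝓘(ℝ, ℝ × ℂ))
        (h.cyl p p)).continuousLinearMapAt ℝ (h.cyl p q) w = w := fun w =>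
      DFunLike.congr_fun (TangentBundle.continuousLinearMapAt_model_space (𝕜 := ℝ)
        (h.cyl p p) (h.cyl p q)) w
    exact (e _).trans (congrArg (mvfderiv cylModel (h.cyl p) q)
      (Bundle.Trivialization.symmL_apply (R := ℝ) _ hqb u))
  refine Eq.trans
    (DFunLike.congr_fun (Bundle.Trivial.linearMapAt_trivialization ℝ (ℝ × M) ℝ q) _) ?_
  refine (hq _ _).trans ?_
  exact congrArg₂ (fun a b => warp (h.cyl p q) a b) (hLq u).symm (hLq v).symm

/-- The metric `dt² + cosh²(t) g_M` of the cylinder. -/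
def IsQuotientBy.cylMetric (h : IsQuotientBy Γ pr) :
    Bundle.ContMDiffRiemannianMetric cylModel ∞ (ℝ × ℂ)
      (fun p : ℝ × M => TangentSpace cylModel p) where
  inner := h.cylInner
  symm p v w := warp_symm _ _ _
  pos p v hv := by
    refine warp_pos (h.isDev_dev p.2).im_pos fun h0 => hv ?_
    exact (mvfderiv_inj (h.isLocalDiffeomorphAt_cyl p)).1 (h0.trans (map_zero _).symm)
  isVonNBounded p := by
    have h1 := (isVonNBounded_warp (h.isDev_dev p.2).im_pos (e := h.cyl p p)).image
      ((diffEquiv (h.isLocalDiffeomorphAt_cyl p)).symm : ℝ × ℂ →L[ℝ] TangentSpace cylModel p)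
    refine Bornology.IsVonNBounded.subset (s₂ := _) (fun v hv => ?_) h1
    exact ⟨diffEquiv (h.isLocalDiffeomorphAt_cyl p) v, hv,
      (diffEquiv (h.isLocalDiffeomorphAt_cyl p)).symm_apply_apply v⟩
  contMDiff := h.contMDiff_cylInner

/-- The Levi-Civita connection of the cylinder. -/
def IsQuotientBy.cylCov (h : IsQuotientBy Γ pr) :
    CovariantDerivative cylModel (ℝ × ℂ) (TangentSpace cylModel : ℝ × M → Type _) :=
  chartCov h.cyl h.isLocalDiffeomorphAt_cyl fun p => warpChr (h.cyl p p)

theorem IsQuotientBy.isLeviCivita_cylCov (h : IsQuotientBy Γ pr) :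
    IsLeviCivita h.cylMetric h.cylCov :=
  isLeviCivita_chartCov (G := fun e u v => warp e u v) (fun _ _ _ => warpChr_symm _ _ _)
    h.cylMetric h.cylInner_eventually
    fun p x y => hasFDerivAt_warp (h.isDev_dev p.2).im_pos x y

omit [IsManifold 𝓘(ℝ, ℂ) ∞ M] in
theorem velocity_line (x : M) (t : ℝ) :
    velocity cylModel (fun t : ℝ => (t, x)) t = ((1, 0) : ℝ × ℂ) := by
  have h := (hasMFDerivAt_id (I := 𝓘(ℝ, ℝ)) t).prodMk
    (hasMFDerivAt_const (I := 𝓘(ℝ, ℝ)) (I' := 𝓘(ℝ, ℂ)) x t)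
  exact congrArg (fun L : ℝ →L[ℝ] ℝ × ℂ => L 1) h.mfderiv

/-- The velocity has the constant components `(1, 0)` in a developing chart, and the Christoffel
symbols vanish on `(∂_t, ∂_t)`. -/
theorem IsQuotientBy.isGeodesic_line (h : IsQuotientBy Γ pr) (x : M) :
    IsGeodesic h.cylCov (fun t : ℝ => (t, x)) := by
  have hs : ContMDiff 𝓘(ℝ, ℝ) cylModel ∞ (fun t : ℝ => (t, x)) :=
    contMDiff_id.prodMk contMDiff_const
  refine ⟨hs, fun s => hasCovDerivAlong_chartCov (f := fun _ => (1, 0))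
    (hs.mdifferentiable (by simp) s) (Filter.Eventually.of_forall fun t => ?_)
    (hasDerivAt_const _ _) ?_⟩
  · rw [velocity_line]
    refine (mvfderiv_cylDev (p := (t, x)) (h.isDev_dev x).1 _).trans ?_
    exact Prod.ext rfl (map_zero _)
  · rw [map_zero, velocity_line]
    have : mvfderiv cylModel (h.cyl (s, x)) (s, x) ((1, 0) : ℝ × ℂ) = (1, 0) :=
      (mvfderiv_cylDev (p := (s, x)) (h.isDev_dev x).1 _).trans (Prod.ext rfl (map_zero _))
    rw [this, warpChr_apply]
    simp
    rfl

omit [IsManifold 𝓘(ℝ, ℂ) ∞ M] in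
theorem hasMFDerivAt_slice (t : ℝ) (x : M) :
    HasMFDerivAt 𝓘(ℝ, ℂ) cylModel (slice t : M → ℝ × M) x (.inr ℝ ℝ ℂ) :=
  (hasMFDerivAt_const (I := 𝓘(ℝ, ℂ)) (I' := 𝓘(ℝ, ℝ)) t x).prodMk
    (hasMFDerivAt_id (I := 𝓘(ℝ, ℂ)) x)

omit [IsManifold 𝓘(ℝ, ℂ) ∞ M] in
theorem mfderiv_slice (t : ℝ) (x : M) (u : TangentSpace 𝓘(ℝ, ℂ) x) :
    mfderiv 𝓘(ℝ, ℂ) cylModel (slice t : M → ℝ × M) x u = ((0, u) : ℝ × ℂ) :=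
  congrArg (fun L : ℂ →L[ℝ] ℝ × ℂ => L u) (hasMFDerivAt_slice t x).mfderiv

/-- The normal component of the covariant derivative of a field which is tangent to a slice. -/
theorem IsQuotientBy.cylCov_slice_fst (h : IsQuotientBy Γ pr) {t : ℝ} {x : M}
    {Y : ∀ q : ℝ × M, TangentSpace cylModel q}
    (hY : IsTangentFieldAt cylModel 𝓘(ℝ, ℂ) (slice t) x Y) (u : TangentSpace 𝓘(ℝ, ℂ) x) :
    (h.cylCov Y (slice t x) (mfderiv 𝓘(ℝ, ℂ) cylModel (slice t) x u) : ℝ × ℂ).1 =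
      h.cylInner (slice t x) (mfderiv 𝓘(ℝ, ℂ) cylModel (slice t) x u) (Y (slice t x)) *
        -(Real.sinh t / Real.cosh t) := by
  set p : ℝ × M := slice t x with hp
  have hφ := (h.isDev_dev x).1
  have hf := mdifferentiableAt_mvfderiv_apply (h.isLocalDiffeomorphAt_cyl p).contMDiffAt hY.1
  have hY0 : ∀ᶠ q in 𝓝 x, (Y (slice t q) : ℝ × ℂ).1 = 0 := by
    filter_upwards [hY.2] with q ⟨w, hw⟩
    rw [← hw, mfderiv_slice]
  -- The `dt`-component of `Y` vanishes along the slice, hence so does its derivative in a direction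
  -- tangent to the slice. Only the Christoffel term contributes to the normal component.
  have hd : (mvfderiv cylModel (fun q => mvfderiv cylModel (h.cyl p) q (Y q)) p
      ((0, u) : ℝ × ℂ)).1 = 0 := by
    have h1 := HasMFDerivAt.comp x ((ContinuousLinearMap.fst ℝ ℝ ℂ).hasFDerivAt.hasMFDerivAt)
      (HasMFDerivAt.comp x hf.hasMFDerivAt (hasMFDerivAt_slice t x))
    have h2 : (ContinuousLinearMap.fst ℝ ℝ ℂ) ∘
        ((fun q => mvfderiv cylModel (h.cyl p) q (Y q)) ∘ slice t) =ᶠ[𝓝 x] fun _ => (0 : ℝ) := by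
      filter_upwards [hY0, isLocalDiffeomorphAt_eventually hφ] with q hq hq'
      exact (congrArg Prod.fst (mvfderiv_cylDev (p := slice t q) hq' _)).trans hq
    have h3 := (h2.mfderiv_eq (I := 𝓘(ℝ, ℂ)) (I' := 𝓘(ℝ, ℝ))).symm.trans h1.mfderiv
    rw [mfderiv_const] at h3
    exact (congrArg (fun L : ℂ →L[ℝ] ℝ => L u) h3).symm
  have hm : ∀ w : TangentSpace cylModel p, mvfderiv cylModel (h.cyl p) p w =
      ((w : ℝ × ℂ).1, mvfderiv 𝓘(ℝ, ℂ) (h.dev x) x (w : ℝ × ℂ).2) :=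
    fun w => mvfderiv_cylDev (p := p) hφ w
  have h1 := congrArg Prod.fst (mvfderiv_chartCov (hψ := h.isLocalDiffeomorphAt_cyl)
    (Chr := fun p => warpChr (h.cyl p p)) Y p (mfderiv 𝓘(ℝ, ℂ) cylModel (slice t) x u))
  have e0 : mvfderiv cylModel (h.cyl p) p ((0, u) : ℝ × ℂ) =
    ((0, mvfderiv 𝓘(ℝ, ℂ) (h.dev x) x u) : ℝ × ℂ) := hm _
  rw [hm, Prod.fst_add, mfderiv_slice, hd, zero_add, hm (Y p), e0, warpChr_apply] at h1
  rw [mfderiv_slice]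
  have e1 : h.cylInner p ((0, u) : ℝ × ℂ) (Y p) = warp (t, h.dev x x)
      (0, mvfderiv 𝓘(ℝ, ℂ) (h.dev x) x u)
      ((Y p : ℝ × ℂ).1, mvfderiv 𝓘(ℝ, ℂ) (h.dev x) x (Y p : ℝ × ℂ).2) :=
    (h.cylInner_eq (h.isDev_dev x) (p := p) _ _).trans
      (congrArg₂ (fun a b => warp (t, h.dev x x) a b) e0 (hm (Y p)))
  refine h1.trans (Eq.trans ?_ (congrArg (· * -(Real.sinh t / Real.cosh t)) e1).symm)
  rw [warp_apply]
  change -(Real.cosh t * Real.sinh t / (h.dev x x).im ^ 2 * _) = _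
  have hc := (Real.cosh_pos t).ne'
  field_simp
  simp
  ring

end CylinderMetric

/-! ### Geometry of the slices, and the isometry with hyperbolic space. -/

section Slices

variable {M : Type*} [TopologicalSpace M] [ChartedSpace ℂ M] [IsManifold 𝓘(ℝ, ℂ) ∞ M]
  {Γ : Subgroup PSL(2, ℝ)} {pr : ℍ → M}

theorem IsQuotientBy.isTotallyGeodesic_slice (h : IsQuotientBy Γ pr) :
    IsTotallyGeodesic 𝓘(ℝ, ℂ) h.cylCov (slice 0 : M → ℝ × M) := by
  intro x Y hY u
  refine ⟨(h.cylCov Y (slice 0 x) (mfderiv 𝓘(ℝ, ℂ) cylModel (slice 0) x u) : ℝ × ℂ).2, ?_⟩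
  rw [mfderiv_slice 0 x (h.cylCov Y (slice 0 x)
    (mfderiv 𝓘(ℝ, ℂ) cylModel (slice 0) x u) : ℝ × ℂ).2]
  refine Prod.ext ((h.cylCov_slice_fst hY u).trans ?_) rfl
  simp

theorem IsQuotientBy.isUmbilic_slice (h : IsQuotientBy Γ pr) (t : ℝ) :
    IsUmbilic 𝓘(ℝ, ℂ) h.cylMetric h.cylCov (slice t : M → ℝ × M) := by
  intro x
  -- The normal vector is `η = -tanh(t) ∂_t`, as read off from `cylCov_slice_fst`.
  refine ⟨((-(Real.sinh t / Real.cosh t), 0) : ℝ × ℂ), fun u => ?_, fun Y hY u =>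
    ⟨(h.cylCov Y (slice t x) (mfderiv 𝓘(ℝ, ℂ) cylModel (slice t) x u) : ℝ × ℂ).2, ?_⟩⟩
  · rw [mfderiv_slice]
    have hφ := (h.isDev_dev x).1
    have e0 : mvfderiv cylModel (cylDev (h.dev x)) (slice t x)
        ((-(Real.sinh t / Real.cosh t), 0) : ℝ × ℂ) = (-(Real.sinh t / Real.cosh t), 0) :=
      (mvfderiv_cylDev (p := slice t x) hφ _).trans (Prod.ext rfl (map_zero _))
    have e1 : mvfderiv cylModel (cylDev (h.dev x)) (slice t x) ((0, u) : ℝ × ℂ) =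
      (0, mvfderiv 𝓘(ℝ, ℂ) (h.dev x) x u) := mvfderiv_cylDev (p := slice t x) hφ _
    refine (h.cylInner_eq (p := slice t x) (h.isDev_dev x) _ _).trans ?_
    rw [e0, e1, warp_apply]
    simp
  · rw [mfderiv_slice t x (h.cylCov Y (slice t x)
      (mfderiv 𝓘(ℝ, ℂ) cylModel (slice t) x u) : ℝ × ℂ).2]
    refine Prod.ext ((h.cylCov_slice_fst hY u).trans ?_) ?_
    · exact (add_zero _).symm
    · refine Eq.symm ((congrArg (· + _) (smul_zero _)).trans (zero_add _))

/-- The diffeomorphism from the cylinder over the upper half-plane, with the metric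
`dt² + cosh²(t) |dz|² / y²`, to the upper half-space. -/
def toHalfSpace (e : ℝ × ℂ) : EuclideanSpace ℝ (Fin 3) :=
  -- Fermi coordinates about the vertical plane where the middle coordinate vanishes: for fixed `x +
  -- iy` the point describes a semicircle of radius `y` orthogonal to this plane, parametrized by
  -- the arc length `t`.
  !₂[e.2.re, e.2.im * (Real.sinh e.1 / Real.cosh e.1), e.2.im / Real.cosh e.1]

/-- The inverse of `toHalfSpace`. -/
def ofHalfSpace (x : EuclideanSpace ℝ (Fin 3)) : ℝ × ℂ :=
  -- On the semicircle above, `x 1 / x 2 = sinh t` and `x 1 ^ 2 + x 2 ^ 2 = y ^ 2`.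
  (Real.arsinh (x 1 / x 2), x 0 + √(x 1 ^ 2 + x 2 ^ 2) * Complex.I)

theorem contDiff_toHalfSpace : ContDiff ℝ ∞ toHalfSpace := by
  have hc : ∀ e : ℝ × ℂ, Real.cosh e.1 ≠ 0 := fun e => (Real.cosh_pos _).ne'
  have him : ContDiff ℝ ∞ fun e : ℝ × ℂ => e.2.im := Complex.imCLM.contDiff.comp contDiff_snd
  have hch : ContDiff ℝ ∞ fun e : ℝ × ℂ => Real.cosh e.1 := Real.contDiff_cosh.comp contDiff_fst
  rw [contDiff_euclidean]
  intro i
  fin_cases i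
  · exact Complex.reCLM.contDiff.comp contDiff_snd
  · exact him.mul ((Real.contDiff_sinh.comp contDiff_fst).div hch hc)
  · exact him.div hch hc

theorem contDiffOn_ofHalfSpace :
    ContDiffOn ℝ ∞ ofHalfSpace {x | 0 < x 2} := by
  intro x hx
  have hp : ∀ i : Fin 3, ContDiff ℝ ∞ fun x : EuclideanSpace ℝ (Fin 3) => x i :=
    fun i => (EuclideanSpace.proj (𝕜 := ℝ) i).contDiff
  have hx' : x 2 ≠ 0 := ne_of_gt hx
  have hs : x 1 ^ 2 + x 2 ^ 2 ≠ 0 := by positivity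
  refine ContDiffAt.contDiffWithinAt (ContDiffAt.prodMk ?_ ?_)
  · exact Real.contDiff_arsinh.contDiffAt.comp x ((hp 1).contDiffAt.div (hp 2).contDiffAt hx')
  · refine (Complex.ofRealCLM.contDiff.comp (hp 0)).contDiffAt.add
      (ContDiffAt.mul ?_ contDiffAt_const)
    exact Complex.ofRealCLM.contDiff.contDiffAt.comp x
      ((((hp 1).pow 2).add ((hp 2).pow 2)).contDiffAt.sqrt hs)

/-- `toHalfSpace` as a partial diffeomorphism. -/
def halfSpacePartialDiffeomorph :
    PartialDiffeomorph 𝓘(ℝ, ℝ × ℂ) 𝓘(ℝ, EuclideanSpace ℝ (Fin 3)) (ℝ × ℂ)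
      (EuclideanSpace ℝ (Fin 3)) ∞ where
  toFun := toHalfSpace
  invFun := ofHalfSpace
  source := {e | 0 < e.2.im}
  target := {x | 0 < x 2}
  map_source' e he := div_pos he (Real.cosh_pos _)
  map_target' x hx := by
    have hx' : x 2 ≠ 0 := ne_of_gt hx
    change 0 < (ofHalfSpace x).2.im
    simp [ofHalfSpace]
    positivity
  left_inv' e he := by
    have hc := (Real.cosh_pos e.1)
    have he : 0 < e.2.im := he
    refine Prod.ext ?_ (Complex.ext ?_ ?_)
    · have : e.2.im * (Real.sinh e.1 / Real.cosh e.1) / (e.2.im / Real.cosh e.1) =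
          Real.sinh e.1 := by
        field_simp
      simp [ofHalfSpace, toHalfSpace, this]
    · simp [ofHalfSpace, toHalfSpace]
    · have : (e.2.im * (Real.sinh e.1 / Real.cosh e.1)) ^ 2 + (e.2.im / Real.cosh e.1) ^ 2 =
          e.2.im ^ 2 := by
        field_simp
        linear_combination -Real.cosh_sq e.1
      simp [ofHalfSpace, toHalfSpace, this, Real.sqrt_sq he.le]
  right_inv' x hx := by
    have hx : 0 < x 2 := hx
    have hs : Real.cosh (Real.arsinh (x 1 / x 2)) = √(x 1 ^ 2 + x 2 ^ 2) / x 2 := by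
      rw [Real.cosh_arsinh, Real.sqrt_eq_iff_mul_self_eq (by positivity) (by positivity),
        div_mul_div_comm, Real.mul_self_sqrt (by positivity)]
      field_simp
      ring
    have hq : 0 < √(x 1 ^ 2 + x 2 ^ 2) := by positivity
    ext i
    fin_cases i
    · simp [ofHalfSpace, toHalfSpace]
    · simp [ofHalfSpace, toHalfSpace, hs]
      field_simp
    · simp [ofHalfSpace, toHalfSpace, hs]
      field_simp
  open_source := isOpen_lt continuous_const (Complex.continuous_im.comp continuous_snd)
  open_target := isOpen_lt continuous_const (EuclideanSpace.proj (𝕜 := ℝ) (2 : Fin 3)).continuous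
  contMDiffOn_toFun := contDiff_toHalfSpace.contMDiff.contMDiffOn
  contMDiffOn_invFun := contDiffOn_ofHalfSpace.contMDiffOn

theorem isLocalDiffeomorphAt_toHalfSpace {e : ℝ × ℂ} (he : 0 < e.2.im) :
    IsLocalDiffeomorphAt 𝓘(ℝ, ℝ × ℂ) 𝓘(ℝ, EuclideanSpace ℝ (Fin 3)) ∞ toHalfSpace e :=
  ⟨halfSpacePartialDiffeomorph, he, fun _ _ => rfl⟩

theorem inner_fderiv_toHalfSpace {e : ℝ × ℂ} (he : 0 < e.2.im) (v w : ℝ × ℂ) :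
    inner ℝ (fderiv ℝ toHalfSpace e v) (fderiv ℝ toHalfSpace e w) / (toHalfSpace e 2) ^ 2 =
      warp e v w := by
  have hc := (Real.cosh_pos e.1).ne'
  have hd := (contDiff_toHalfSpace.differentiable (by simp) e).hasFDerivAt
  have him : HasFDerivAt (fun e : ℝ × ℂ => e.2.im) (Complex.imCLM ∘L .snd ℝ ℝ ℂ) e :=
    (Complex.imCLM ∘L .snd ℝ ℝ ℂ).hasFDerivAt
  have hi : ∀ i (L : ℝ × ℂ →L[ℝ] ℝ), HasFDerivAt (fun e => toHalfSpace e i) L e →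
      ∀ v, fderiv ℝ toHalfSpace e v i = L v := fun i L hL v =>
    congrArg (fun L : ℝ × ℂ →L[ℝ] ℝ => L v)
      (((EuclideanSpace.proj (𝕜 := ℝ) i).hasFDerivAt.comp e hd).unique hL)
  have h0 := hi 0 _ (Complex.reCLM ∘L .snd ℝ ℝ ℂ).hasFDerivAt
  have h1 := hi 1 _ (him.mul (((Real.hasDerivAt_sinh e.1).div
    (Real.hasDerivAt_cosh e.1) hc).comp_hasFDerivAt e hasFDerivAt_fst))
  have h2 := hi 2 _ (him.mul (((Real.hasDerivAt_cosh e.1).inv hc).comp_hasFDerivAt e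
    hasFDerivAt_fst))
  rw [PiLp.inner_apply, Fin.sum_univ_three, warp_apply]
  simp only [h0, h1, h2, toHalfSpace]
  simp
  field_simp
  rw [Real.cosh_sq_sub_sinh_sq]
  linear_combination -(e.2.im ^ 2 * w.1 * v.1 + Real.cosh e.1 ^ 2 * (w.2.im * v.2.im)) *
    Real.cosh_sq e.1

theorem IsQuotientBy.isHyperbolicMetric_cylMetric (h : IsQuotientBy Γ pr) :
    IsHyperbolicMetric 2 (fun (p : ℝ × M) u v => h.cylMetric.inner p u v) := by
  intro p
  have hφ := h.isLocalDiffeomorphAt_cyl p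
  refine ⟨toHalfSpace ∘ h.cyl p, IsLocalDiffeomorphAt.comp (hf := hφ)
    (hg := isLocalDiffeomorphAt_toHalfSpace (h.isDev_dev p.2).im_pos), ?_⟩
  have h1 : ∀ᶠ q : ℝ × M in 𝓝 p, IsDev pr (h.dev p.2) q.2 :=
    continuousAt_snd.eventually (h.isDev_dev p.2).eventually
  filter_upwards [h.cylInner_eventually p, h1] with q hq hd
  have hpos : 0 < (h.cyl p q).2.im := hd.im_pos
  refine ⟨div_pos hpos (Real.cosh_pos _), fun u v => ?_⟩
  have e : ∀ u, mvfderiv cylModel (toHalfSpace ∘ h.cyl p) q u =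
      fderiv ℝ toHalfSpace (h.cyl p q) (mvfderiv cylModel (h.cyl p) q u) := fun u => by
    have h2 := HasMFDerivAt.comp q ((contDiff_toHalfSpace.differentiable
      (by simp) (h.cyl p q)).hasFDerivAt.hasMFDerivAt)
      ((isLocalDiffeomorphAt_cylDev hd.1).contMDiffAt.mdifferentiableAt (by simp)).hasMFDerivAt
    exact congrArg (fun L : ℝ × ℂ →L[ℝ] EuclideanSpace ℝ (Fin 3) => L u) h2.mfderiv
  rw [e u, e v]
  exact (hq u v).trans (inner_fderiv_toHalfSpace hpos _ _).symm

/-- Since `cosh 0 = 1`, the induced metric is `|dz|²/y²` in a developing chart, read in `ℝ²` through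
the basis `1, i` of `ℂ`. -/
theorem IsQuotientBy.isHyperbolicMetric_slice (h : IsQuotientBy Γ pr) :
    IsHyperbolicMetric 1 (inducedMetric 𝓘(ℝ, ℂ) h.cylMetric (slice 0 : M → ℝ × M)) := by
  intro x
  let L := Complex.orthonormalBasisOneI.repr
  have hφ := (h.isDev_dev x).1
  refine ⟨L ∘ h.dev x, IsLocalDiffeomorphAt.comp (hf := hφ)
    (hg := L.toContinuousLinearEquiv.toDiffeomorph.isLocalDiffeomorph _), ?_⟩
  filter_upwards [(h.isDev_dev x).eventually] with y hy
  have hL : L (h.dev x y) (Fin.last 1) = (h.dev x y).im := by simp [L]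
  refine ⟨hL ▸ hy.im_pos, fun u v => ?_⟩
  have e : ∀ u, mvfderiv 𝓘(ℝ, ℂ) (L ∘ h.dev x) y u = L (mvfderiv 𝓘(ℝ, ℂ) (h.dev x) y u) :=
    fun u => by
    have h2 := HasMFDerivAt.comp y L.toContinuousLinearEquiv.hasFDerivAt.hasMFDerivAt
      (hy.1.contMDiffAt.mdifferentiableAt (by simp)).hasMFDerivAt
    exact congrArg (fun L : ℂ →L[ℝ] EuclideanSpace ℝ (Fin 2) => L u) h2.mfderiv
  have e1 : ∀ u : TangentSpace 𝓘(ℝ, ℂ) y, mvfderiv cylModel (cylDev (h.dev x)) (slice 0 y)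
      ((0, u) : ℝ × ℂ) = (0, mvfderiv 𝓘(ℝ, ℂ) (h.dev x) y u) := fun u =>
    mvfderiv_cylDev (p := slice 0 y) hy.1 _
  change h.cylInner (slice 0 y) (mfderiv 𝓘(ℝ, ℂ) cylModel (slice 0) y u)
    (mfderiv 𝓘(ℝ, ℂ) cylModel (slice 0) y v) = _
  rw [e u, e v, L.inner_map_map, mfderiv_slice, mfderiv_slice]
  refine (h.cylInner_eq (p := slice 0 y) hy _ _).trans ?_
  rw [e1, e1, warp_apply]
  change _ = _ / (L (h.dev x y) (Fin.last 1)) ^ 2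
  rw [hL, Complex.inner]
  simp [cylDev, slice]
  ring

end Slices

/-! ### The isomorphism of `PU(2)` with `SO(3)`. -/

section AdjointRepresentation

open Matrix

theorem toPU_mul (B B' : SU2) : toPU (B * B') = toPU B * toPU B' := rfl

theorem toPU_surjective : Function.Surjective toPU := Quotient.mk_surjective

theorem SU2.mul_star (B : SU2) : B.1 * star B.1 = 1 := B.2.1.2

theorem SU2.star_mul (B : SU2) : star B.1 * B.1 = 1 := B.2.1.1

/-- Both are the inverse of a unitary matrix of determinant `1`. Comparing entries shows that the
first column `(α, β)` determines the matrix, so that `Ad` becomes a polynomial in the unit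
quaternion formed by `α, β`. -/
theorem SU2.star_eq_adjugate (B : SU2) : star B.1 = adjugate B.1 := by
  have h1 : B.1.det = 1 := B.2.2
  calc star B.1 = adjugate B.1 * B.1 * star B.1 := by rw [adjugate_mul, h1, one_smul, one_mul]
    _ = adjugate B.1 := by rw [mul_assoc, B.mul_star, mul_one]

theorem SU2.apply_one_one (B : SU2) : B.1 1 1 = star (B.1 0 0) := by
  have := congrFun (congrFun B.star_eq_adjugate 0) 0
  rw [adjugate_fin_two] at this
  exact this.symm

theorem SU2.apply_zero_one (B : SU2) : B.1 0 1 = -star (B.1 1 0) := by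
  have := congrFun (congrFun B.star_eq_adjugate 0) 1
  rw [adjugate_fin_two] at this
  exact (neg_eq_iff_eq_neg.2 this).symm ▸ rfl

theorem SU2.sum_sq (B : SU2) : (B.1 0 0).re ^ 2 + (B.1 0 0).im ^ 2 + (B.1 1 0).re ^ 2 +
    (B.1 1 0).im ^ 2 = 1 := by
  have h1 : B.1.det = 1 := B.2.2
  rw [det_fin_two, B.apply_one_one, B.apply_zero_one] at h1
  have := congrArg Complex.re h1
  simp at this
  linarith

/-- The element `((α, -β̄), (β, ᾱ))` of `SU(2)`. -/
def mkSU2 (α β : ℂ) (h : α.re ^ 2 + α.im ^ 2 + β.re ^ 2 + β.im ^ 2 = 1) : SU2 :=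
  ⟨!![α, -star β; β, star α], by
    refine mem_specialUnitaryGroup_iff.2 ⟨mem_unitaryGroup_iff.2 ?_, ?_⟩
    · ext i j
      fin_cases i <;> fin_cases j <;> apply Complex.ext <;>
        simp [mul_apply, star_apply] <;> linarith
    · rw [det_fin_two_of]
      apply Complex.ext <;> simp <;> linarith⟩

/-- The matrix of the rotation of `ℝ³` attached to a quaternion. -/
def quatRot (p q r s : ℝ) : Matrix (Fin 3) (Fin 3) ℝ :=
  !![p ^ 2 - q ^ 2 - r ^ 2 + s ^ 2, -2 * p * q + 2 * r * s, 2 * (p * r + q * s);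
    2 * p * q + 2 * r * s, p ^ 2 - q ^ 2 + r ^ 2 - s ^ 2, -2 * (p * s - q * r);
    -2 * (p * r - q * s), 2 * (p * s + q * r), p ^ 2 + q ^ 2 - r ^ 2 - s ^ 2]

theorem Ad_toPU_eq (B : SU2) :
    Ad (toPU B) = quatRot (B.1 0 0).re (B.1 0 0).im (B.1 1 0).re (B.1 1 0).im := by
  ext i j
  rw [Ad_toPU]
  fin_cases i <;> fin_cases j <;>
    simp [coord, a, quatRot, trace_fin_two, mul_apply, Fin.sum_univ_two, vecMul,
      B.apply_one_one, B.apply_zero_one, dotProduct] <;> ring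

theorem Ad_orthogonal (k : PU2) : (Ad k)ᵀ * Ad k = 1 := by
  obtain ⟨B, rfl⟩ := toPU_surjective k
  have h := B.sum_sq
  rw [Ad_toPU_eq]
  generalize (B.1 0 0).re = p, (B.1 0 0).im = q, (B.1 1 0).re = r, (B.1 1 0).im = s at h
  ext i j
  fin_cases i <;> fin_cases j <;>
    simp [quatRot, mul_apply, Fin.sum_univ_three]
  · linear_combination (p ^ 2 + q ^ 2 + r ^ 2 + s ^ 2 + 1) * h
  · ring
  · ring
  · ring
  · linear_combination (p ^ 2 + q ^ 2 + r ^ 2 + s ^ 2 + 1) * h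
  · ring
  · ring
  · ring
  · linear_combination (p ^ 2 + q ^ 2 + r ^ 2 + s ^ 2 + 1) * h

theorem det_Ad (k : PU2) : (Ad k).det = 1 := by
  obtain ⟨B, rfl⟩ := toPU_surjective k
  have h := B.sum_sq
  rw [Ad_toPU_eq]
  generalize (B.1 0 0).re = p, (B.1 0 0).im = q, (B.1 1 0).re = r, (B.1 1 0).im = s at h
  have : (quatRot p q r s).det = (p ^ 2 + q ^ 2 + r ^ 2 + s ^ 2) ^ 3 := by
    simp [quatRot, det_fin_three]
    ring
  rw [this, h, one_pow]

/-- The elements of `su(2)`. -/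
def IsSkew (X : Matrix (Fin 2) (Fin 2) ℂ) : Prop := star X = -X ∧ X.trace = 0

theorem sum_coord {X : Matrix (Fin 2) (Fin 2) ℂ} (hX : IsSkew X) :
    ∑ i, (coord X i : ℂ) • a i = X := by
  obtain ⟨h1, h2⟩ := hX
  rw [trace_fin_two] at h2
  have h00 := congrFun (congrFun h1 0) 0
  have h01 := congrFun (congrFun h1 0) 1
  change star (X 0 0) = -X 0 0 at h00
  change star (X 1 0) = -X 0 1 at h01
  have e1 : X 1 1 = -X 0 0 := by linear_combination h2
  have e2 : X 0 1 = -star (X 1 0) := by rw [h01, neg_neg]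
  have e3 : (X 0 0).re = 0 := by
    have := congrArg Complex.re h00
    simp at this
    linarith
  ext i j
  fin_cases i <;> fin_cases j <;> apply Complex.ext <;>
    simp [coord, a, trace_fin_two, mul_apply, Fin.sum_univ_three, Fin.sum_univ_two, e1, e2, e3] <;>
    ring

theorem isSkew_a (j : Fin 3) : IsSkew (a j) := by
  constructor
  · ext k l
    fin_cases j <;> fin_cases k <;> fin_cases l <;> simp [a, star_apply]
  · fin_cases j <;> simp [a, trace_fin_two]

theorem IsSkew.conj {X : Matrix (Fin 2) (Fin 2) ℂ} (hX : IsSkew X) (B : SU2) :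
    IsSkew (B.1 * X * star B.1) := by
  constructor
  · rw [star_mul, star_mul, star_star, hX.1]
    simp [mul_assoc]
  · rw [trace_mul_comm, ← mul_assoc, B.star_mul, one_mul, hX.2]

theorem IsSkew.commutator {X Y : Matrix (Fin 2) (Fin 2) ℂ} (hX : star X = -X) (hY : star Y = -Y) :
    IsSkew (X * Y - Y * X) := by
  constructor
  · rw [star_sub, star_mul, star_mul, hX, hY]
    simp
  · rw [trace_sub, trace_mul_comm, sub_self]

theorem coord_add (X Y : Matrix (Fin 2) (Fin 2) ℂ) (i : Fin 3) :
    coord (X + Y) i = coord X i + coord Y i := by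
  simp [coord, mul_add]

theorem coord_smul (x : ℝ) (X : Matrix (Fin 2) (Fin 2) ℂ) (i : Fin 3) :
    coord ((x : ℂ) • X) i = x * coord X i := by
  simp [coord]
  ring

/-- An element of `su(2)` has real coordinates in the `a_k`, so a complex linear map acts on them
through the real parts that `coord` extracts. Applied to conjugations and to commutators, this turns
identities between `2 × 2` matrices into identities for `Ad` and `ad`. -/
theorem coord_linear (L : Matrix (Fin 2) (Fin 2) ℂ →ₗ[ℂ] Matrix (Fin 2) (Fin 2) ℂ)
    {X : Matrix (Fin 2) (Fin 2) ℂ} (hX : IsSkew X) (i : Fin 3) :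
    ∑ k, coord (L (a k)) i * coord X k = coord (L X) i := by
  conv_rhs => rw [← sum_coord hX]
  simp only [map_add, map_smul, Fin.sum_univ_three, coord_add, coord_smul]
  ring

theorem sum_coord_conj (B : SU2) {X : Matrix (Fin 2) (Fin 2) ℂ} (hX : IsSkew X) (i : Fin 3) :
    ∑ k, Ad (toPU B) i k * coord X k = coord (B.1 * X * star B.1) i :=
  coord_linear (LinearMap.mulRight ℂ (star B.1) ∘ₗ LinearMap.mulLeft ℂ B.1) hX i

theorem sum_coord_ad (Y : Matrix (Fin 2) (Fin 2) ℂ) {X : Matrix (Fin 2) (Fin 2) ℂ} (hX : IsSkew X)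
    (i : Fin 3) : ∑ k, ad Y i k * coord X k = coord (Y * X - X * Y) i :=
  coord_linear (LinearMap.mulLeft ℂ Y - LinearMap.mulRight ℂ Y) hX i

theorem Ad_mul (k k' : PU2) : Ad (k * k') = Ad k * Ad k' := by
  obtain ⟨B, rfl⟩ := toPU_surjective k
  obtain ⟨B', rfl⟩ := toPU_surjective k'
  rw [← toPU_mul]
  ext i j
  rw [mul_apply]
  refine Eq.trans ?_ (sum_coord_conj B ((isSkew_a j).conj B') i).symm
  rw [Ad_toPU]
  congr 1
  change B.1 * B'.1 * a j * star (B.1 * B'.1) = _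
  rw [star_mul]
  simp only [mul_assoc]

theorem Ad_injective : Function.Injective Ad := by
  suffices h : ∀ k, Ad k = 1 → k = 1 by
    intro k k' hk
    have : k'⁻¹ * k = 1 := by
      refine h _ ?_
      rw [Ad_mul, hk, ← Ad_mul, inv_mul_cancel]
      change Ad (toPU 1) = 1
      rw [Ad_toPU_eq]
      ext i j
      fin_cases i <;> fin_cases j <;> simp [quatRot]
    rw [← mul_one k', ← this, mul_inv_cancel_left]
  intro k hk
  obtain ⟨B, rfl⟩ := toPU_surjective k
  have hs := B.sum_sq
  rw [Ad_toPU_eq] at hk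
  have h0 := congrFun (congrFun hk 0) 0
  have h2 := congrFun (congrFun hk 2) 2
  simp [quatRot] at h0 h2
  -- The entry `(2, 2)` is `|α|² - |β|² = 1`, while `|α|² + |β|² = 1`: this forces `β = 0`. The
  -- entry `(0, 0)` then makes `α` real, so `α = ±1`.
  have hr : (B.1 1 0).re = 0 := by nlinarith [sq_nonneg (B.1 1 0).re, sq_nonneg (B.1 1 0).im]
  have hi : (B.1 1 0).im = 0 := by nlinarith [sq_nonneg (B.1 1 0).re, sq_nonneg (B.1 1 0).im]
  have hq : (B.1 0 0).im = 0 := by rw [hr, hi] at *; nlinarith [sq_nonneg (B.1 0 0).im]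
  have hβ : B.1 1 0 = 0 := Complex.ext hr hi
  have hp : (B.1 0 0).re ^ 2 = 1 := by rw [hr, hi, hq] at hs; linarith
  refine (QuotientGroup.eq_one_iff B).2 ?_
  have e1 := B.apply_one_one
  have e2 := B.apply_zero_one
  rw [hβ, star_zero, neg_zero] at e2
  rcases sq_eq_one_iff.1 hp with hp | hp
  · left
    have hα : B.1 0 0 = 1 := Complex.ext hp hq
    ext i j
    fin_cases i <;> fin_cases j <;> simp [hα, hβ, e1, e2]
  · right
    have hα : B.1 0 0 = -1 := Complex.ext hp (hq.trans (by simp))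
    ext i j
    fin_cases i <;> fin_cases j <;> simp [hα, hβ, e1, e2]

/-- Conjugation by `diag(w, w̄)` fixes `a₃` and rotates the plane of `a₁, a₂` by `w²`. -/
theorem Ad_theta (ζ : Circle) : Ad (theta ζ) =
    !![(ζ : ℂ).re, -(ζ : ℂ).im, 0; (ζ : ℂ).im, (ζ : ℂ).re, 0; 0, 0, 1] := by
  obtain ⟨w, rfl⟩ : ∃ w : Circle, w ^ 2 = ζ := ⟨Circle.exp (Complex.arg (ζ : ℂ) / 2), by
    rw [← Circle.exp_nsmul]
    simp [mul_div_cancel₀, Circle.exp_arg]⟩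
  rw [theta_sq, Ad_toPU_eq]
  have h : (w : ℂ).re ^ 2 + (w : ℂ).im ^ 2 = 1 := by
    have := Circle.normSq_coe w
    rw [Complex.normSq_apply] at this
    linarith
  ext i j
  fin_cases i <;> fin_cases j <;> simp [quatRot, tau, pow_two] <;> linarith

/-- Transitivity on the unit sphere. The quaternion comes from the half-angle formulas, `α = √((1 +
z)/2)` and `β = (x - iy)/(2α)`, which break down only at the south pole. -/
theorem exists_Ad_third_column {x y z : ℝ} (h : x ^ 2 + y ^ 2 + z ^ 2 = 1) :
    ∃ k, Ad k 0 2 = x ∧ Ad k 1 2 = y ∧ Ad k 2 2 = z := by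
  by_cases hz : z = -1
  · have hx : x = 0 := by subst hz; nlinarith [sq_nonneg x, sq_nonneg y]
    have hy : y = 0 := by subst hz; nlinarith [sq_nonneg x, sq_nonneg y]
    refine ⟨toPU (mkSU2 0 1 (by simp)), ?_⟩
    rw [Ad_toPU_eq]
    simp [mkSU2, quatRot, hx, hy, hz]
  · have hz1 : 0 < 1 + z := by
      have h1 : -1 ≤ z := by nlinarith [sq_nonneg x, sq_nonneg y]
      have h2 : -1 < z := lt_of_le_of_ne h1 (Ne.symm hz)
      linarith
    set p := √((1 + z) / 2) with hp
    have hp0 : 0 < p := Real.sqrt_pos.2 (by linarith)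
    have hp2 : p ^ 2 = (1 + z) / 2 := Real.sq_sqrt (by linarith)
    have hβ : (x / (2 * p)) ^ 2 + (-y / (2 * p)) ^ 2 = (1 - z) / 2 := by
      rw [div_pow, div_pow, ← add_div, div_eq_iff (by positivity), mul_pow, hp2]
      linear_combination h
    refine ⟨toPU (mkSU2 (p : ℂ) ⟨x / (2 * p), -y / (2 * p)⟩ ?_), ?_⟩
    · simp only [Complex.ofReal_re, Complex.ofReal_im]
      linear_combination hp2 + hβ
    · rw [Ad_toPU_eq]
      simp only [mkSU2, quatRot]
      simp
      refine ⟨by field_simp, by field_simp, ?_⟩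
      linear_combination hp2 - hβ

/-- An element `k` is chosen so that `Ad k` has the same third column as `R`. Then `Q = (Ad k)⁻¹ R`
is orthogonal, has positive determinant and fixes the third axis; it is therefore a plane rotation,
which belongs to the image of `theta`. -/
theorem exists_Ad_eq {R : Matrix (Fin 3) (Fin 3) ℝ} (h1 : Rᵀ * R = 1) (h2 : 0 < R.det) :
    ∃ k, Ad k = R := by
  have hR := congrFun (congrFun h1 2) 2
  simp [mul_apply, Fin.sum_univ_three] at hR
  obtain ⟨k, hk0, hk1, hk2⟩ := exists_Ad_third_column (x := R 0 2) (y := R 1 2) (z := R 2 2)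
    (by linear_combination hR)
  have hk := Ad_orthogonal k
  have hk' := mul_eq_one_comm.1 hk
  set Q := (Ad k)ᵀ * R with hQ
  have hRQ : R = Ad k * Q := by rw [hQ, ← mul_assoc, hk', one_mul]
  have hQQ : Qᵀ * Q = 1 := by
    rw [hQ, transpose_mul, transpose_transpose, mul_assoc, ← mul_assoc (Ad k), hk', one_mul, h1]
  have hdet : 0 < Q.det := by rwa [hQ, det_mul, det_transpose, det_Ad, one_mul]
  have hcol : ∀ i, Q i 2 = (1 : Matrix (Fin 3) (Fin 3) ℝ) i 2 := fun i => by
    rw [← hk]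
    simp [hQ, mul_apply, Fin.sum_univ_three, hk0, hk1, hk2]
  have c0 := hcol 0
  have c1 := hcol 1
  have c2 := hcol 2
  have q20 := congrFun (congrFun hQQ 2) 0
  have q21 := congrFun (congrFun hQQ 2) 1
  have q00 := congrFun (congrFun hQQ 0) 0
  have q11 := congrFun (congrFun hQQ 1) 1
  have q01 := congrFun (congrFun hQQ 0) 1
  rw [det_fin_three] at hdet
  simp [mul_apply, Fin.sum_univ_three] at c0 c1 c2 q20 q21 q00 q11 q01
  simp only [c0, c1, c2, zero_mul, one_mul, zero_add] at q20 q21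
  simp only [q20, q21, c0, c1, c2, mul_zero, zero_mul, mul_one, add_zero, sub_zero]
    at q00 q11 q01 hdet
  have hD : Q 0 0 * Q 1 1 - Q 0 1 * Q 1 0 = 1 := by
    -- The square of the determinant of the `2 × 2` block is its Gram determinant.
    have : (Q 0 0 * Q 1 1 - Q 0 1 * Q 1 0) ^ 2 = 1 := by
      linear_combination q00 * (Q 0 1 * Q 0 1 + Q 1 1 * Q 1 1) + q11 -
        (Q 0 0 * Q 0 1 + Q 1 0 * Q 1 1) * q01
    rcases sq_eq_one_iff.1 this with h | h <;> linarith
  have hs : (Q 1 1 - Q 0 0) ^ 2 + (Q 0 1 + Q 1 0) ^ 2 = 0 := by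
    linear_combination q00 + q11 - 2 * hD
  have e1 : Q 1 1 = Q 0 0 := by nlinarith [sq_nonneg (Q 1 1 - Q 0 0), sq_nonneg (Q 0 1 + Q 1 0)]
  have e2 : Q 0 1 = -Q 1 0 := by nlinarith [sq_nonneg (Q 1 1 - Q 0 0), sq_nonneg (Q 0 1 + Q 1 0)]
  let ζ : Circle := ⟨⟨Q 0 0, Q 1 0⟩, by
    change (⟨Q 0 0, Q 1 0⟩ : ℂ) ∈ Metric.sphere (0 : ℂ) 1
    rw [mem_sphere_zero_iff_norm, ← pow_eq_one_iff_of_nonneg (norm_nonneg _) two_ne_zero,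
      ← Complex.normSq_eq_norm_sq, Complex.normSq_mk, q00]⟩
  refine ⟨k * theta ζ, ?_⟩
  rw [Ad_mul, hRQ]
  congr 1
  rw [Ad_theta]
  ext i j
  fin_cases i <;> fin_cases j <;> simp [ζ, c0, c1, c2, q20, q21, e1, e2]

end AdjointRepresentation

/-! ### Differentials of Möbius transformations on the manifold `ℍ`. -/

section DerivativeOfMoebius

/-- The chart of `ℍ` is the inclusion itself, so tangent vectors of `ℍ` are complex numbers without
any conversion factor. -/
theorem hasMFDerivAt_coe (z : ℍ) :
    HasMFDerivAt 𝓘(ℝ, ℂ) 𝓘(ℝ, ℂ) ((↑) : ℍ → ℂ) z (ContinuousLinearMap.id ℝ ℂ) := by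
  refine ⟨UpperHalfPlane.continuous_coe.continuousAt, ?_⟩
  refine (hasFDerivWithinAt_id _ _).congr_of_eventuallyEq ?_ ?_
  · filter_upwards [extChartAt_target_mem_nhdsWithin (I := 𝓘(ℝ, ℂ)) z] with y hy
    exact (extChartAt 𝓘(ℝ, ℂ) z).right_inv hy
  · exact (extChartAt 𝓘(ℝ, ℂ) z).right_inv (mem_extChartAt_target z)

theorem hasMFDerivAt_ofComplex {w : ℂ} (hw : 0 < w.im) :
    HasMFDerivAt 𝓘(ℝ, ℂ) 𝓘(ℝ, ℂ) UpperHalfPlane.ofComplex w (ContinuousLinearMap.id ℝ ℂ) := by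
  have h := ((isLocalDiffeomorphAt_ofComplex hw).mdifferentiableAt (by simp)).hasMFDerivAt
  have h1 := (HasMFDerivAt.comp w (hasMFDerivAt_coe _) h).congr_of_eventuallyEq
    (UpperHalfPlane.eventuallyEq_coe_comp_ofComplex hw).symm
  have h2 := hasMFDerivAt_unique h1 (hasMFDerivAt_id w)
  exact h.congr_mfderiv h2

theorem hasMFDerivAt_SL_smul (A : SL(2, ℝ)) (z : ℍ) :
    HasMFDerivAt 𝓘(ℝ, ℂ) 𝓘(ℝ, ℂ) (fun w : ℍ => A • w) z
      ((ContinuousLinearMap.mul ℝ ℂ (1 / (A 1 0 * z + A 1 1) ^ 2))) := by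
  have h1 : HasFDerivAt (mob A) _ (z : ℂ) :=
    ((hasDerivAt_mob A z.im_pos).hasFDerivAt).restrictScalars ℝ
  have h2 : 0 < (mob A z).im := by rw [← coe_smul_eq_mob]; exact UpperHalfPlane.im_pos _
  have h3 := HasMFDerivAt.comp z (hasMFDerivAt_ofComplex h2)
    (HasMFDerivAt.comp z h1.hasMFDerivAt (hasMFDerivAt_coe z))
  refine (h3.congr_of_eventuallyEq (Filter.Eventually.of_forall fun w => ?_)).congr_mfderiv ?_
  · change A • w = UpperHalfPlane.ofComplex (mob A w)
    rw [← coe_smul_eq_mob, UpperHalfPlane.ofComplex_apply]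
  · refine ContinuousLinearMap.ext fun v => ?_
    exact mul_comm (G := ℂ) _ _

end DerivativeOfMoebius

/-! ### The complex number `g'(i)`. -/

section FrameScalar

/-- The derivative at `i` of the Möbius transformation of an element of `PSL(2, ℝ)`. -/
def derivAtI : PSL(2, ℝ) → ℂ :=
  Quotient.lift (fun A : SL(2, ℝ) => 1 / ((A 1 0 : ℂ) * Complex.I + A 1 1) ^ 2) (by
    intro A B h
    have h' : A⁻¹ * B ∈ Subgroup.center SL(2, ℝ) := QuotientGroup.leftRel_apply.1 h
    obtain ⟨r, hr, hc⟩ := Matrix.SpecialLinearGroup.mem_center_iff.1 h'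
    have hB : B.1 = A.1 * Matrix.scalar (Fin 2) r := by
      rw [hc, ← Matrix.SpecialLinearGroup.coe_mul, mul_inv_cancel_left]
    have h0 : B 1 0 = A 1 0 * r := by
      rw [hB]; simp
    have h1 : B 1 1 = A 1 1 * r := by
      rw [hB]; simp
    have hr' : (r : ℂ) ^ 2 = 1 := by
      have : r ^ 2 = 1 := by simpa using hr
      exact_mod_cast this
    simp only [h0, h1, Complex.ofReal_mul]
    congr 1
    linear_combination -((A 1 0 : ℂ) * Complex.I + A 1 1) ^ 2 * hr')

theorem derivAtI_toPSL (A : SL(2, ℝ)) :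
    derivAtI (toPSL A) = 1 / ((A 1 0 : ℂ) * Complex.I + A 1 1) ^ 2 := rfl

theorem denom_I_ne_zero (A : SL(2, ℝ)) : (A 1 0 : ℂ) * Complex.I + A 1 1 ≠ 0 :=
  denom_ne_zero A (by simp)

theorem coe_SL_smul_I (A : SL(2, ℝ)) : ((A • UpperHalfPlane.I : ℍ) : ℂ) =
    (A 0 0 * Complex.I + A 0 1) / (A 1 0 * Complex.I + A 1 1) := by
  rw [coe_smul_eq_mob, mob, UpperHalfPlane.coe_I]

theorem derivAtI_mul (A B : SL(2, ℝ)) : derivAtI (toPSL (A * B)) =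
    1 / (A 1 0 * ((B • UpperHalfPlane.I : ℍ) : ℂ) + A 1 1) ^ 2 * derivAtI (toPSL B) := by
  have e0 : (A * B) 1 0 = A 1 0 * B 0 0 + A 1 1 * B 1 0 := by
    simp [Matrix.mul_apply, Fin.sum_univ_two]
  have e1 : (A * B) 1 1 = A 1 0 * B 0 1 + A 1 1 * B 1 1 := by
    simp [Matrix.mul_apply, Fin.sum_univ_two]
  have hB := denom_I_ne_zero B
  rw [derivAtI_toPSL, derivAtI_toPSL, coe_SL_smul_I, e0, e1, div_mul_div_comm, one_mul, ← mul_pow]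
  congr 2
  have key : ∀ a b n j : ℂ, j ≠ 0 → (a * (n / j) + b) * j = a * n + b * j := by
    intro a b n j hj
    field_simp
  refine Eq.trans ?_ (key _ _ _ _ hB).symm
  push_cast
  ring

/-- By the chain rule the extra factor is `h'(i) = (a - ib)⁻²` for a rotation with first row `(a,
b)`, and this equals `(a + ib)²` because `a² + b² = 1`. -/
theorem derivAtI_mul_stab (g : PSL(2, ℝ)) (h : stabI) :
    derivAtI (g * h) = derivAtI g * sigma h := by
  obtain ⟨A, rfl⟩ := toPSL_surjective g
  obtain ⟨k, hk⟩ := h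
  obtain ⟨B, rfl⟩ := toPSL_surjective k
  have hB : B • UpperHalfPlane.I = UpperHalfPlane.I := by rw [← toPSL_smul]; exact hk
  change derivAtI (toPSL (A * B)) = _
  rw [derivAtI_mul, hB, UpperHalfPlane.coe_I, sigma_coe, ← derivAtI_toPSL, derivAtI_toPSL B]
  congr 1
  obtain ⟨h1, h2, h3⟩ := toPSL_mem_stabI hk
  have h3' : (B 0 0 : ℂ) ^ 2 + (B 0 1 : ℂ) ^ 2 = 1 := by exact_mod_cast h3
  rw [one_div, inv_eq_iff_eq_inv, ← inv_pow]
  congr 1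
  rw [h1, h2]
  refine eq_inv_of_mul_eq_one_left ?_
  push_cast
  linear_combination h3' - (B 0 1 : ℂ) ^ 2 * Complex.I_sq

theorem derivAtI_ne_zero (g : PSL(2, ℝ)) : derivAtI g ≠ 0 := by
  obtain ⟨A, rfl⟩ := toPSL_surjective g
  exact one_div_ne_zero (pow_ne_zero 2 (denom_I_ne_zero A))

theorem im_SL_smul_I (A : SL(2, ℝ)) : (A • UpperHalfPlane.I : ℍ).im =
    1 / Complex.normSq ((A 1 0 : ℂ) * Complex.I + A 1 1) := by
  have hd := det_SL A
  rw [← UpperHalfPlane.coe_im, coe_SL_smul_I, Complex.div_im, ← sub_div]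
  congr 1
  simp
  linarith

/-- Expresses that `g` is an isometry of `|dz|²/y²`: the unit vector `1` at `i` is sent to a vector
of Euclidean length `Im (g i)`. -/
theorem normSq_derivAtI (g : PSL(2, ℝ)) :
    Complex.normSq (derivAtI g) = (g • UpperHalfPlane.I : ℍ).im ^ 2 := by
  obtain ⟨A, rfl⟩ := toPSL_surjective g
  rw [toPSL_smul, im_SL_smul_I, derivAtI_toPSL]
  simp

end FrameScalar

/-! ### The map from the homogeneous bundle to orthonormal frames. -/

section Frames

variable {M : Type*} [TopologicalSpace M] [ChartedSpace ℂ M] {Γ : Subgroup PSL(2, ℝ)} {pr : ℍ → M}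

theorem mfderiv_idProd {S S' : Type*} [TopologicalSpace S] [ChartedSpace ℂ S] [TopologicalSpace S']
    [ChartedSpace ℂ S'] {f : S → S'} {z : S}
    {L : TangentSpace 𝓘(ℝ, ℂ) z →L[ℝ] TangentSpace 𝓘(ℝ, ℂ) (f z)}
    (hf : HasMFDerivAt 𝓘(ℝ, ℂ) 𝓘(ℝ, ℂ) f z L) (t : ℝ) (v : ℝ × ℂ) :
    mfderiv cylModel cylModel (Prod.map id f : ℝ × S → ℝ × S') (t, z) v =
      ((v.1, L v.2) : ℝ × ℂ) := by
  have h1 := HasMFDerivAt.prodMap (p := ((t, z) : ℝ × S)) (hasMFDerivAt_id (I := 𝓘(ℝ, ℝ)) t) hf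
  refine (congrArg (fun L : ℝ × ℂ →L[ℝ] ℝ × ℂ => L v) h1.mfderiv).trans (Prod.ext ?_ ?_)
  · exact congrArg (fun L : ℝ →L[ℝ] ℝ => L v.1) (hasMFDerivAt_id (I := 𝓘(ℝ, ℝ)) t).mfderiv
  · exact congrArg (fun L : ℂ →L[ℝ] ℂ => L v.2) hf.mfderiv

theorem IsQuotientBy.mfderiv_idpr (h : IsQuotientBy Γ pr) (t : ℝ) (z : ℍ) (v : ℝ × ℂ) :
    mfderiv cylModel cylModel (Prod.map id pr : ℝ × ℍ → ℝ × M) (t, z) v =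
      ((v.1, mfderiv 𝓘(ℝ, ℂ) 𝓘(ℝ, ℂ) pr z v.2) : ℝ × ℂ) :=
  mfderiv_idProd ((h.isLocalDiffeomorph z).mdifferentiableAt (by simp)).hasMFDerivAt t v

theorem IsQuotientBy.mvfderiv_dev_mfderiv_pr (h : IsQuotientBy Γ pr) {φ : M → ℂ} {z : ℍ}
    (hφ : IsDev pr φ (pr z)) {A : SL(2, ℝ)} (hA : ∀ᶠ w in 𝓝 z, φ (pr w) = (A • w : ℍ)) (v : ℂ) :
    mvfderiv 𝓘(ℝ, ℂ) φ (pr z) (mfderiv 𝓘(ℝ, ℂ) 𝓘(ℝ, ℂ) pr z v) =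
      1 / ((A 1 0 : ℂ) * z + A 1 1) ^ 2 * v := by
  have h1 := HasMFDerivAt.comp z (hφ.1.mdifferentiableAt (by simp)).hasMFDerivAt
    ((h.isLocalDiffeomorph z).mdifferentiableAt (by simp)).hasMFDerivAt
  have h2 := HasMFDerivAt.comp z (hasMFDerivAt_coe _) (hasMFDerivAt_SL_smul A z)
  have h3 := hasMFDerivAt_unique h1 (h2.congr_of_eventuallyEq hA)
  exact congrArg (fun L : ℂ →L[ℝ] ℂ => L v) h3

theorem IsQuotientBy.mvfderiv_cylDev_mfderiv_idpr (h : IsQuotientBy Γ pr) {φ : M → ℂ} {z : ℍ}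
    (hφ : IsDev pr φ (pr z)) {A : SL(2, ℝ)} (hA : ∀ᶠ w in 𝓝 z, φ (pr w) = (A • w : ℍ)) (t : ℝ)
    (v : ℝ × ℂ) :
    mvfderiv cylModel (cylDev φ) (slice t (pr z))
      (mfderiv cylModel cylModel (Prod.map id pr : ℝ × ℍ → ℝ × M) (t, z) v) =
      (v.1, 1 / ((A 1 0 : ℂ) * z + A 1 1) ^ 2 * v.2) := by
  rw [h.mfderiv_idpr]
  exact (mvfderiv_cylDev (p := slice t (pr z)) hφ.1 _).trans
    (Prod.ext rfl (h.mvfderiv_dev_mfderiv_pr hφ hA _))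

theorem IsQuotientBy.exists_isDev_idpr (h : IsQuotientBy Γ pr) (z : ℍ) :
    ∃ φ : M → ℂ, IsDev pr φ (pr z) ∧ φ (pr z) = z ∧ ∀ (t : ℝ) (v : ℝ × ℂ),
      mvfderiv cylModel (cylDev φ) (slice t (pr z))
        (mfderiv cylModel cylModel (Prod.map id pr : ℝ × ℍ → ℝ × M) (t, z) v) = v := by
  obtain ⟨φ, hφ, hz⟩ := h.exists_isDev z
  refine ⟨φ, hφ, hz.self_of_nhds, fun t v => ?_⟩
  refine (h.mvfderiv_cylDev_mfderiv_idpr hφ (A := 1) ?_ t v).trans ?_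
  · filter_upwards [hz] with w hw
    rw [hw, one_smul]
  · simp

theorem IsQuotientBy.cylInner_mfderiv_idpr (h : IsQuotientBy Γ pr) (t : ℝ) (z : ℍ) (v w : ℝ × ℂ) :
    h.cylInner (slice t (pr z))
      (mfderiv cylModel cylModel (Prod.map id pr : ℝ × ℍ → ℝ × M) (t, z) v)
      (mfderiv cylModel cylModel (Prod.map id pr : ℝ × ℍ → ℝ × M) (t, z) w) =
      warp (t, (z : ℂ)) v w := by
  obtain ⟨φ, hφ, hz, he⟩ := h.exists_isDev_idpr z
  refine (h.cylInner_eq (p := slice t (pr z)) hφ _ _).trans ?_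
  rw [he, he]
  change warp (t, φ (pr z)) v w = _
  rw [hz]

theorem IsQuotientBy.mfderiv_idpr_injective (h : IsQuotientBy Γ pr) (t : ℝ) (z : ℍ) :
    Function.Injective
      (mfderiv cylModel cylModel (Prod.map id pr : ℝ × ℍ → ℝ × M) (t, z)) := by
  obtain ⟨φ, hφ, hz, he⟩ := h.exists_isDev_idpr z
  intro v w hvw
  exact (he t v).symm.trans ((congrArg _ hvw).trans (he t w))

/-- The chain rule applied to `pr ∘ A = pr`. -/
theorem IsQuotientBy.tangentMap_idpr_smul (h : IsQuotientBy Γ pr) {A : SL(2, ℝ)} (hA : toPSL A ∈ Γ)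
    (t : ℝ) (z : ℍ) (v : ℝ × ℂ) :
    tangentMap cylModel cylModel (Prod.map id pr : ℝ × ℍ → ℝ × M)
        ⟨(t, A • z), ((v.1, 1 / ((A 1 0 : ℂ) * z + A 1 1) ^ 2 * v.2) : ℝ × ℂ)⟩ =
      tangentMap cylModel cylModel (Prod.map id pr : ℝ × ℍ → ℝ × M) ⟨(t, z), v⟩ := by
  have h1 := HasMFDerivAt.prodMap (p := ((t, z) : ℝ × ℍ)) (hasMFDerivAt_id (I := 𝓘(ℝ, ℝ)) t)
    (hasMFDerivAt_SL_smul A z)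
  have e : (Prod.map id pr : ℝ × ℍ → ℝ × M) ∘ Prod.map id (fun w : ℍ => A • w) =
      Prod.map id pr := by
    funext q
    refine Prod.ext rfl ?_
    exact ((h.eq_iff _ _).2 ⟨toPSL A, hA, toPSL_smul A q.2⟩).symm
  have hd : MDifferentiableAt cylModel cylModel (Prod.map id pr : ℝ × ℍ → ℝ × M) (t, A • z) :=
    (HasMFDerivAt.prodMap (p := ((t, A • z) : ℝ × ℍ)) (hasMFDerivAt_id (I := 𝓘(ℝ, ℝ)) t)
      (((h.isLocalDiffeomorph _).mdifferentiableAt (by simp)).hasMFDerivAt)).mdifferentiableAt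
  have h2 := tangentMap_comp_at (I := cylModel) (I' := cylModel) (I'' := cylModel)
    (⟨(t, z), v⟩ : TangentBundle cylModel (ℝ × ℍ)) hd h1.mdifferentiableAt
  rw [e] at h2
  refine Eq.trans ?_ h2.symm
  congr 1
  refine congrArg (Bundle.TotalSpace.mk ((t, A • z) : ℝ × ℍ)) ?_
  exact (mfderiv_idProd (hasMFDerivAt_SL_smul A z) t v).symm

variable [IsManifold 𝓘(ℝ, ℂ) ∞ M]

/-- The type of the vectors depends on the base point; comparing points of the tangent bundle avoids
transporting them. -/
theorem SOFrame.ext_toTangent {g : Bundle.ContMDiffRiemannianMetric cylModel ∞ (ℝ × ℂ)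
    (fun p : ℝ × M => TangentSpace cylModel p)} {t : ℝ} {F F' : SOFrame pr g t}
    (h : ∀ j, F.toTangent j = F'.toTangent j) : F = F' := by
  obtain ⟨x, v, ho, hp⟩ := F
  obtain ⟨x', v', ho', hp'⟩ := F'
  obtain rfl : x = x' := congrArg (fun p : TangentBundle cylModel (ℝ × M) => p.1.2) (h 0)
  obtain rfl : v = v' := funext fun j => eq_of_heq (Bundle.TotalSpace.mk.inj (h j)).2
  rfl

/-- The vector of the cylinder over the upper half-plane which has given coordinates in the
orthonormal frame attached to an element of `PSL(2, ℝ)`. -/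
def frameCol (t : ℝ) (g : PSL(2, ℝ)) (x : Fin 3 → ℝ) : ℝ × ℂ :=
  -- The vector `∂_t` comes third because `χ` rotates the plane of `a₁, a₂` and fixes `a₃`; division
  -- by `cosh t` compensates the warping factor.
  (x 2, (x 0 + x 1 * Complex.I) * (derivAtI g / Real.cosh t))

theorem warp_frameCol (t : ℝ) (g : PSL(2, ℝ)) (x y : Fin 3 → ℝ) :
    warp (t, ((g • UpperHalfPlane.I : ℍ) : ℂ)) (frameCol t g x) (frameCol t g y) =
      x 0 * y 0 + x 1 * y 1 + x 2 * y 2 := by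
  have hc := (Real.cosh_pos t).ne'
  have hy := (g • UpperHalfPlane.I : ℍ).im_pos.ne'
  have hn : Real.cosh t ^ 2 * Complex.normSq (derivAtI g / Real.cosh t) =
      (g • UpperHalfPlane.I : ℍ).im ^ 2 := by
    rw [map_div₀, Complex.normSq_ofReal, normSq_derivAtI]
    field_simp
  rw [Complex.normSq_apply] at hn
  rw [warp_apply]
  simp only [frameCol]
  generalize derivAtI g / (Real.cosh t : ℂ) = κ at *
  simp
  field_simp
  linear_combination (x 0 * y 0 + x 1 * y 1) * hn

/-- The vectors of the frame attached to a point of `P_χ`, in the cylinder over the upper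
half-plane. -/
def frameVec (t : ℝ) (g : PSL(2, ℝ)) (k : PU2) (j : Fin 3) : ℝ × ℂ :=
  frameCol t g fun i => Ad k i j

theorem warp_frameVec (t : ℝ) (g : PSL(2, ℝ)) (k : PU2) (i j : Fin 3) :
    warp (t, ((g • UpperHalfPlane.I : ℍ) : ℂ)) (frameVec t g k i) (frameVec t g k j) =
      if i = j then 1 else 0 := by
  have ho := congrFun (congrFun (Ad_orthogonal k) i) j
  rw [Matrix.one_apply, Matrix.mul_apply, Fin.sum_univ_three] at ho
  exact (warp_frameCol t g _ _).trans ho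

/-- The frame attached to a point of `P_χ`. -/
def IsQuotientBy.frame (h : IsQuotientBy Γ pr) (t : ℝ) (g : PSL(2, ℝ)) (k : PU2) :
    SOFrame pr h.cylMetric t where
  pt := pr (g • UpperHalfPlane.I)
  vec j := mfderiv cylModel cylModel (Prod.map id pr : ℝ × ℍ → ℝ × M) (t, g • UpperHalfPlane.I)
    (frameVec t g k j)
  orthonormal i j := (h.cylInner_mfderiv_idpr t _ _ _).trans (warp_frameVec t g k i j)
  positive := by
    set κ : ℂ := derivAtI g / Real.cosh t with hκ
    have hκ0 : κ ≠ 0 := div_ne_zero (derivAtI_ne_zero g) (by exact_mod_cast (Real.cosh_pos t).ne')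
    -- The matrix expresses the frame for `k = 1` in the basis `(∂_t, 1, i)`; its determinant is
    -- `|κ|²`.
    refine ⟨g • UpperHalfPlane.I, !![0, 0, 1; κ.re, -κ.im, 0; κ.im, κ.re, 0] * Ad k, ?_,
      fun j => ?_⟩
    · rw [Matrix.det_mul, det_Ad, mul_one, Matrix.det_fin_three]
      have := Complex.normSq_pos.2 hκ0
      rw [Complex.normSq_apply] at this
      simpa using this
    · have e : frameVec t g k j = ((!![0, 0, 1; κ.re, -κ.im, 0; κ.im, κ.re, 0] * Ad k) 0 j,
          (((!![0, 0, 1; κ.re, -κ.im, 0; κ.im, κ.re, 0] * Ad k) 1 j : ℝ) : ℂ) +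
          ((!![0, 0, 1; κ.re, -κ.im, 0; κ.im, κ.re, 0] * Ad k) 2 j : ℝ) * Complex.I) := by
        refine Prod.ext ?_ ?_
        · simp [frameVec, frameCol, Matrix.mul_apply, Fin.sum_univ_three]
        · simp only [frameVec, frameCol, ← hκ]
          apply Complex.ext <;> simp [Matrix.mul_apply, Fin.sum_univ_three] <;> ring
      rw [← e]
      rfl

theorem IsQuotientBy.frame_toTangent (h : IsQuotientBy Γ pr) (t : ℝ) (g : PSL(2, ℝ)) (k : PU2)
    (j : Fin 3) : (h.frame t g k).toTangent j =
      tangentMap cylModel cylModel (Prod.map id pr : ℝ × ℍ → ℝ × M)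
        ⟨(t, g • UpperHalfPlane.I), frameVec t g k j⟩ := rfl

/-- Replacing `g` by `g h` multiplies `g'(i)` by `σ(h)`, which is the rotation `Ad (χ(h))` of the
first two coordinates: exactly the relation that defines `P_χ`. -/
theorem frameVec_mul_stab (t : ℝ) (g : PSL(2, ℝ)) (h : stabI) (k : PU2) (j : Fin 3) :
    frameVec t (g * h) k j = frameVec t g (chi h * k) j := by
  have e : ∀ i, Ad (chi h * k) i j = ∑ l, Ad (theta (sigma h)) i l * Ad k l j := fun i => by
    rw [Ad_mul]; rfl
  simp only [frameVec, frameCol, e, derivAtI_mul_stab, Ad_theta, Fin.sum_univ_three]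
  refine Prod.ext (by simp) ?_
  have hs : (sigma h : ℂ) = (sigma h : ℂ).re + (sigma h : ℂ).im * Complex.I :=
    (Complex.re_add_im _).symm
  generalize (sigma h : ℂ) = σ at *
  simp only [Matrix.of_apply, Matrix.cons_val', Matrix.cons_val_zero, Matrix.cons_val_one,
    Matrix.cons_val, Complex.ofReal_add, Complex.ofReal_mul, Complex.ofReal_neg,
    Complex.ofReal_zero, Complex.ofReal_cosh]
  linear_combination (Ad k 0 j + Ad k 1 j * Complex.I) * (derivAtI g / Complex.cosh t) * hs +
    (Ad k 1 j * σ.im : ℂ) * (derivAtI g / Complex.cosh t) * Complex.I_sq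

theorem IsQuotientBy.frame_mul_stab (h : IsQuotientBy Γ pr) (t : ℝ) (g : PSL(2, ℝ)) (k : PU2)
    (s : stabI) : h.frame t (g * s) k = h.frame t g (chi s * k) := by
  refine SOFrame.ext_toTangent fun j => ?_
  have hs : (g * s) • UpperHalfPlane.I = g • UpperHalfPlane.I := by rw [mul_smul, s.2]
  rw [h.frame_toTangent, h.frame_toTangent, hs, frameVec_mul_stab]

theorem IsQuotientBy.frame_smul (h : IsQuotientBy Γ pr) (t : ℝ) {γ : PSL(2, ℝ)} (hγ : γ ∈ Γ)
    (g : PSL(2, ℝ)) (k : PU2) : h.frame t (γ * g) k = h.frame t g k := by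
  obtain ⟨A, rfl⟩ := toPSL_surjective γ
  obtain ⟨B, rfl⟩ := toPSL_surjective g
  refine SOFrame.ext_toTangent fun j => ?_
  rw [h.frame_toTangent, h.frame_toTangent]
  have e : frameVec t (toPSL A * toPSL B) k j = ((frameVec t (toPSL B) k j).1,
      1 / (A 1 0 * ((toPSL B • UpperHalfPlane.I : ℍ) : ℂ) + A 1 1) ^ 2 *
        (frameVec t (toPSL B) k j).2) := by
    refine Prod.ext rfl ?_
    change (_ * (derivAtI (toPSL (A * B)) / _)) = _ * (_ * (derivAtI (toPSL B) / _))
    rw [derivAtI_mul, toPSL_smul]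
    ring
  rw [e, mul_smul, toPSL_smul A]
  exact h.tangentMap_idpr_smul hγ t _ _

/-- The isomorphism from the `Γ`-quotient of `P_χ` to the frame bundle. -/
def IsQuotientBy.toFrame (h : IsQuotientBy Γ pr) (t : ℝ) :
    GammaQuotient Γ → SOFrame pr h.cylMetric t :=
  Quotient.lift (Quotient.lift (fun p => h.frame t p.1 p.2) (by
    rintro p q ⟨s, h1, h2⟩
    rw [h1, h.frame_mul_stab, h2])) (by
    rintro p ⟨q⟩ ⟨γ, rfl⟩
    exact h.frame_smul t γ.2 q.1 q.2)

theorem IsQuotientBy.toFrame_mk (h : IsQuotientBy Γ pr) (t : ℝ) (g : PSL(2, ℝ)) (k : PU2) :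
    h.toFrame t (.mk Γ g k) = h.frame t g k := rfl

end Frames

/-! ### Equivariance, bijectivity and smoothness. -/

section Isomorphism

variable {M : Type*} [TopologicalSpace M] [ChartedSpace ℂ M] [IsManifold 𝓘(ℝ, ℂ) ∞ M]
  {Γ : Subgroup PSL(2, ℝ)} {pr : ℍ → M}

theorem frameVec_mul (t : ℝ) (g : PSL(2, ℝ)) (k k' : PU2) (j : Fin 3) :
    frameVec t g (k * k') j = ∑ i, Ad k' i j • frameVec t g k i := by
  have e : ∀ i, Ad (k * k') i j = ∑ l, Ad k i l * Ad k' l j := fun i => by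
    rw [Ad_mul]; rfl
  simp only [frameVec, frameCol, e, Fin.sum_univ_three]
  refine Prod.ext ?_ ?_
  · simp
    ring
  · simp
    ring

theorem IsQuotientBy.frame_mul_vec (h : IsQuotientBy Γ pr) (t : ℝ) (g : PSL(2, ℝ)) (k k' : PU2)
    (j : Fin 3) : (h.frame t g (k * k')).vec j = ∑ i, Ad k' i j • (h.frame t g k).vec i := by
  change mfderiv cylModel cylModel (Prod.map id pr : ℝ × ℍ → ℝ × M) (t, g • UpperHalfPlane.I)
    (frameVec t g (k * k') j) = _
  rw [frameVec_mul]
  refine (map_sum _ _ _).trans (Finset.sum_congr rfl fun i _ => ?_)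
  exact map_smul _ _ _

theorem frameVec_injective {t : ℝ} {g : PSL(2, ℝ)} {k k' : PU2}
    (h : ∀ j, frameVec t g k j = frameVec t g k' j) : k = k' := by
  refine Ad_injective (Matrix.ext fun i j => ?_)
  have hκ : derivAtI g / (Real.cosh t : ℂ) ≠ 0 :=
    div_ne_zero (derivAtI_ne_zero g) (by exact_mod_cast (Real.cosh_pos t).ne')
  obtain ⟨h1, h2⟩ := Prod.ext_iff.1 (h j)
  have h3 := mul_right_cancel₀ hκ h2
  have hre := congrArg Complex.re h3
  have him := congrArg Complex.im h3
  simp at hre him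
  fin_cases i
  exacts [hre, him, h1]

theorem GammaQuotient.exists_mk (x : GammaQuotient Γ) : ∃ g k, x = .mk Γ g k := by
  obtain ⟨⟨g, k⟩⟩ := x
  exact ⟨g, k, rfl⟩

theorem GammaQuotient.mk_mul_stab (g : PSL(2, ℝ)) (s : stabI) (k : PU2) :
    GammaQuotient.mk Γ (g * s) k = .mk Γ g (chi s * k) :=
  congrArg (Quotient.mk (MulAction.orbitRel Γ P)) (Quotient.sound ⟨s⁻¹, by simp, by simp⟩)

theorem GammaQuotient.mk_smul {γ : PSL(2, ℝ)} (hγ : γ ∈ Γ) (g : PSL(2, ℝ)) (k : PU2) :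
    GammaQuotient.mk Γ (γ * g) k = .mk Γ g k :=
  Quotient.sound ⟨⟨γ, hγ⟩, rfl⟩

theorem exists_smul_I_eq (z : ℍ) : ∃ g : PSL(2, ℝ), g • UpperHalfPlane.I = z :=
  ⟨toPSL z.toSL2R, by rw [toPSL_smul, UpperHalfPlane.toSL2R_smul_I]⟩

theorem IsQuotientBy.toFrame_injective (h : IsQuotientBy Γ pr) (t : ℝ) :
    Function.Injective (h.toFrame t) := by
  intro x x' hx
  obtain ⟨g, k, rfl⟩ := x.exists_mk
  obtain ⟨g', k', rfl⟩ := x'.exists_mk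
  have hpt : pr (g • UpperHalfPlane.I) = pr (g' • UpperHalfPlane.I) := congrArg SOFrame.pt hx
  obtain ⟨γ, hγ, he⟩ := (h.eq_iff _ _).1 hpt
  let s : stabI := ⟨(γ * g)⁻¹ * g', by
    rw [MulAction.mem_stabilizer_iff, mul_smul, ← he, ← mul_smul γ, inv_smul_smul]⟩
  have hg : g' = γ * g * s := (mul_inv_cancel_left _ _).symm
  -- The base points determine `g` up to `Γ` and the stabilizer of `i`. Both classes now have
  -- representatives with the same first component, and only the elements of `PU(2)` remain to be
  -- compared.
  rw [← GammaQuotient.mk_smul hγ g k, hg, GammaQuotient.mk_mul_stab] at hx ⊢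
  generalize γ * g = g₁ at hx
  congr 1
  refine frameVec_injective (t := t) (g := g₁) fun j => ?_
  rw [h.toFrame_mk, h.toFrame_mk] at hx
  have hj := congrArg (fun F : SOFrame pr h.cylMetric t => F.toTangent j) hx
  exact h.mfderiv_idpr_injective t _ (eq_of_heq (Bundle.TotalSpace.mk.inj hj).2)

theorem frameCol_surjective (t : ℝ) (g : PSL(2, ℝ)) : Function.Surjective (frameCol t g) := by
  intro v
  have hκ : derivAtI g / (Real.cosh t : ℂ) ≠ 0 :=
    div_ne_zero (derivAtI_ne_zero g) (by exact_mod_cast (Real.cosh_pos t).ne')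
  refine ⟨![(v.2 / (derivAtI g / Real.cosh t)).re, (v.2 / (derivAtI g / Real.cosh t)).im, v.1], ?_⟩
  refine Prod.ext rfl ?_
  simp only [frameCol, Matrix.cons_val_zero, Matrix.cons_val_one]
  rw [Complex.re_add_im, div_mul_cancel₀ _ hκ]

theorem IsQuotientBy.toFrame_surjective (h : IsQuotientBy Γ pr) (t : ℝ) :
    Function.Surjective (h.toFrame t) := by
  rintro ⟨x, v, ho, z, C, hC, hv⟩
  obtain ⟨g, rfl⟩ := exists_smul_I_eq z
  obtain rfl : x = pr (g • UpperHalfPlane.I) :=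
    congrArg (fun p : TangentBundle cylModel (ℝ × M) => p.1.2) (hv 0)
  have hv' := fun j => eq_of_heq (Bundle.TotalSpace.mk.inj (hv j)).2
  choose R hR using fun j => frameCol_surjective t g
    ((C 0 j, (C 1 j : ℂ) + C 2 j * Complex.I) : ℝ × ℂ)
  have hRR : (Matrix.of fun i j => R j i).transpose *
      (Matrix.of fun i j => R j i : Matrix (Fin 3) (Fin 3) ℝ) = 1 := by
    ext i j
    rw [Matrix.one_apply, ← ho i j, hv', hv', Matrix.mul_apply, Fin.sum_univ_three]
    refine Eq.trans ?_ (h.cylInner_mfderiv_idpr t _ _ _).symm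
    rw [← hR, ← hR, warp_frameCol]
    rfl
  have hdet : 0 < (Matrix.of fun i j => R j i : Matrix (Fin 3) (Fin 3) ℝ).det := by
    set κ : ℂ := derivAtI g / Real.cosh t with hκ
    have hκ0 : κ ≠ 0 := div_ne_zero (derivAtI_ne_zero g) (by exact_mod_cast (Real.cosh_pos t).ne')
    have hn := Complex.normSq_pos.2 hκ0
    rw [Complex.normSq_apply] at hn
    -- `C` and `R` hold the components of the same vectors, in the basis `(∂_t, 1, i)` and in the
    -- frame of `g`. The change of basis has determinant `|κ|² > 0`, so positivity passes to `R`.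
    have e : C = !![0, 0, 1; κ.re, -κ.im, 0; κ.im, κ.re, 0] * Matrix.of fun i j => R j i := by
      ext i j
      obtain ⟨h1, h2⟩ := Prod.ext_iff.1 (hR j)
      simp only [frameCol, ← hκ] at h1 h2
      have hre := congrArg Complex.re h2
      have him := congrArg Complex.im h2
      simp at hre him
      fin_cases i <;> simp [Matrix.mul_apply, Fin.sum_univ_three] <;> linarith
    rw [e, Matrix.det_mul, Matrix.det_fin_three] at hC
    simp at hC
    exact pos_of_mul_pos_right hC hn.le
  obtain ⟨k, hk⟩ := exists_Ad_eq hRR hdet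
  refine ⟨.mk Γ g k, SOFrame.ext_toTangent fun j => ?_⟩
  refine Eq.trans ?_ (hv j).symm
  rw [h.toFrame_mk, h.frame_toTangent, ← hR, frameVec, hk]
  rfl

section Smoothness

variable {W : Type*} [NormedAddCommGroup W] [NormedSpace ℝ W]

theorem SmoothSL.ofReal {A : W → SL(2, ℝ)} (hA : SmoothSL A) (i j : Fin 2) :
    ContDiff ℝ ∞ fun w => ((A w i j : ℝ) : ℂ) :=
  Complex.ofRealCLM.contDiff.comp (hA i j)

theorem SmoothSL.contDiff_smul_I {A : W → SL(2, ℝ)} (hA : SmoothSL A) :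
    ContDiff ℝ ∞ fun w => ((A w • UpperHalfPlane.I : ℍ) : ℂ) := by
  simp only [coe_SL_smul_I, div_eq_mul_inv]
  exact (((hA.ofReal 0 0).mul contDiff_const).add (hA.ofReal 0 1)).mul
    ((((hA.ofReal 1 0).mul contDiff_const).add (hA.ofReal 1 1)).inv fun w => denom_I_ne_zero _)

theorem SmoothSL.contDiff_derivAtI {A : W → SL(2, ℝ)} (hA : SmoothSL A) :
    ContDiff ℝ ∞ fun w => derivAtI (toPSL (A w)) := by
  simp only [derivAtI_toPSL, one_div]
  exact ((((hA.ofReal 1 0).mul contDiff_const).add (hA.ofReal 1 1)).pow 2).inv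
    fun w => pow_ne_zero 2 (denom_I_ne_zero _)

theorem SmoothSU.contDiff_Ad {B : W → SU2} (hB : SmoothSU B) (i j : Fin 3) :
    ContDiff ℝ ∞ fun w => Ad (toPU (B w)) i j := by
  have h1 := Complex.reCLM.contDiff.comp (hB 0 0)
  have h2 := Complex.imCLM.contDiff.comp (hB 0 0)
  have h3 := Complex.reCLM.contDiff.comp (hB 1 0)
  have h4 := Complex.imCLM.contDiff.comp (hB 1 0)
  simp only [Function.comp_def, Complex.reCLM_apply, Complex.imCLM_apply] at h1 h2 h3 h4
  simp only [Ad_toPU_eq]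
  fin_cases i <;> fin_cases j <;> simp [quatRot] <;> fun_prop

theorem contDiff_frameVec (t : ℝ) {A : W → SL(2, ℝ)} (hA : SmoothSL A) {B : W → SU2}
    (hB : SmoothSU B) (j : Fin 3) :
    ContDiff ℝ ∞ fun w => frameVec t (toPSL (A w)) (toPU (B w)) j := by
  have h1 := fun i => Complex.ofRealCLM.contDiff.comp (hB.contDiff_Ad i j)
  exact (hB.contDiff_Ad 2 j).prodMk (((h1 0).add ((h1 1).mul contDiff_const)).mul
    (hA.contDiff_derivAtI.div_const _))

theorem contMDiff_mk_tangentBundle {F : Type*} [NormedAddCommGroup F] [NormedSpace ℝ F]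
    {e v : W → F}
    (he : ContDiff ℝ ∞ e) (hv : ContDiff ℝ ∞ v) :
    ContMDiff 𝓘(ℝ, W) 𝓘(ℝ, F).tangent ∞ (fun w => (⟨e w, v w⟩ : TangentBundle 𝓘(ℝ, F) F)) := by
  have h1 := he.contMDiff.prodMk hv.contMDiff
  rw [chartedSpaceSelf_prod] at h1
  exact (contMDiff_tangentBundleModelSpaceHomeomorph_symm (I := 𝓘(ℝ, F)) (n := ∞)).comp h1

theorem IsQuotientBy.contMDiff_frame (h : IsQuotientBy Γ pr) (t : ℝ) {A : W → SL(2, ℝ)}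
    (hA : SmoothSL A) {B : W → SU2} (hB : SmoothSU B) (j : Fin 3) :
    ContMDiff 𝓘(ℝ, W) cylModel.tangent ∞
      (fun w => (h.frame t (toPSL (A w)) (toPU (B w))).toTangent j) := by
  let s : Set (ℝ × ℂ) := {e | 0 < e.2.im}
  have hs : IsOpen s := isOpen_lt continuous_const (Complex.continuous_im.comp continuous_snd)
  -- The map `id × pr` read on an open set of `ℝ × ℂ`, where a smooth family of tangent vectors is
  -- just a pair of smooth functions.
  let f : ℝ × ℂ → ℝ × M := fun e => (e.1, pr (UpperHalfPlane.ofComplex e.2))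
  have hf : ContMDiffOn 𝓘(ℝ, ℝ × ℂ) cylModel ∞ f s := fun e he =>
    (contDiff_fst.contMDiff.contMDiffAt.prodMk
      (ContMDiffAt.comp e (h.isLocalDiffeomorph _).contMDiffAt
        (ContMDiffAt.comp e (isLocalDiffeomorphAt_ofComplex he).contMDiffAt
          contDiff_snd.contMDiff.contMDiffAt))).contMDiffWithinAt
  have h1 := hf.contMDiffOn_tangentMapWithin (m := ∞) (by simp) hs.uniqueMDiffOn
  have h2 := contMDiff_mk_tangentBundle (contDiff_const.prodMk hA.contDiff_smul_I)
    (contDiff_frameVec t hA hB j) (e := fun w => (t, ((A w • UpperHalfPlane.I : ℍ) : ℂ)))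
  have h3 := h1.comp_contMDiff h2 fun w => (A w • UpperHalfPlane.I : ℍ).im_pos
  refine h3.congr fun w => ?_
  set z : ℍ := A w • UpperHalfPlane.I with hz
  have hfz : MDifferentiableAt 𝓘(ℝ, ℝ × ℂ) cylModel f (t, (z : ℂ)) :=
    (hf.contMDiffAt (hs.mem_nhds z.im_pos)).mdifferentiableAt (by simp)
  have e : (Prod.map id pr : ℝ × ℍ → ℝ × M) = f ∘ cylDev (fun w : ℍ => (w : ℂ)) := by
    funext q
    refine Prod.ext rfl ?_
    change pr q.2 = pr (UpperHalfPlane.ofComplex (q.2 : ℂ))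
    rw [UpperHalfPlane.ofComplex_apply]
  have h4 := tangentMap_comp_at (I := cylModel) (I' := 𝓘(ℝ, ℝ × ℂ)) (I'' := cylModel)
    (f := cylDev (fun w : ℍ => (w : ℂ)))
    (⟨(t, z), frameVec t (toPSL (A w)) (toPU (B w)) j⟩ : TangentBundle cylModel (ℝ × ℍ)) hfz
    ((isLocalDiffeomorphAt_cylDev (p := (t, z)) (isLocalDiffeomorphAt_coe z)).mdifferentiableAt
      (by simp))
  rw [h.frame_toTangent, toPSL_smul, ← hz, e]
  refine h4.trans ?_
  have h5 : tangentMap cylModel 𝓘(ℝ, ℝ × ℂ) (cylDev (fun w : ℍ => (w : ℂ)))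
      (⟨(t, z), frameVec t (toPSL (A w)) (toPU (B w)) j⟩ : TangentBundle cylModel (ℝ × ℍ)) =
      ⟨(t, (z : ℂ)), frameVec t (toPSL (A w)) (toPU (B w)) j⟩ := by
    refine congrArg (Bundle.TotalSpace.mk ((t, (z : ℂ)) : ℝ × ℂ)) ?_
    refine (mvfderiv_cylDev (p := (t, z)) (isLocalDiffeomorphAt_coe z) _).trans (Prod.ext rfl ?_)
    exact congrArg (fun L : ℂ →L[ℝ] ℂ => L _) (hasMFDerivAt_coe z).mfderiv
  rw [h5]
  exact (tangentMapWithin_eq_tangentMap (p := ⟨(t, (z : ℂ)), _⟩)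
    (hs.uniqueMDiffOn (t, (z : ℂ)) z.im_pos) hfz).symm

end Smoothness

end Isomorphism

/-! ### The derivative of the frame along a curve. -/

section FrameDerivative

/-- Separates the two roles of `λ`: the part on `𝔥` rotates the first two axes, and `r μ₀` couples
them with the third, like a second fundamental form. -/
theorem ad_lam (r : ℝ) (X : Matrix (Fin 2) (Fin 2) ℝ) : ad (lam r X) =
    !![0, -slCoord X 2, r * slCoord X 0; slCoord X 2, 0, r * slCoord X 1;
      -(r * slCoord X 0), -(r * slCoord X 1), 0] := by
  generalize hu : slCoord X = u
  ext i j
  simp only [lam, hu]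
  fin_cases i <;> fin_cases j <;>
    simp [ad, mu0, coord, a, Matrix.trace_fin_two, Matrix.mul_apply, Fin.sum_univ_two] <;> ring

theorem star_lam (r : ℝ) (X : Matrix (Fin 2) (Fin 2) ℝ) : star (lam r X) = -lam r X := by
  generalize hu : slCoord X = u
  ext i j
  simp only [lam, hu]
  fin_cases i <;> fin_cases j <;> simp [mu0, a, Matrix.star_apply] <;> ring

theorem hasDerivAt_matrix_mul {m : Type*} [Fintype m] {X Y : ℝ → Matrix m m ℂ}
    {X' Y' : Matrix m m ℂ}
    {s : ℝ} (hX : ∀ i j, HasDerivAt (fun s => X s i j) (X' i j) s)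
    (hY : ∀ i j, HasDerivAt (fun s => Y s i j) (Y' i j) s) (i j : m) :
    HasDerivAt (fun s => (X s * Y s) i j) ((X' * Y s + X s * Y') i j) s := by
  simp only [Matrix.mul_apply, Matrix.add_apply, ← Finset.sum_add_distrib]
  exact HasDerivAt.fun_sum fun k _ => (hX i k).mul (hY k j)

theorem coord_sub (X Y : Matrix (Fin 2) (Fin 2) ℂ) (i : Fin 3) :
    coord (X - Y) i = coord X i - coord Y i := by
  simp [coord, mul_sub]

theorem hasDerivAt_coord {X : ℝ → Matrix (Fin 2) (Fin 2) ℂ} {X' : Matrix (Fin 2) (Fin 2) ℂ}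
    {s : ℝ} (hX : ∀ i j, HasDerivAt (fun s => X s i j) (X' i j) s) (i : Fin 3) :
    HasDerivAt (fun s => coord (X s) i) (coord X' i) s := by
  have h := hasDerivAt_matrix_mul (X := fun _ => a i) (X' := 0)
    (fun k l => hasDerivAt_const s (a i k l)) hX
  have h1 := ((h 0 0).add (h 1 1)).const_mul (-2)
  have h2 := Complex.reCLM.hasFDerivAt.comp_hasDerivAt s h1
  simp only [coord, Matrix.trace_fin_two]
  convert! h2 using 1
  simp [Matrix.mul_apply]

variable {A : ℝ → SL(2, ℝ)} {B : ℝ → SU2}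

theorem SmoothSU.hasDerivAt (hB : SmoothSU B) (s : ℝ) (i j : Fin 2) :
    HasDerivAt (fun s => (B s).1 i j)
      ((Matrix.of fun i j => deriv (fun s => (B s).1 i j) s : Matrix (Fin 2) (Fin 2) ℂ) i j) s :=
  ((hB i j).differentiable (by simp) s).hasDerivAt

/-- With `L = λ(A⁻¹A')`, the definition of `ω` gives `B' = B ω - L B`; the formula is the image of
this equation under the adjoint representation. -/
theorem SmoothSU.hasDerivAt_Ad (hB : SmoothSU B) (r : ℝ) (A : ℝ → SL(2, ℝ)) (s : ℝ) (i j : Fin 3) :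
    HasDerivAt (fun s => Ad (toPU (B s)) i j)
      (∑ k, Ad (toPU (B s)) i k * ad (connForm r A B s) k j -
        ∑ k, ad (lam r (((A s)⁻¹).1 * Matrix.of fun i j => deriv (fun s => A s i j) s)) i k *
          Ad (toPU (B s)) k j) s := by
  have hL := star_lam r (((A s)⁻¹).1 * Matrix.of fun i j => deriv (fun s => A s i j) s)
  have hd := hB.hasDerivAt s
  have hω : connForm r A B s = star (B s).1 * lam r _ * (B s).1 + star (B s).1 * _ := rfl
  rw [hω]
  generalize lam r (((A s)⁻¹).1 * Matrix.of fun i j => deriv (fun s => A s i j) s) = L at *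
  generalize (Matrix.of fun i j => deriv (fun s => (B s).1 i j) s :
    Matrix (Fin 2) (Fin 2) ℂ) = B' at *
  have hs : ∀ i j, HasDerivAt (fun s => (star (B s).1) i j) ((star B') i j) s :=
    fun i j => (hd j i).star
  have h1 := (B s).mul_star
  have h2 := (B s).star_mul
  -- Derivative of `B B* = 1`.
  have hBB : B' * star (B s).1 + (B s).1 * star B' = 0 := by
    ext i j
    have h3 := hasDerivAt_matrix_mul hd hs i j
    simp only [fun s => (B s).mul_star] at h3
    exact h3.unique (hasDerivAt_const _ _)
  have hBB' : star B' * (B s).1 = -(star (B s).1 * B') := by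
    have : star (B s).1 * (B' * star (B s).1 + (B s).1 * star B') * (B s).1 = 0 := by
      rw [hBB, mul_zero, zero_mul]
    rw [mul_add, add_mul, ← mul_assoc, mul_assoc _ _ (B s).1, h2, mul_one, ← mul_assoc, h2,
      one_mul] at this
    exact eq_neg_of_add_eq_zero_right this
  -- Skewness of `ω` places its commutators with the `a_j` in `su(2)`, where they are recovered from
  -- their coordinates.
  have hωs : star (star (B s).1 * L * (B s).1 + star (B s).1 * B') =
      -(star (B s).1 * L * (B s).1 + star (B s).1 * B') := by
    rw [star_add, star_mul, star_mul, star_mul, star_star, hL, hBB', neg_add]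
    simp only [neg_mul, mul_neg, mul_assoc]
  have h4 := hasDerivAt_coord (hasDerivAt_matrix_mul
    (hasDerivAt_matrix_mul hd (fun k l => hasDerivAt_const s (a j k l)) (Y' := 0)) hs) i
  refine h4.congr_deriv ?_
  have e1 : ∑ k, ad L i k * Ad (toPU (B s)) k j = _ := sum_coord_ad L ((isSkew_a j).conj (B s)) i
  have e2 : ∑ k, Ad (toPU (B s)) i k *
      ad (star (B s).1 * L * (B s).1 + star (B s).1 * B') k j = _ :=
    sum_coord_conj (B s) (IsSkew.commutator hωs (isSkew_a j).1) i
  rw [e1, e2, ← coord_sub]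
  congr 1
  generalize (B s).1 = b, a j = x at *
  have hb : B' * star b = -(b * star B') := eq_neg_of_add_eq_zero_left hBB
  have e3 : b * ((star b * L * b + star b * B') * x) * star b =
      L * (b * x * star b) + B' * x * star b := by
    have : b * ((star b * L * b + star b * B') * x) * star b =
      (b * star b) * L * b * x * star b + (b * star b) * B' * x * star b := by noncomm_ring
    rw [this, h1]
    noncomm_ring
  have e4 : b * (x * (star b * L * b + star b * B')) * star b =
      b * x * star b * L - b * x * star B' := by
    have : b * (x * (star b * L * b + star b * B')) * star b =
      b * x * star b * L * (b * star b) + b * x * star b * (B' * star b) := by noncomm_ring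
    rw [this, h1, hb]
    have : b * x * star b * -(b * star B') = -(b * x * (star b * b) * star B') := by noncomm_ring
    rw [this, h2]
    noncomm_ring
  rw [mul_sub, sub_mul, e3, e4]
  noncomm_ring

/-- The tangent vector `X · i` for an element `X` of `sl(2, ℝ)`. -/
def velocityAtI (X : Matrix (Fin 2) (Fin 2) ℝ) : ℂ := slCoord X 0 + slCoord X 1 * Complex.I

theorem SmoothSL.hasDerivAt (hA : SmoothSL A) (s : ℝ) (i j : Fin 2) :
    HasDerivAt (fun s => ((A s i j : ℝ) : ℂ)) (deriv (fun s => A s i j) s : ℝ) s :=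
  ((hA i j).differentiable (by simp) s).hasDerivAt.ofReal_comp

theorem SmoothSL.trace_eq_zero (hA : SmoothSL A) (s : ℝ) :
    deriv (fun s => A s 0 0) s * A s 1 1 + A s 0 0 * deriv (fun s => A s 1 1) s -
      (deriv (fun s => A s 0 1) s * A s 1 0 + A s 0 1 * deriv (fun s => A s 1 0) s) = 0 := by
  have h := fun i j => ((hA i j).differentiable (by simp) s).hasDerivAt
  have h1 := ((h 0 0).mul (h 1 1)).sub ((h 0 1).mul (h 1 0))
  exact h1.unique ((hasDerivAt_const s (1 : ℝ)).congr_of_eventuallyEq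
    (Filter.Eventually.of_forall fun s => det_SL (A s)))

/-- The left logarithmic derivative of a curve. -/
def logDerivSL (A : ℝ → SL(2, ℝ)) (s : ℝ) : Matrix (Fin 2) (Fin 2) ℝ :=
  ((A s)⁻¹).1 * Matrix.of fun i j => deriv (fun s => A s i j) s

theorem logDerivSL_eq (A : ℝ → SL(2, ℝ)) (s : ℝ) : logDerivSL A s =
    !![A s 1 1 * deriv (fun s => A s 0 0) s - A s 0 1 * deriv (fun s => A s 1 0) s,
      A s 1 1 * deriv (fun s => A s 0 1) s - A s 0 1 * deriv (fun s => A s 1 1) s;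
      -(A s 1 0) * deriv (fun s => A s 0 0) s + A s 0 0 * deriv (fun s => A s 1 0) s,
      -(A s 1 0) * deriv (fun s => A s 0 1) s + A s 0 0 * deriv (fun s => A s 1 1) s] := by
  unfold logDerivSL
  rw [Matrix.SpecialLinearGroup.coe_inv, Matrix.adjugate_fin_two]
  ext i j
  fin_cases i <;> fin_cases j <;> simp [Matrix.mul_apply, Fin.sum_univ_two] <;> ring

/-- By left invariance the velocity is the image under `g'(i)` of the vector `X · i`, where `X =
A⁻¹A'`. -/
theorem SmoothSL.hasDerivAt_smul_I (hA : SmoothSL A) (s : ℝ) :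
    HasDerivAt (fun s => ((A s • UpperHalfPlane.I : ℍ) : ℂ))
      (derivAtI (toPSL (A s)) * velocityAtI (logDerivSL A s)) s := by
  simp only [coe_SL_smul_I]
  have h := hA.hasDerivAt s
  refine ((((h 0 0).mul_const Complex.I).add (h 0 1)).div
    (((h 1 0).mul_const Complex.I).add (h 1 1)) (denom_I_ne_zero (A s))).congr_deriv ?_
  have ht := hA.trace_eq_zero s
  rw [derivAtI_toPSL, velocityAtI, logDerivSL_eq]
  simp only [slCoord]
  have ht' := congrArg (fun x : ℝ => (x : ℂ)) ht
  rw [one_div, ← div_eq_inv_mul]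
  congr 1
  simp at ht' ⊢
  linear_combination ((deriv (fun s => A s 0 0) s : ℝ) * A s 1 0 -
    A s 0 0 * (deriv (fun s => A s 1 0) s : ℝ) : ℂ) * Complex.I_sq - Complex.I * ht'

/-- The second term is the Christoffel term of `ℍ`, so the formula says that the covariant
derivative of `g'(i)` along `g i` is `i u₃ g'(i)`: the Levi-Civita connection of `ℍ` is the one
given by the `𝔥`-part. -/
theorem SmoothSL.hasDerivAt_derivAtI (hA : SmoothSL A) (s : ℝ) :
    HasDerivAt (fun s => derivAtI (toPSL (A s)))
      (derivAtI (toPSL (A s)) * (Complex.I * slCoord (logDerivSL A s) 2) -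
        Complex.I * derivAtI (toPSL (A s)) ^ 2 * velocityAtI (logDerivSL A s) /
          (A s • UpperHalfPlane.I : ℍ).im) s := by
  have h := hA.hasDerivAt s
  have hj := denom_I_ne_zero (A s)
  have hadd : HasDerivAt (fun s => (A s 1 0 : ℂ) * Complex.I + A s 1 1)
      ((deriv (fun s => A s 1 0) s : ℝ) * Complex.I + (deriv (fun s => A s 1 1) s : ℝ)) s :=
    ((h 1 0).mul_const Complex.I).add (h 1 1)
  have hder := (hadd.fun_pow 2).fun_inv (pow_ne_zero 2 hj)
  have hy : (((A s • UpperHalfPlane.I : ℍ).im : ℝ) : ℂ) =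
      1 / ((A s 1 0 * Complex.I + A s 1 1) * (A s 1 1 - A s 1 0 * Complex.I)) := by
    rw [im_SL_smul_I, Complex.ofReal_div, ← Complex.mul_conj]
    simp [sub_eq_add_neg, add_comm]
  -- With `j = ci + d`, one has `g'(i) = j⁻²`, whose derivative is `-2 j' j⁻³`; this is the required
  -- formula after multiplication by `j³`.
  have key : -2 * ((deriv (fun s => A s 1 0) s : ℝ) * Complex.I +
      (deriv (fun s => A s 1 1) s : ℝ)) =
      Complex.I * slCoord (logDerivSL A s) 2 * (A s 1 0 * Complex.I + A s 1 1) -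
        Complex.I * velocityAtI (logDerivSL A s) * (A s 1 1 - A s 1 0 * Complex.I) := by
    have ht := congrArg (fun x : ℝ => (x : ℂ)) (hA.trace_eq_zero s)
    have hd := congrArg (fun x : ℝ => (x : ℂ)) (det_SL (A s))
    simp only [velocityAtI, slCoord, logDerivSL_eq]
    simp at ht hd ⊢
    linear_combination 2 * ((deriv (fun s => A s 1 0) s : ℝ) * Complex.I +
      (deriv (fun s => A s 1 1) s : ℝ)) * hd - 2 * A s 1 1 * ht + 2 *
      ((deriv (fun s => A s 1 0) s : ℝ) * A s 0 1 * (A s 1 0 * Complex.I - A s 1 1) +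
        (deriv (fun s => A s 1 1) s : ℝ) * A s 1 0 * A s 0 1 -
        (deriv (fun s => A s 0 1) s : ℝ) * A s 1 0 * A s 1 1 +
        (deriv (fun s => A s 0 0) s : ℝ) * A s 1 1 * (A s 1 1 - A s 1 0 * Complex.I)) * Complex.I_sq
  simp only [derivAtI_toPSL, one_div]
  refine hder.congr_deriv ?_
  rw [hy]
  simp only [Nat.cast_ofNat, Nat.add_one_sub_one, pow_one]
  field_simp
  linear_combination key

/-- Parallel transport on an oriented surface commutes with multiplication by `i`, so the symbol of
`|dz|²/y²` is the complex bilinear form `i v w / y`. This form matches the derivative of `g'(i)`. -/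
theorem warpChr_horizontal (e v : ℝ × ℂ) (w : ℂ) : warpChr e v (0, w) =
    (-(Real.cosh e.1 * Real.sinh e.1 / e.2.im ^ 2 * (v.2 * star w).re),
      Complex.I * v.2 * w / e.2.im + (Real.sinh e.1 / Real.cosh e.1 : ℝ) * v.1 * w) := by
  rw [warpChr_apply]
  simp only
  generalize Real.cosh e.1 = C, Real.sinh e.1 = S
  refine Prod.ext ?_ (Complex.ext ?_ ?_)
  · simp
  · simp [Complex.div_ofReal_re]
    ring
  · simp [Complex.div_ofReal_im]
    ring

/-- The frame equation in coordinates. In the derivative of `Q`, the term `Q ad(ω)` gives the sum.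
In the remainder, `u₃` cancels against the derivative of `g'(i)`; the term in `g'(i)²` is the symbol
of `ℍ`; and `sinh t` produces the terms of `warpChr` due to the warping, the `∂_t` component using
`|g'(i)| = Im (g i)`. -/
theorem hasDerivAt_frameVec (hA : SmoothSL A) (hB : SmoothSU B) (t s : ℝ) (j : Fin 3) :
    HasDerivAt (fun s => frameVec t (toPSL (A s)) (toPU (B s)) j)
      (∑ i, ad (connForm (Real.sinh t) A B s) i j • frameVec t (toPSL (A s)) (toPU (B s)) i -
        warpChr (t, ((A s • UpperHalfPlane.I : ℍ) : ℂ)) (frameVec t (toPSL (A s)) (toPU (B s)) j)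
          (0, derivAtI (toPSL (A s)) * velocityAtI (logDerivSL A s))) s := by
  have hD := fun i => hB.hasDerivAt_Ad (Real.sinh t) A s i j
  have hc := hA.hasDerivAt_derivAtI s
  refine ((hD 2).prodMk ((((hD 0).ofReal_comp).add ((hD 1).ofReal_comp.mul_const Complex.I)).mul
    (hc.div_const (Real.cosh t : ℂ)))).congr_deriv ?_
  rw [show ((A s)⁻¹).1 * Matrix.of (fun i j => deriv (fun s => A s i j) s) = logDerivSL A s
      from rfl,
    ad_lam, warpChr_horizontal]
  have hC := (Real.cosh_pos t).ne'
  have hy := (A s • UpperHalfPlane.I : ℍ).im_pos.ne'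
  have hn := normSq_derivAtI (toPSL (A s))
  rw [Complex.normSq_apply, toPSL_smul] at hn
  simp only [frameVec, frameCol, velocityAtI, UpperHalfPlane.coe_im, Fin.sum_univ_three]
  generalize Real.cosh t = C, Real.sinh t = S, (A s • UpperHalfPlane.I : ℍ).im = y,
    derivAtI (toPSL (A s)) = c, ad _ = W, slCoord (logDerivSL A s) = u at *
  generalize hQ : Ad (toPU (B s)) = Q
  refine Prod.ext ?_ ?_
  · simp [Complex.div_ofReal_re, Complex.div_ofReal_im]
    field_simp
    linear_combination -(S * (u 0 * Q 0 j + u 1 * Q 1 j)) * hn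
  · simp [hQ]
    linear_combination ((Q 1 j : ℂ) * u 2 * (c / C)) * Complex.I_sq

end FrameDerivative

/-! ### Comparison of the connections on the quotient. -/

section Connection

variable {M : Type*} [TopologicalSpace M] [ChartedSpace ℂ M] {Γ : Subgroup PSL(2, ℝ)} {pr : ℍ → M}
  {A : ℝ → SL(2, ℝ)} {B : ℝ → SU2}

theorem SmoothSL.contMDiff_orbit (hA : SmoothSL A) :
    ContMDiff 𝓘(ℝ, ℝ) 𝓘(ℝ, ℂ) ∞ fun s => (toPSL (A s) • UpperHalfPlane.I : ℍ) := by
  intro s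
  refine (((isLocalDiffeomorphAt_ofComplex (A s • UpperHalfPlane.I : ℍ).im_pos).contMDiffAt).comp s
    hA.contDiff_smul_I.contMDiff.contMDiffAt).congr_of_eventuallyEq
    (Filter.Eventually.of_forall fun s => ?_)
  exact (toPSL_smul _ _).trans (UpperHalfPlane.ofComplex_apply _).symm

variable [IsManifold 𝓘(ℝ, ℂ) ∞ M]

/-- The connection equation, for a lift of the curve which is adapted to the chosen chart. -/
theorem IsQuotientBy.hasCovDerivAlong_frame_of_adapted (h : IsQuotientBy Γ pr) (hA : SmoothSL A)
    (hB : SmoothSU B) (t s : ℝ) (j : Fin 3)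
    (hz : ∀ᶠ w in 𝓝 (toPSL (A s) • UpperHalfPlane.I : ℍ),
      h.dev (pr (toPSL (A s) • UpperHalfPlane.I)) (pr w) = w) :
    HasCovDerivAlong h.cylCov (fun s => slice t (h.frame t (toPSL (A s)) (toPU (B s))).pt)
      (fun s => (h.frame t (toPSL (A s)) (toPU (B s))).vec j) s
      (∑ i, ad (connForm (Real.sinh t) A B s) i j •
        (h.frame t (toPSL (A s)) (toPU (B s))).vec i) := by
  set φ := h.dev (pr (toPSL (A s) • UpperHalfPlane.I)) with hφdef
  have hφ : IsDev pr φ (pr (toPSL (A s) • UpperHalfPlane.I)) := h.isDev_dev _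
  have hc := hA.contMDiff_orbit s
  have hpr := (h.isLocalDiffeomorph (toPSL (A s) • UpperHalfPlane.I : ℍ)).contMDiffAt
  have hγ : MDifferentiableAt 𝓘(ℝ, ℝ) cylModel
      (fun s => slice t (pr (toPSL (A s) • UpperHalfPlane.I))) s :=
    (contMDiffAt_const.prodMk (hpr.comp s hc)).mdifferentiableAt (by simp)
  have hcoord : ∀ᶠ s' in 𝓝 s, ∀ v : ℝ × ℂ, mvfderiv cylModel (cylDev φ)
      (slice t (pr (toPSL (A s') • UpperHalfPlane.I)))
      (mfderiv cylModel cylModel (Prod.map id pr : ℝ × ℍ → ℝ × M)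
        (t, toPSL (A s') • UpperHalfPlane.I) v) = v := by
    filter_upwards [hc.continuousAt.eventually (eventually_eventually_nhds.2 hz),
      (hpr.comp s hc).continuousAt.eventually hφ.eventually] with s' h1 h2 v
    refine (h.mvfderiv_cylDev_mfderiv_idpr h2 (A := 1) ?_ t v).trans ?_
    · filter_upwards [h1] with w hw
      rw [hw, one_smul]
    · simp
  have hvel : mvfderiv cylModel (cylDev φ) (slice t (pr (toPSL (A s) • UpperHalfPlane.I)))
      (velocity cylModel (fun s => slice t (pr (toPSL (A s) • UpperHalfPlane.I))) s) =
      (0, derivAtI (toPSL (A s)) * velocityAtI (logDerivSL A s)) := by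
    have h1 := HasMFDerivAt.comp s ((isLocalDiffeomorphAt_cylDev
      (p := slice t (pr (toPSL (A s) • UpperHalfPlane.I))) hφ.1).mdifferentiableAt
        (by simp)).hasMFDerivAt hγ.hasMFDerivAt
    have h2 := ((hasDerivAt_const s t).prodMk (hA.hasDerivAt_smul_I s)).hasFDerivAt.hasMFDerivAt
    have h3 := hasMFDerivAt_unique h1 (h2.congr_of_eventuallyEq ?_)
    · refine (congrArg (fun L : ℝ →L[ℝ] ℝ × ℂ => L 1) h3).trans ?_
      simp
    · filter_upwards [hc.continuousAt.eventually hz] with s' hs'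
      refine Prod.ext rfl ?_
      exact hs'.trans (by rw [toPSL_smul])
  refine hasCovDerivAlong_chartCov hγ (f := fun s => frameVec t (toPSL (A s)) (toPU (B s)) j)
    (hcoord.mono fun s' hs' => hs' _) (hasDerivAt_frameVec hA hB t s j) ?_
  have hsum : mvfderiv cylModel (cylDev φ) (slice t (pr (toPSL (A s) • UpperHalfPlane.I)))
      (∑ i, ad (connForm (Real.sinh t) A B s) i j •
        (h.frame t (toPSL (A s)) (toPU (B s))).vec i) =
      ∑ i, ad (connForm (Real.sinh t) A B s) i j • frameVec t (toPSL (A s)) (toPU (B s)) i := by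
    refine (map_sum _ _ _).trans (Finset.sum_congr rfl fun i _ => ?_)
    refine (map_smul _ _ _).trans ?_
    exact congrArg _ (hcoord.self_of_nhds _)
  have hpt : cylDev φ (slice t (pr (toPSL (A s) • UpperHalfPlane.I))) =
      (t, ((A s • UpperHalfPlane.I : ℍ) : ℂ)) :=
    Prod.ext rfl (hz.self_of_nhds.trans (by rw [toPSL_smul]))
  refine hsum.trans ?_
  refine Eq.trans ?_ (congrArg₂ (fun e v => _ - warpChr (t, ((A s • UpperHalfPlane.I : ℍ) : ℂ))
    (frameVec t (toPSL (A s)) (toPU (B s)) j) (0, derivAtI (toPSL (A s)) *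
      velocityAtI (logDerivSL A s)) + warpChr e (frameVec t (toPSL (A s)) (toPU (B s)) j) v)
    hpt.symm hvel.symm)
  exact (sub_add_cancel _ _).symm

theorem SmoothSL.const_mul (hA : SmoothSL A) (C : SL(2, ℝ)) : SmoothSL fun s => C * A s := by
  intro i j
  have : (fun s => (C * A s) i j) = fun s => C i 0 * A s 0 j + C i 1 * A s 1 j := by
    funext s
    simp [Matrix.mul_apply, Fin.sum_univ_two]
  rw [this]
  exact (contDiff_const.mul (hA 0 j)).add (contDiff_const.mul (hA 1 j))

/-- The left Maurer-Cartan form is invariant under left translations. -/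
theorem connForm_const_mul (hA : SmoothSL A) (C : SL(2, ℝ)) (r s : ℝ) :
    connForm r (fun s => C * A s) B s = connForm r A B s := by
  have e : (Matrix.of fun i j => deriv (fun s => (C * A s) i j) s : Matrix (Fin 2) (Fin 2) ℝ) =
      C.1 * Matrix.of fun i j => deriv (fun s => A s i j) s := by
    ext i j
    have h1 := fun k => (((hA k j).differentiable (by simp) s).hasDerivAt.const_mul (C i k))
    have h2 := ((h1 0).add (h1 1)).deriv
    rw [Matrix.mul_apply, Fin.sum_univ_two]
    refine Eq.trans (congrArg (fun f => deriv f s) (funext fun s => ?_)) h2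
    simp [Matrix.mul_apply, Fin.sum_univ_two]
  have hC : (C⁻¹).1 * C.1 = 1 := by
    rw [← Matrix.SpecialLinearGroup.coe_mul, inv_mul_cancel, Matrix.SpecialLinearGroup.coe_one]
  have e2 : ((C * A s)⁻¹).1 * (C.1 * Matrix.of fun i j => deriv (fun s => A s i j) s) =
      ((A s)⁻¹).1 * Matrix.of fun i j => deriv (fun s => A s i j) s := by
    rw [mul_inv_rev, Matrix.SpecialLinearGroup.coe_mul, Matrix.mul_assoc, ← Matrix.mul_assoc _ C.1,
      hC, Matrix.one_mul]
  rw [connForm, connForm, e, e2]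

/-- The chart chosen at the base point lifts it to `C • (A(s) i)` for some `C` in `Γ`. Replacing `A`
by `C A` changes neither the frame nor the connection form, and makes the lift adapted to the chart.
-/
theorem IsQuotientBy.hasCovDerivAlong_frame (h : IsQuotientBy Γ pr) (hA : SmoothSL A)
    (hB : SmoothSU B) (t s : ℝ) (j : Fin 3) :
    HasCovDerivAlong h.cylCov (fun s => slice t (h.frame t (toPSL (A s)) (toPU (B s))).pt)
      (fun s => (h.frame t (toPSL (A s)) (toPU (B s))).vec j) s
      (∑ i, ad (connForm (Real.sinh t) A B s) i j •
        (h.frame t (toPSL (A s)) (toPU (B s))).vec i) := by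
  obtain ⟨C, hC, he⟩ := h.isDev_comp_pr (h.isDev_dev (pr (toPSL (A s) • UpperHalfPlane.I)))
  have hF : (fun s => h.frame t (toPSL (A s)) (toPU (B s))) =
      fun s => h.frame t (toPSL (C * A s)) (toPU (B s)) :=
    funext fun s => (h.frame_smul t hC _ _).symm
  have hpr : ∀ w : ℍ, pr (C • w) = pr w := fun w =>
    ((h.eq_iff _ _).2 ⟨toPSL C, hC, toPSL_smul C w⟩).symm
  have hCA : ∀ s, (toPSL (C * A s) • UpperHalfPlane.I : ℍ) =
      C • (toPSL (A s) • UpperHalfPlane.I : ℍ) := fun s => by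
    rw [toPSL_smul, toPSL_smul, mul_smul]
  have key := h.hasCovDerivAlong_frame_of_adapted (hA.const_mul C) hB t s j (by
    have hc := (continuous_SL_smul C⁻¹).tendsto (C • (toPSL (A s) • UpperHalfPlane.I : ℍ))
    rw [inv_smul_smul] at hc
    simp only [hCA, hpr]
    filter_upwards [hc.eventually he] with w hw
    rw [smul_inv_smul] at hw
    rw [← hw, ← hpr (C⁻¹ • w), smul_inv_smul])
  rw [connForm_const_mul hA] at key
  -- The whole curve of frames is replaced at once, since the types of its vectors depend on its
  -- base points.
  exact (congrArg (fun F : ℝ → SOFrame pr h.cylMetric t =>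
    HasCovDerivAlong h.cylCov (fun s => slice t (F s).pt) (fun s => (F s).vec j) s
      (∑ i, ad (connForm (Real.sinh t) A B s) i j • (F s).vec i)) hF).mpr key

theorem IsQuotientBy.isIsomorphism_toFrame (h : IsQuotientBy Γ pr) (t : ℝ) :
    IsIsomorphism Γ h.cylCov (Real.sinh t) (h.toFrame t) where
  bijective := ⟨h.toFrame_injective t, h.toFrame_surjective t⟩
  covers _ _ := rfl
  equivariant g k k' j := congrArg
    (Bundle.TotalSpace.mk (slice t (pr (g • UpperHalfPlane.I)))) (h.frame_mul_vec t g k k' j)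
  smooth _ _ _ hA hB j := h.contMDiff_frame t hA hB j
  connection _ _ hA hB s j := h.hasCovDerivAlong_frame hA hB t s j

end Connection

end HypCyl

end

theorem mainTheorem4 (Γ : Subgroup PSL(2, ℝ)) [ProperlyDiscontinuousSMul Γ ℍ]
    {M : Type*} [TopologicalSpace M] [CompactSpace M] [ChartedSpace ℂ M] [IsManifold 𝓘(ℝ, ℂ) ∞ M]
    (pr : ℍ → M) (hpr : HypCyl.IsQuotientBy Γ pr) :
    ∃ g : Bundle.ContMDiffRiemannianMetric HypCyl.cylModel ∞ (ℝ × ℂ)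
        (fun p : ℝ × M => TangentSpace HypCyl.cylModel p),
      HypCyl.IsHyperbolicMetric 2 (fun (p : ℝ × M) u v => g.inner p u v) ∧
      ∃ cov : CovariantDerivative HypCyl.cylModel (ℝ × ℂ)
          (TangentSpace HypCyl.cylModel : ℝ × M → Type _),
        HypCyl.IsLeviCivita g cov ∧
        (HypCyl.IsTotallyGeodesic 𝓘(ℝ, ℂ) cov (HypCyl.slice 0 : M → ℝ × M) ∧
          HypCyl.IsHyperbolicMetric 1
            (HypCyl.inducedMetric 𝓘(ℝ, ℂ) g (HypCyl.slice 0 : M → ℝ × M))) ∧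
        (∀ x : M, HypCyl.IsGeodesic cov (fun t : ℝ => (t, x))) ∧
        ∀ t : ℝ,
          HypCyl.IsUmbilic 𝓘(ℝ, ℂ) g cov (HypCyl.slice t : M → ℝ × M) ∧
          ∃ Φ : HypCyl.GammaQuotient Γ → HypCyl.SOFrame pr g t,
            HypCyl.IsIsomorphism Γ cov (Real.sinh t) Φ :=
  ⟨hpr.cylMetric, hpr.isHyperbolicMetric_cylMetric, hpr.cylCov, hpr.isLeviCivita_cylCov,
    ⟨hpr.isTotallyGeodesic_slice, hpr.isHyperbolicMetric_slice⟩, hpr.isGeodesic_line,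
    fun t => ⟨hpr.isUmbilic_slice t, hpr.toFrame t, hpr.isIsomorphism_toFrame t⟩⟩
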